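/- Let $K\ge 2$ be fixed. Write $\Delta^{K-1}=\{q\in\mathbb R^K: q_i\ge 0,\ \sum_i q_i=1\}$, with relative interior $\mathring\Delta^{K-1}=\{q\in\Delta^{K-1}: q_i>0 \text{ for all } i\}$, and let $\mathcal H=\{v\in\mathbb R^K:\sum_i v_i=0\}$. Let $W\in[0,1]^{K\times K}$ be a symmetric weight matrix such that the graph on $\{1,\dots,K\}$ with an edge between $i\ne j$ whenever $W_{ij}\neq 0$ is connected. Let $L=D-W$ be its Laplacian, where $D$ is diagonal with $D_{ii}=\sum_j W_{ij}$. **Prior.** For fixed $a_q,b_q,a_C,b_C>0$, the prior $\Pi$ on pairs $(q,C)$, with $q\in\Delta^{K-1}$ and $C$ a column-stochastic $K\times K$ matrix, is given by independent $\tau_q\sim\mathrm{Gamma}(a_q,b_q)$ and $\tau_C\sim\mathrm{Gamma}(a_C,b_C)$ (shape, rate) and $$q=\mathrm{softmax}(\theta),\qquad C_{:,i}=\mathrm{softmax}(\phi_i)\quad(i=1,\dots,K).$$ Here, given $(\tau_q,\tau_C)$, the vectors $\theta,\phi_1,\dots,\phi_K\in\mathcal H$ are independent. The vector $\theta$ has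 density proportional to $\exp(-\tfrac{\tau_q}{2}\theta^\top L\theta)$ and each $\phi_i$ has density proportional to $\exp(-\tfrac{\tau_C}{2}\phi_i^\top L\phi_i)$, with respect to Lebesgue measure on $\mathcal H$. **Data.** Let $q_0\in\mathring\Delta^{K-1}$, and let $C_0\in(0,1)^{K\times K}$ satisfy $\sum_j (C_0)_{j,i}=1$ for all $i$ and $\det C_0\ne 0$. For sample sizes $n_1^S,\dots,n_K^S,n'\in\mathbb N$, the data consist of independent count vectors $$N_i^S\sim\mathrm{Multi}(n_i^S,(C_0)_{:,i})\quad(i=1,\dots,K),\qquad \tilde N\sim\mathrm{Multi}(n',C_0q_0).$$ Let $\mathbb P_{(q_0,C_0)}$ denote their joint law. The posterior $\Pi(\cdot\mid\text{data})$ is obtained from $\Pi$ by Bayes' formula with the likelihood $$\Big[\prod_{i=1}^K\mathrm{Multi}(N_i^S;n_i^S,C_{:,i})\Big]\,\mathrm{Multi}(\tilde N;n',Cq).$$ For all sample sizes it is, $\mathbb P_{(q_0,C_0)}$-almost surely, a well-defined probability measure. **Claim.** Consider a sequence of sample sizes all of which diverge: $\min_i n_i^S\to\infty$ and $n'\to\infty$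 (hence also $N:=n'+\sum_i n_i^S\to\infty$). No relation between the rates of divergence is assumed. For $\varepsilon>0$ let $$B_\varepsilon=\{(q,C):\ \|q-q_0\|_2<\varepsilon,\ \|C-C_0\|_F<\varepsilon\}.$$ Then, for every $\varepsilon>0$, $\Pi(B_\varepsilon^c\mid\text{data})\to 0$ in $\mathbb P_{(q_0,C_0)}$-probability, that is, for every $\delta>0$, $$\mathbb P_{(q_0,C_0)}\big(\Pi(B_\varepsilon^c\mid\text{data})>\delta\big)\to 0 .$$ -/

import Mathlib

open MeasureTheory ProbabilityTheory Filter Topology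
open scoped ENNReal Matrix

noncomputable section

namespace LabelShift

variable {K : ℕ}

/-! ### The label graph and its Laplacian -/

/-- The graph on the labels whose edges are the pairs of distinct labels with nonzero weight. -/
def similarityGraph (W : Matrix (Fin K) (Fin K) ℝ) : SimpleGraph (Fin K) :=
  SimpleGraph.fromRel fun i j => W i j ≠ 0

/-- The unnormalised Laplacian `L = D - W`, where `D` is diagonal with `D i i = ∑ j, W i j`. -/
def laplacian (W : Matrix (Fin K) (Fin K) ℝ) : Matrix (Fin K) (Fin K) ℝ :=
  Matrix.diagonal (fun i => ∑ j, W i j) - W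

/-! ### Parameters -/

/-- The (relative) interior of the probability simplex. -/
def openSimplex (K : ℕ) : Set (Fin K → ℝ) :=
  {q | (∀ i, 0 < q i) ∧ ∑ i, q i = 1}

instance instMeasurableSpaceMatrix : MeasurableSpace (Matrix (Fin K) (Fin K) ℝ) :=
  inferInstanceAs (MeasurableSpace (Fin K → Fin K → ℝ))

/-- A parameter `(q, C)`: the target class prior `q` and the confusion matrix `C`, where `C j i`
is the probability of predicting `j` when the true class is `i`. -/
abbrev Param (K : ℕ) : Type := (Fin K → ℝ) × Matrix (Fin K) (Fin K) ℝ

/-- The set of all `(q, C)` with `‖q - q₀‖₂ < ε` (Euclidean norm) and `‖C - C₀‖_F < ε`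
(Frobenius norm). -/
def paramBall (q₀ : Fin K → ℝ) (C₀ : Matrix (Fin K) (Fin K) ℝ) (ε : ℝ) : Set (Param K) :=
  {x | √(∑ i, (x.1 i - q₀ i) ^ 2) < ε ∧ √(∑ j, ∑ i, (x.2 j i - C₀ j i) ^ 2) < ε}

/-! ### Multinomial sampling -/

/-- The multinomial probability mass function with `n` trials and cell probabilities `p`. -/
def multinomialMass (n : ℕ) (p : Fin K → ℝ) (k : Fin K → ℕ) : ℝ :=
  if ∑ j, k j = n then (Nat.multinomial Finset.univ k : ℝ) * ∏ j, p j ^ k j else 0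

/-- The multinomial distribution with `n` trials and cell probabilities `p`. -/
def multinomialLaw (n : ℕ) (p : Fin K → ℝ) : Measure (Fin K → ℕ) :=
  ∑ k ∈ Finset.piAntidiag Finset.univ n,
    ENNReal.ofReal (multinomialMass n p k) • Measure.dirac k

/-- The data: the counts `N i j` of predictions `j` among the source examples with true class `i`,
and the counts of predictions on the unlabelled target examples. -/
abbrev Data (K : ℕ) : Type := (Fin K → Fin K → ℕ) × (Fin K → ℕ)

/-- The law of the data under `(q, C)`: the `K + 1` count vectors are independent, the `i`-th
source vector is multinomial with `nS i` trials and cell probabilities the `i`-th column of `C`,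
and the target vector is multinomial with `nT` trials and cell probabilities `C q`. -/
def dataLaw (nS : Fin K → ℕ) (nT : ℕ) (x : Param K) : Measure (Data K) :=
  (Measure.pi fun i => multinomialLaw (nS i) (fun j => x.2 j i)).prod
    (multinomialLaw nT (x.2 *ᵥ x.1))

/-- The likelihood of the parameter `x` given the data `d`. -/
def likelihood (nS : Fin K → ℕ) (nT : ℕ) (d : Data K) (x : Param K) : ℝ :=
  (∏ i, multinomialMass (nS i) (fun j => x.2 j i) (d.1 i)) * multinomialMass nT (x.2 *ᵥ x.1) d.2

/-! ### The hierarchical Laplacian-Gaussian prior -/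

/-- The hyperplane of vectors with coordinate sum zero. -/
def centered (K : ℕ) : Submodule ℝ (EuclideanSpace ℝ (Fin K)) where
  carrier := {v | ∑ i, v i = 0}
  add_mem' {a b} ha hb := by
    simp only [Set.mem_ofPred_eq, PiLp.add_apply, Finset.sum_add_distrib] at *
    rw [ha, hb, add_zero]
  zero_mem' := by simp
  smul_mem' c a ha := by
    simp only [Set.mem_ofPred_eq, PiLp.smul_apply, smul_eq_mul, ← Finset.mul_sum] at *
    rw [ha, mul_zero]

/-- The unnormalised density `exp (-(τ / 2) vᵀ L v)` on the hyperplane of centered vectors. -/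
def gmrfWeight (L : Matrix (Fin K) (Fin K) ℝ) (τ : ℝ) (v : centered K) : ℝ≥0∞ :=
  ENNReal.ofReal (Real.exp (-(τ / 2) * ((fun i => v.1 i) ⬝ᵥ L *ᵥ fun i => v.1 i)))

/-- The Gaussian Markov random field with precision `τ L`: the probability measure on the
hyperplane of centered vectors whose density with respect to Lebesgue measure on that hyperplane
is proportional to `exp (-(τ / 2) vᵀ L v)`. -/
def gmrf (L : Matrix (Fin K) (Fin K) ℝ) (τ : ℝ) : Measure (centered K) :=
  (∫⁻ v, gmrfWeight L τ v)⁻¹ • volume.withDensity (gmrfWeight L τ)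

/-- The softmax map. -/
def softmax (v : Fin K → ℝ) (j : Fin K) : ℝ := Real.exp (v j) / ∑ l, Real.exp (v l)

/-- The prior of `q`: `τ ∼ Gamma(a, b)` (shape `a`, rate `b`), `θ ∣ τ ∼ gmrf L τ` and
`q = softmax θ`. -/
def priorTarget (L : Matrix (Fin K) (Fin K) ℝ) (a b : ℝ) : Measure (Fin K → ℝ) :=
  ((gammaMeasure a b).bind (gmrf L)).map fun θ => softmax fun i => θ.1 i

/-- The prior of `C`: `τ ∼ Gamma(a, b)` (shape `a`, rate `b`); given `τ`, the vectors `φ i` are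
independent with law `gmrf L τ`; the `i`-th column of `C` is `softmax (φ i)`. -/
def priorConfusion (L : Matrix (Fin K) (Fin K) ℝ) (a b : ℝ) :
    Measure (Matrix (Fin K) (Fin K) ℝ) :=
  ((gammaMeasure a b).bind fun τ => Measure.pi fun _ : Fin K => gmrf L τ).map
    fun φ => Matrix.of fun j i => softmax (fun l => (φ i).1 l) j

/-- The joint prior of `(q, C)`; the two blocks are independent. -/
def jointPrior (L : Matrix (Fin K) (Fin K) ℝ) (aq bq aC bC : ℝ) : Measure (Param K) :=
  (priorTarget L aq bq).prod (priorConfusion L aC bC)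

/-- The posterior of `(q, C)` given the data `d`, by Bayes' formula: the measure whose density
with respect to the prior `ρ` is the likelihood divided by its `ρ`-integral. -/
def posterior (ρ : Measure (Param K)) (nS : Fin K → ℕ) (nT : ℕ) (d : Data K) :
    Measure (Param K) :=
  (∫⁻ x, ENNReal.ofReal (likelihood nS nT d x) ∂ρ)⁻¹ •
    ρ.withDensity fun x => ENNReal.ofReal (likelihood nS nT d x)

/-! ### Well-definedness: the families of measures used above are measurable in `τ`, and the
multinomial distributions are probability measures -/

lemma measurable_gmrfWeight (L : Matrix (Fin K) (Fin K) ℝ) :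
    Measurable (Function.uncurry (gmrfWeight L)) := by
  unfold Function.uncurry gmrfWeight
  refine Continuous.measurable ?_
  refine ENNReal.continuous_ofReal.comp (Real.continuous_exp.comp ?_)
  simp only [dotProduct, Matrix.mulVec]
  fun_prop

instance isFiniteMeasure_gmrf (L : Matrix (Fin K) (Fin K) ℝ) (τ : ℝ) :
    IsFiniteMeasure (gmrf L τ) := by
  refine ⟨?_⟩
  have h : gmrf L τ Set.univ = (∫⁻ v, gmrfWeight L τ v)⁻¹ * ∫⁻ v, gmrfWeight L τ v := by
    simp [gmrf]
  rw [h]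
  exact (ENNReal.inv_mul_le_one _).trans_lt ENNReal.one_lt_top

lemma measurable_gmrf (L : Matrix (Fin K) (Fin K) ℝ) : Measurable (gmrf L) := by
  refine Measure.measurable_of_measurable_coe _ fun s hs => ?_
  have h : ∀ τ, gmrf L τ s =
      (∫⁻ v, gmrfWeight L τ v)⁻¹ * ∫⁻ v in s, gmrfWeight L τ v := by
    intro τ
    simp [gmrf, withDensity_apply _ hs]
  simp only [h]
  exact (Measurable.lintegral_prod_right' (measurable_gmrfWeight L)).inv.mul
    (Measurable.lintegral_prod_right' (measurable_gmrfWeight L))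

lemma measurable_pi_gmrf (L : Matrix (Fin K) (Fin K) ℝ) :
    Measurable fun τ => Measure.pi fun _ : Fin K => gmrf L τ := by
  refine Measurable.measure_of_isPiSystem generateFrom_pi.symm isPiSystem_pi ?_ ?_
  · rintro _ ⟨s, hs, rfl⟩
    simp only [Measure.pi_pi]
    exact Finset.measurable_prod _ fun i _ =>
      (Measure.measurable_coe (show MeasurableSet (s i) by simpa using hs i (Set.mem_univ i))).comp (measurable_gmrf L)
  · simp only [Measure.pi_univ]
    exact Finset.measurable_prod _ fun i _ =>
      (Measure.measurable_coe MeasurableSet.univ).comp (measurable_gmrf L)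

lemma isProbabilityMeasure_multinomialLaw (n : ℕ) {p : Fin K → ℝ} (hp : p ∈ stdSimplex ℝ (Fin K)) :
    IsProbabilityMeasure (multinomialLaw n p) := by
  refine ⟨?_⟩
  have hnn : ∀ k, 0 ≤ multinomialMass n p k := by
    intro k
    unfold multinomialMass
    split_ifs
    · exact mul_nonneg (Nat.cast_nonneg _) (Finset.prod_nonneg fun j _ => pow_nonneg (hp.1 j) _)
    · exact le_rfl
  simp only [multinomialLaw, Measure.coe_finsetSum, Measure.coe_smul, Finset.sum_apply,
    Pi.smul_apply, measure_univ, smul_eq_mul, mul_one]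
  rw [← ENNReal.ofReal_sum_of_nonneg fun k _ => hnn k]
  have h := Finset.sum_pow_eq_sum_piAntidiag Finset.univ p n
  rw [hp.2, one_pow] at h
  rw [← ENNReal.ofReal_one, h]
  congr 1
  refine Finset.sum_congr rfl fun k hk => ?_
  rw [multinomialMass, if_pos (Finset.mem_piAntidiag.1 hk).1]

end LabelShift

end

/-!
In the coordinates `(C, p)` with `p = C *ᵥ q`, the likelihood is a product of `K + 1` multinomial
monomials, one for each column of `C` and one for `p`. Both sides of Bayes' formula are compared
with the local mass: the product of the masses which these monomials give, under Lebesgue measure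
on the simplex, to small balls around the true columns and around `C₀ *ᵥ q₀`.

The prior density is bounded below near the truth and `C₀` is invertible, so the evidence is at
least a constant times the local mass. If `(q, C)` is far from the truth, then either the mixture
`C *ᵥ q` is far from `C₀ *ᵥ q₀`, or some column `i` with `q i` bounded below is far from that of
`C₀`. With `q` fixed, the mixture has a bounded density as a function of any column of weight
bounded below. Hence, for data whose frequencies are close to their expectations, the numerator is
bounded by the local mass times a factor that is exponentially small in one of the sample sizes;
the softmax prior density blows up at most polynomially at the boundary of the simplex, and the
monomials of such data absorb this. Each factor decays in its own sample size, so no relation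
between the rates is needed.
-/

noncomputable section

open scoped NNReal

namespace LabelShift

variable {K : ℕ}

section Det

variable {E : Type*} [NormedAddCommGroup E] [NormedSpace ℝ E] [FiniteDimensional ℝ E]

lemma abs_det_le_pow_of_norm_le (A : E →ₗ[ℝ] E) {R : ℝ} (hR : 0 < R)
    (hA : ∀ x, ‖A x‖ ≤ R * ‖x‖) : |LinearMap.det A| ≤ R ^ Module.finrank ℝ E := by
  borelize E
  let μ : Measure E := Measure.addHaar
  have himage : A '' Metric.closedBall 0 1 ⊆ Metric.closedBall 0 R := by
    rintro _ ⟨x, hx, rfl⟩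
    rw [mem_closedBall_zero_iff] at hx ⊢
    exact (hA x).trans (mul_le_of_le_one_right hR.le hx)
  have hvol := measure_mono (μ := μ) himage
  rw [Measure.addHaar_image_linearMap, Measure.addHaar_closedBall' μ 0 hR.le] at hvol
  exact (ENNReal.ofReal_le_ofReal_iff (by positivity)).1 <|
    (ENNReal.mul_le_mul_iff_left (Metric.measure_closedBall_pos μ _ one_pos).ne'
      measure_closedBall_lt_top.ne).1 hvol

lemma one_le_abs_det_of_norm_le (A : E →ₗ[ℝ] E) (hA : ∀ x, ‖x‖ ≤ ‖A x‖) :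
    1 ≤ |LinearMap.det A| := by
  have hinj : Function.Injective A := (injective_iff_map_eq_zero A).2 fun x hx =>
    norm_le_zero_iff.1 <| by simpa [hx] using hA x
  let e := LinearEquiv.ofInjectiveEndo A hinj
  have hdet : LinearMap.det A * LinearMap.det (e.symm : E →ₗ[ℝ] E) = 1 := e.det_mul_det_symm
  have hsymm : |LinearMap.det (e.symm : E →ₗ[ℝ] E)| ≤ 1 := by
    refine (abs_det_le_pow_of_norm_le (R := 1) _ one_pos fun x => ?_).trans_eq (one_pow _)
    simpa [e] using (hA (e.symm x)).trans_eq (congrArg norm (e.apply_symm_apply x))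
  calc 1 = |LinearMap.det A| * |LinearMap.det (e.symm : E →ₗ[ℝ] E)| := by
        rw [← abs_mul, hdet, abs_one]
    _ ≤ |LinearMap.det A| := mul_le_of_le_one_right (abs_nonneg _) hsymm

end Det

/-! ### The affine chart of the simplex -/

/-- The point of the affine hyperplane `∑ i, c i = 1` with displacement `h` from the barycentre.
Lebesgue measure on the simplex is encoded as Lebesgue measure on these displacements. -/
def simplexPoint (h : centered K) (i : Fin K) : ℝ := (K : ℝ)⁻¹ + h.1 i

/-- The displacements of the points of the open simplex. -/
def simplexChart (K : ℕ) : Set (centered K) := {h | ∀ i, 0 < simplexPoint h i}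

lemma mem_centered {v : EuclideanSpace ℝ (Fin K)} : v ∈ centered K ↔ ∑ i, v i = 0 := Iff.rfl

lemma sum_centered (h : centered K) : ∑ i, h.1 i = 0 := h.2

@[fun_prop]
lemma continuous_simplexPoint : Continuous (simplexPoint (K := K)) := by
  unfold simplexPoint; fun_prop

lemma simplexPoint_injective : Function.Injective (simplexPoint (K := K)) := fun h k e => by
  ext i
  simpa [simplexPoint] using congrFun e i

lemma sum_simplexPoint [NeZero K] (h : centered K) : ∑ i, simplexPoint h i = 1 := by
  simp [simplexPoint, Finset.sum_add_distrib, sum_centered]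

lemma neZero_of_mem_openSimplex {q : Fin K → ℝ} (hq : q ∈ openSimplex K) : NeZero K :=
  ⟨by rintro rfl; simpa using hq.2⟩

lemma simplexPoint_mem_openSimplex [NeZero K] {h : centered K} (hh : h ∈ simplexChart K) :
    simplexPoint h ∈ openSimplex K := ⟨hh, sum_simplexPoint h⟩

lemma isOpen_simplexChart : IsOpen (simplexChart K) := by
  simp only [simplexChart, Set.ofPred_forall]
  exact isOpen_iInter_of_finite fun i =>
    isOpen_lt continuous_const ((continuous_apply i).comp continuous_simplexPoint)

lemma le_one_of_mem_openSimplex {c : Fin K → ℝ} (hc : c ∈ openSimplex K) (i : Fin K) : c i ≤ 1 :=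
  (Finset.single_le_sum (fun j _ => (hc.1 j).le) (Finset.mem_univ i)).trans_eq hc.2

lemma prod_pos_of_mem_openSimplex {c : Fin K → ℝ} (hc : c ∈ openSimplex K) : 0 < ∏ j, c j :=
  Finset.prod_pos fun j _ => hc.1 j

lemma prod_le_of_mem_openSimplex {c : Fin K → ℝ} (hc : c ∈ openSimplex K) (i : Fin K) :
    ∏ j, c j ≤ c i := by
  rw [← Finset.mul_prod_erase _ _ (Finset.mem_univ i)]
  exact mul_le_of_le_one_right (hc.1 i).le <|
    Finset.prod_le_one (fun j _ => (hc.1 j).le) fun j _ => le_one_of_mem_openSimplex hc j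

lemma openSimplex_subset_stdSimplex : openSimplex K ⊆ stdSimplex ℝ (Fin K) :=
  fun _ hc => ⟨fun j => (hc.1 j).le, hc.2⟩

/-- The displacement of a point from the barycentre. -/
def displacement [NeZero K] (c : Fin K → ℝ) (hc : ∑ i, c i = 1) : centered K :=
  ⟨WithLp.toLp 2 fun i => c i - (K : ℝ)⁻¹, by
    simp [mem_centered, Finset.sum_sub_distrib, hc]⟩

@[simp]
lemma simplexPoint_displacement [NeZero K] (c : Fin K → ℝ) (hc : ∑ i, c i = 1) :
    simplexPoint (displacement c hc) = c := by
  ext i; simp [simplexPoint, displacement]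

lemma norm_le_mul_of_abs_le (h : centered K) {R : ℝ} (hR : ∀ i, |h.1 i| ≤ R) : ‖h‖ ≤ K * R := by
  calc ‖h‖ = ‖∑ i, EuclideanSpace.single i (h.1 i)‖ := by
        rw [Submodule.coe_norm]
        congr 1
        ext j
        simp
    _ ≤ ∑ i, ‖EuclideanSpace.single i (h.1 i)‖ := norm_sum_le _ _
    _ ≤ ∑ _i : Fin K, R := Finset.sum_le_sum fun i _ => by simpa using hR i
    _ = K * R := by simp

lemma abs_apply_le_norm (h : centered K) (i : Fin K) : |h.1 i| ≤ ‖h‖ := by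
  rw [Submodule.coe_norm, ← Real.norm_eq_abs]
  exact PiLp.norm_apply_le h.1 i

lemma simplexChart_subset_closedBall [NeZero K] :
    simplexChart K ⊆ Metric.closedBall 0 (K : ℝ) := by
  intro h hh
  rw [mem_closedBall_zero_iff]
  refine (norm_le_mul_of_abs_le h (R := 1) fun i => ?_).trans_eq (mul_one _)
  have hpos : 0 < (K : ℝ)⁻¹ + h.1 i := hh i
  have hle : (K : ℝ)⁻¹ + h.1 i ≤ 1 :=
    le_one_of_mem_openSimplex (simplexPoint_mem_openSimplex hh) i
  have hK : (K : ℝ)⁻¹ ≤ 1 := Nat.cast_inv_le_one K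
  have hK0 : (0 : ℝ) ≤ (K : ℝ)⁻¹ := by positivity
  rw [abs_le]
  constructor <;> linarith

lemma volume_simplexChart_ne_top [NeZero K] : volume (simplexChart K) ≠ ⊤ :=
  ((measure_mono simplexChart_subset_closedBall).trans_lt measure_closedBall_lt_top).ne

/-! ### Softmax as a change of variables -/

lemma sum_exp_pos [NeZero K] (v : Fin K → ℝ) : 0 < ∑ l, Real.exp (v l) :=
  Finset.sum_pos (fun _ _ => Real.exp_pos _) Finset.univ_nonempty

lemma softmax_mem_openSimplex [NeZero K] (v : Fin K → ℝ) : softmax v ∈ openSimplex K := by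
  refine ⟨fun j => div_pos (Real.exp_pos _) (sum_exp_pos v), ?_⟩
  simp only [softmax, ← Finset.sum_div]
  exact div_self (sum_exp_pos v).ne'

@[fun_prop]
lemma continuous_softmax [NeZero K] : Continuous (softmax (K := K)) :=
  continuous_pi fun _ => Continuous.div (by fun_prop) (by fun_prop) fun v => (sum_exp_pos v).ne'

/-- The restriction of softmax to centered vectors, a bijection onto the open simplex. -/
def csoftmax (φ : centered K) : Fin K → ℝ := softmax fun i => φ.1 i

lemma csoftmax_mem_openSimplex [NeZero K] (φ : centered K) : csoftmax φ ∈ openSimplex K :=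
  softmax_mem_openSimplex _

@[fun_prop]
lemma continuous_csoftmax [NeZero K] : Continuous (csoftmax (K := K)) :=
  continuous_softmax.comp (by fun_prop)

lemma log_csoftmax [NeZero K] (φ : centered K) (i : Fin K) :
    Real.log (csoftmax φ i) = φ.1 i - Real.log (∑ l, Real.exp (φ.1 l)) := by
  rw [csoftmax, softmax, Real.log_div (Real.exp_pos _).ne' (sum_exp_pos _).ne', Real.log_exp]

/-- Subtraction of the mean. -/
def centering (K : ℕ) [NeZero K] : EuclideanSpace ℝ (Fin K) →L[ℝ] centered K :=
  LinearMap.toContinuousLinearMap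
    { toFun := fun v => ⟨WithLp.toLp 2 fun i => v i - (K : ℝ)⁻¹ * ∑ j, v j, by
        simp [mem_centered, Finset.sum_sub_distrib,
          mul_inv_cancel_left₀ (NeZero.ne (K : ℝ))]⟩
      map_add' := fun v w => by
        ext i; simp [Finset.sum_add_distrib]; ring
      map_smul' := fun c v => by
        ext i; simp [← Finset.mul_sum]; ring }

lemma centering_apply [NeZero K] (v : EuclideanSpace ℝ (Fin K)) (i : Fin K) :
    (centering K v).1 i = v i - (K : ℝ)⁻¹ * ∑ j, v j := rfl

/-- The inverse of `csoftmax`, read in the affine chart of the simplex. -/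
def logChart [NeZero K] (h : centered K) : centered K :=
  centering K (WithLp.toLp 2 fun i => Real.log (simplexPoint h i))

/-- The derivative of `logChart`. -/
def logChartDeriv [NeZero K] (h : centered K) : centered K →L[ℝ] centered K :=
  (centering K).comp (LinearMap.toContinuousLinearMap
    { toFun := fun k => WithLp.toLp 2 fun i => (simplexPoint h i)⁻¹ * k.1 i
      map_add' := fun v w => by ext i; simp; ring
      map_smul' := fun c v => by ext i; simp; ring })

lemma logChartDeriv_apply [NeZero K] (h k : centered K) (i : Fin K) :
    (logChartDeriv h k).1 i =
      (simplexPoint h i)⁻¹ * k.1 i - (K : ℝ)⁻¹ * ∑ j, (simplexPoint h j)⁻¹ * k.1 j := rfl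

lemma hasFDerivAt_logChart [NeZero K] {h : centered K} (hh : h ∈ simplexChart K) :
    HasFDerivAt logChart (logChartDeriv h) h := by
  refine (centering K).hasFDerivAt.comp h ?_
  rw [← hasFDerivWithinAt_univ, hasFDerivWithinAt_euclidean]
  intro i
  have hcoord : HasFDerivAt (fun k : centered K => simplexPoint k i)
      ((EuclideanSpace.proj i).comp (centered K).subtypeL) h :=
    (((EuclideanSpace.proj (𝕜 := ℝ) i).comp (centered K).subtypeL).hasFDerivAt).const_add _
  exact (hcoord.log (hh i).ne').hasFDerivWithinAt.congr_fderiv rfl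

lemma logChart_displacement_csoftmax [NeZero K] (φ : centered K) :
    logChart (displacement (csoftmax φ) (csoftmax_mem_openSimplex φ).2) = φ := by
  ext i
  rw [logChart, centering_apply]
  simp [log_csoftmax, Finset.sum_sub_distrib, sum_centered,
    inv_mul_cancel_left₀ (NeZero.ne (K : ℝ))]

lemma csoftmax_logChart [NeZero K] {h : centered K} (hh : h ∈ simplexChart K) :
    csoftmax (logChart h) = simplexPoint h := by
  have hexp : ∀ j, Real.exp ((logChart h).1 j) =
      simplexPoint h j * Real.exp (-((K : ℝ)⁻¹ * ∑ l, Real.log (simplexPoint h l))) := by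
    intro j
    rw [logChart, centering_apply, sub_eq_add_neg, Real.exp_add]
    simp only [Real.exp_log (hh j)]
  ext i
  simp only [csoftmax, softmax, hexp, ← Finset.sum_mul, sum_simplexPoint, one_mul]
  exact mul_div_cancel_right₀ _ (Real.exp_pos _).ne'

lemma injOn_logChart [NeZero K] : Set.InjOn (logChart (K := K)) (simplexChart K) := by
  intro h hh k hk e
  apply simplexPoint_injective
  rw [← csoftmax_logChart hh, e, csoftmax_logChart hk]

lemma image_logChart [NeZero K] : logChart '' simplexChart K = Set.univ :=
  Set.eq_univ_of_forall fun φ => ⟨displacement (csoftmax φ) (csoftmax_mem_openSimplex φ).2,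
    fun i => by
      rw [simplexPoint_displacement]
      exact (csoftmax_mem_openSimplex φ).1 i,
    logChart_displacement_csoftmax φ⟩

lemma norm_logChartDeriv_le [NeZero K] {h : centered K} (hh : h ∈ simplexChart K) (k : centered K) :
    ‖logChartDeriv h k‖ ≤ 2 * K * (∏ j, simplexPoint h j)⁻¹ * ‖k‖ := by
  have hc := simplexPoint_mem_openSimplex hh
  set P := ∏ j, simplexPoint h j
  have hP : 0 < P := prod_pos_of_mem_openSimplex hc
  have hterm : ∀ j, |(simplexPoint h j)⁻¹ * k.1 j| ≤ P⁻¹ * ‖k‖ := fun j => by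
    rw [abs_mul, abs_of_pos (inv_pos.2 (hh j))]
    exact mul_le_mul (inv_anti₀ hP (prod_le_of_mem_openSimplex hc j)) (abs_apply_le_norm k j)
      (abs_nonneg _) (by positivity)
  have hmean : |(K : ℝ)⁻¹ * ∑ j, (simplexPoint h j)⁻¹ * k.1 j| ≤ P⁻¹ * ‖k‖ := by
    rw [abs_mul, abs_inv, Nat.abs_cast, inv_mul_le_iff₀ (by exact_mod_cast NeZero.pos K)]
    exact (Finset.abs_sum_le_sum_abs _ _).trans
      ((Finset.sum_le_sum fun j _ => hterm j).trans_eq (by simp))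
  have hnorm := norm_le_mul_of_abs_le (logChartDeriv h k) (R := 2 * (P⁻¹ * ‖k‖)) fun i => by
    rw [logChartDeriv_apply, two_mul]
    exact (abs_sub _ _).trans (add_le_add (hterm i) hmean)
  linarith

lemma norm_le_norm_logChartDeriv [NeZero K] {h : centered K} (hh : h ∈ simplexChart K)
    (k : centered K) : ‖k‖ ≤ ‖logChartDeriv h k‖ := by
  have hinner : ‖k‖ ^ 2 ≤ inner ℝ (logChartDeriv h k) k := by
    have hterm : ∀ i, inner ℝ ((simplexPoint h i)⁻¹ * k.1 i -
        (K : ℝ)⁻¹ * ∑ j, (simplexPoint h j)⁻¹ * k.1 j) (k.1 i) =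
        (simplexPoint h i)⁻¹ * k.1 i ^ 2 -
          ((K : ℝ)⁻¹ * ∑ j, (simplexPoint h j)⁻¹ * k.1 j) * k.1 i := fun i => by
      simp only [RCLike.inner_apply, conj_trivial]; ring
    rw [Submodule.coe_inner, Submodule.coe_norm, EuclideanSpace.real_norm_sq_eq, PiLp.inner_apply]
    simp only [logChartDeriv_apply, hterm, Finset.sum_sub_distrib, ← Finset.mul_sum, sum_centered,
      mul_zero, sub_zero]
    exact Finset.sum_le_sum fun i _ => le_mul_of_one_le_left (sq_nonneg _) <|
      (one_le_inv₀ (hh i)).2 (le_one_of_mem_openSimplex (simplexPoint_mem_openSimplex hh) i)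
  rcases (norm_nonneg k).eq_or_lt with hk | hk
  · exact hk ▸ norm_nonneg _
  · have hcs := hinner.trans (real_inner_le_norm (logChartDeriv h k) k)
    rw [sq] at hcs
    exact le_of_mul_le_mul_right hcs hk

lemma lintegral_csoftmax [NeZero K] (F : (Fin K → ℝ) → ℝ≥0∞) :
    ∫⁻ φ, F (csoftmax φ) = ∫⁻ h in simplexChart K,
      ENNReal.ofReal |(logChartDeriv h).det| * F (simplexPoint h) := by
  rw [← setLIntegral_univ, ← image_logChart, lintegral_image_eq_lintegral_abs_det_fderiv_mul volume
    isOpen_simplexChart.measurableSet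
    (fun h hh => (hasFDerivAt_logChart hh).hasFDerivWithinAt) injOn_logChart]
  refine setLIntegral_congr_fun isOpen_simplexChart.measurableSet fun h hh => ?_
  simp only [csoftmax_logChart hh]

/-- The dimension of the simplex. -/
abbrev simplexDim (K : ℕ) : ℕ := Module.finrank ℝ (centered K)

/-- A bound, up to a constant, on the Jacobian of the inverse of softmax. It blows up only
polynomially at the boundary of the simplex, so a monomial of high degree absorbs it. -/
def jacobianBound (c : Fin K → ℝ) : ℝ≥0∞ := ENNReal.ofReal ((∏ j, c j) ^ simplexDim K)⁻¹

lemma one_le_jacobianBound {c : Fin K → ℝ} (hc : c ∈ openSimplex K) : 1 ≤ jacobianBound c := by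
  rw [jacobianBound, ENNReal.one_le_ofReal]
  exact (one_le_inv₀ (pow_pos (prod_pos_of_mem_openSimplex hc) _)).2 <|
    pow_le_one₀ (prod_pos_of_mem_openSimplex hc).le <|
      Finset.prod_le_one (fun j _ => (hc.1 j).le) fun j _ => le_one_of_mem_openSimplex hc j

@[fun_prop]
lemma measurable_jacobianBound : Measurable (jacobianBound (K := K)) := by
  unfold jacobianBound
  fun_prop

lemma measurableSet_openSimplex : MeasurableSet (openSimplex K) := by
  have : openSimplex K = (⋂ i, {q | 0 < q i}) ∩ {q | ∑ i, q i = 1} := by ext; simp [openSimplex]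
  rw [this]
  exact (MeasurableSet.iInter fun i =>
    measurableSet_lt measurable_const (measurable_pi_apply i)).inter
    (measurableSet_eq_fun (by fun_prop) measurable_const)

/-- Lebesgue measure on the open simplex. -/
def simplexMeasure (K : ℕ) : Measure (Fin K → ℝ) :=
  (volume.restrict (simplexChart K)).map simplexPoint

instance isFiniteMeasure_simplexMeasure [NeZero K] : IsFiniteMeasure (simplexMeasure K) := by
  have : IsFiniteMeasure (volume.restrict (simplexChart K)) :=
    isFiniteMeasure_restrict.2 volume_simplexChart_ne_top
  exact inferInstanceAs (IsFiniteMeasure (Measure.map _ _))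

lemma lintegral_simplexMeasure {F : (Fin K → ℝ) → ℝ≥0∞} (hF : Measurable F) :
    ∫⁻ c, F c ∂simplexMeasure K = ∫⁻ h in simplexChart K, F (simplexPoint h) :=
  lintegral_map hF (by fun_prop)

lemma ae_simplexMeasure_mem_openSimplex [NeZero K] :
    ∀ᵐ c ∂simplexMeasure K, c ∈ openSimplex K := by
  refine (ae_map_iff (p := (· ∈ openSimplex K)) (by fun_prop) measurableSet_openSimplex).2 ?_
  filter_upwards [ae_restrict_mem isOpen_simplexChart.measurableSet] with h hh
  exact simplexPoint_mem_openSimplex hh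

/-- The measure with density `jacobianBound` on the open simplex: up to a constant, it dominates
the image of Lebesgue measure under softmax. -/
def jacobianMeasure (K : ℕ) : Measure (Fin K → ℝ) :=
  (simplexMeasure K).withDensity jacobianBound

instance sigmaFinite_jacobianMeasure [NeZero K] : SigmaFinite (jacobianMeasure K) :=
  SigmaFinite.withDensity_of_ne_top' fun _ => ENNReal.ofReal_ne_top

lemma lintegral_jacobianMeasure {F : (Fin K → ℝ) → ℝ≥0∞} (hF : Measurable F) :
    ∫⁻ c, F c ∂jacobianMeasure K = ∫⁻ c, jacobianBound c * F c ∂simplexMeasure K :=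
  lintegral_withDensity_eq_lintegral_mul _ measurable_jacobianBound hF

lemma ae_jacobianMeasure_mem_openSimplex [NeZero K] :
    ∀ᵐ c ∂jacobianMeasure K, c ∈ openSimplex K :=
  (withDensity_absolutelyContinuous _ _).ae_le ae_simplexMeasure_mem_openSimplex

lemma simplexMeasure_le_jacobianMeasure [NeZero K] : simplexMeasure K ≤ jacobianMeasure K := by
  conv_lhs => rw [← withDensity_one (μ := simplexMeasure K)]
  refine withDensity_mono ?_
  filter_upwards [ae_simplexMeasure_mem_openSimplex] with c hc
  exact one_le_jacobianBound hc

lemma map_csoftmax_apply [NeZero K] {A : Set (Fin K → ℝ)} (hA : MeasurableSet A) :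
    Measure.map csoftmax volume A = ∫⁻ h in simplexChart K,
      ENNReal.ofReal |(logChartDeriv h).det| * A.indicator 1 (simplexPoint h) := by
  rw [← lintegral_csoftmax, ← lintegral_indicator_one hA,
    lintegral_map (measurable_one.indicator hA) (by fun_prop)]

lemma map_csoftmax_le [NeZero K] :
    Measure.map csoftmax volume ≤ ENNReal.ofReal ((2 * K) ^ simplexDim K) • jacobianMeasure K := by
  refine Measure.le_iff.2 fun A hA => ?_
  have hind : Measurable (A.indicator (1 : (Fin K → ℝ) → ℝ≥0∞)) := measurable_one.indicator hA
  rw [map_csoftmax_apply hA, Measure.smul_apply, smul_eq_mul, ← lintegral_indicator_one hA,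
    lintegral_jacobianMeasure hind, lintegral_simplexMeasure (by fun_prop),
    ← lintegral_const_mul' _ _ ENNReal.ofReal_ne_top]
  refine setLIntegral_mono' isOpen_simplexChart.measurableSet fun h hh => ?_
  have hK : (0 : ℝ) < K := by exact_mod_cast NeZero.pos K
  have hP : 0 < ∏ j, simplexPoint h j :=
    prod_pos_of_mem_openSimplex (simplexPoint_mem_openSimplex hh)
  rw [← mul_assoc, jacobianBound, ← ENNReal.ofReal_mul (by positivity), ← inv_pow, ← mul_pow]
  gcongr
  exact abs_det_le_pow_of_norm_le (logChartDeriv h).toLinearMap (by positivity)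
    (norm_logChartDeriv_le hh)

lemma simplexMeasure_le_map_csoftmax [NeZero K] :
    simplexMeasure K ≤ Measure.map csoftmax volume := by
  refine Measure.le_iff.2 fun A hA => ?_
  rw [map_csoftmax_apply hA, ← lintegral_indicator_one hA,
    lintegral_simplexMeasure (measurable_one.indicator hA)]
  refine setLIntegral_mono' isOpen_simplexChart.measurableSet fun h hh =>
    le_mul_of_one_le_left' ?_
  rw [ENNReal.one_le_ofReal]
  exact one_le_abs_det_of_norm_le (logChartDeriv h).toLinearMap (norm_le_norm_logChartDeriv hh)

/-! ### The Laplacian form -/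

/-- The quadratic form of a matrix on centered vectors. -/
def centeredForm (L : Matrix (Fin K) (Fin K) ℝ) (v : centered K) : ℝ :=
  (fun i => v.1 i) ⬝ᵥ L *ᵥ fun i => v.1 i

/-- Positive definiteness of the quadratic form of a matrix on centered vectors: it makes
`gmrf L τ` a proper Gaussian law for every `τ > 0`. -/
def CenteredPosDef (L : Matrix (Fin K) (Fin K) ℝ) : Prop :=
  ∀ v : centered K, v ≠ 0 → 0 < centeredForm L v

section CenteredForm

variable {L : Matrix (Fin K) (Fin K) ℝ}

@[fun_prop]
lemma continuous_centeredForm (L : Matrix (Fin K) (Fin K) ℝ) : Continuous (centeredForm L) := by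
  unfold centeredForm
  simp only [dotProduct, Matrix.mulVec]
  fun_prop

lemma centeredForm_smul (L : Matrix (Fin K) (Fin K) ℝ) (t : ℝ) (v : centered K) :
    centeredForm L (t • v) = t ^ 2 * centeredForm L v := by
  have : (fun i => (t • v).1 i) = t • fun i => v.1 i := by ext i; simp
  rw [centeredForm, this, Matrix.mulVec_smul, smul_dotProduct, dotProduct_smul, centeredForm]
  simp only [smul_eq_mul]; ring

lemma centeredForm_zero (L : Matrix (Fin K) (Fin K) ℝ) : centeredForm L 0 = 0 := by
  simpa using centeredForm_smul L 0 0

lemma CenteredPosDef.nonneg (hL : CenteredPosDef L) (v : centered K) : 0 ≤ centeredForm L v := by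
  rcases eq_or_ne v 0 with rfl | hv
  · exact (centeredForm_zero L).ge
  · exact (hL v hv).le

lemma CenteredPosDef.exists_coercive (hL : CenteredPosDef L) :
    ∃ c > 0, ∀ v : centered K, c * ‖v‖ ^ 2 ≤ centeredForm L v := by
  obtain ⟨c, hc, hmin⟩ := (isCompact_sphere (0 : centered K) 1).exists_forall_le'
    (continuous_centeredForm L).continuousOn fun v hv => hL v (ne_zero_of_mem_unit_sphere ⟨v, hv⟩)
  refine ⟨c, hc, fun v => ?_⟩
  rcases eq_or_ne v 0 with rfl | hv
  · simp [centeredForm_zero]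
  · have hle := hmin (‖v‖⁻¹ • v) (by simp [norm_smul, hv])
    rwa [centeredForm_smul, inv_pow, inv_mul_eq_div, le_div_iff₀ (by positivity)] at hle

end CenteredForm

section Laplacian

variable {W : Matrix (Fin K) (Fin K) ℝ}

lemma centeredForm_laplacian (W : Matrix (Fin K) (Fin K) ℝ) (v : centered K) :
    centeredForm (laplacian W) v =
      ∑ i, ∑ j, W i j * v.1 i ^ 2 - ∑ i, ∑ j, W i j * (v.1 i * v.1 j) := by
  simp only [centeredForm, laplacian, Matrix.sub_mulVec, dotProduct_sub]
  congr 1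
  · simp only [dotProduct, Matrix.mulVec_diagonal, Finset.sum_mul, Finset.mul_sum]
    exact Finset.sum_congr rfl fun i _ => Finset.sum_congr rfl fun j _ => by ring
  · simp only [dotProduct, Matrix.mulVec, Finset.mul_sum]
    exact Finset.sum_congr rfl fun i _ => Finset.sum_congr rfl fun j _ => by ring

lemma two_mul_centeredForm_laplacian (hW : W.IsSymm) (v : centered K) :
    2 * centeredForm (laplacian W) v = ∑ i, ∑ j, W i j * (v.1 i - v.1 j) ^ 2 := by
  have hswap : ∑ i, ∑ j, W i j * v.1 j ^ 2 = ∑ i, ∑ j, W i j * v.1 i ^ 2 := by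
    rw [Finset.sum_comm]
    simp only [hW.apply]
  have hexpand : ∑ i, ∑ j, W i j * (v.1 i - v.1 j) ^ 2 =
      ∑ i, ∑ j, W i j * v.1 i ^ 2 + ∑ i, ∑ j, W i j * v.1 j ^ 2
        - 2 * ∑ i, ∑ j, W i j * (v.1 i * v.1 j) := by
    simp only [Finset.mul_sum, ← Finset.sum_add_distrib, ← Finset.sum_sub_distrib]
    exact Finset.sum_congr rfl fun i _ => Finset.sum_congr rfl fun j _ => by ring
  rw [hexpand, hswap, centeredForm_laplacian]; ring

lemma apply_eq_apply_of_centeredForm_laplacian_nonpos (hW : W.IsSymm) (hW0 : ∀ i j, 0 ≤ W i j)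
    {v : centered K} (hv : centeredForm (laplacian W) v ≤ 0) {i j : Fin K} (hij : W i j ≠ 0) :
    v.1 i = v.1 j := by
  have hterm : ∀ i j, 0 ≤ W i j * (v.1 i - v.1 j) ^ 2 := fun i j =>
    mul_nonneg (hW0 i j) (sq_nonneg _)
  have hle : W i j * (v.1 i - v.1 j) ^ 2 ≤ 0 :=
    calc W i j * (v.1 i - v.1 j) ^ 2
        ≤ ∑ j, W i j * (v.1 i - v.1 j) ^ 2 :=
          Finset.single_le_sum (fun j _ => hterm i j) (Finset.mem_univ j)
      _ ≤ ∑ i, ∑ j, W i j * (v.1 i - v.1 j) ^ 2 :=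
          Finset.single_le_sum (f := fun i => ∑ j, W i j * (v.1 i - v.1 j) ^ 2)
            (fun i _ => Finset.sum_nonneg fun j _ => hterm i j) (Finset.mem_univ i)
      _ ≤ 0 := by
          rw [← two_mul_centeredForm_laplacian hW]
          linarith
  have hzero := (mul_eq_zero.1 (hle.antisymm (hterm i j))).resolve_left hij
  exact sub_eq_zero.1 (pow_eq_zero_iff two_ne_zero |>.1 hzero)

lemma eq_zero_of_forall_apply_eq {v : centered K} (hv : ∀ i j, v.1 i = v.1 j) : v = 0 := by
  ext i
  have hsum := sum_centered v
  simp only [hv _ i, Finset.sum_const, Finset.card_univ, Fintype.card_fin, nsmul_eq_mul] at hsum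
  exact (mul_eq_zero.1 hsum).resolve_left (by exact_mod_cast i.pos.ne')

lemma centeredPosDef_laplacian (hW : W.IsSymm) (hW0 : ∀ i j, 0 ≤ W i j)
    (hconn : (similarityGraph W).Connected) : CenteredPosDef (laplacian W) := by
  intro v hv
  contrapose! hv
  have hadj : ∀ i j, (similarityGraph W).Adj i j → v.1 i = v.1 j := by
    intro i j hij
    rw [similarityGraph, SimpleGraph.fromRel_adj] at hij
    rcases hij.2 with h | h
    · exact apply_eq_apply_of_centeredForm_laplacian_nonpos hW hW0 hv h
    · exact (apply_eq_apply_of_centeredForm_laplacian_nonpos hW hW0 hv h).symm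
  refine eq_zero_of_forall_apply_eq fun i j => ?_
  obtain ⟨p⟩ := hconn.preconnected i j
  induction p with
  | nil => rfl
  | cons h _ ih => exact (hadj _ _ h).trans ih

end Laplacian

/-! ### Bounds for the Gaussian Markov random field -/

section Gmrf

variable {L : Matrix (Fin K) (Fin K) ℝ}

lemma gmrfWeight_eq (L : Matrix (Fin K) (Fin K) ℝ) (τ : ℝ) (v : centered K) :
    gmrfWeight L τ v = ENNReal.ofReal (Real.exp (-(τ / 2) * centeredForm L v)) := rfl

lemma gmrf_univ_le_one (L : Matrix (Fin K) (Fin K) ℝ) (τ : ℝ) : gmrf L τ Set.univ ≤ 1 := by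
  simp [gmrf, ENNReal.inv_mul_le_one]

lemma gmrfWeight_le_one (hL : ∀ v, 0 ≤ centeredForm L v) {τ : ℝ} (hτ : 0 ≤ τ) (v : centered K) :
    gmrfWeight L τ v ≤ 1 := by
  rw [gmrfWeight_eq, ENNReal.ofReal_le_one, Real.exp_le_one_iff]
  nlinarith [hL v]

lemma gmrfWeight_anti (hL : ∀ v, 0 ≤ centeredForm L v) {σ τ : ℝ} (hστ : σ ≤ τ) (v : centered K) :
    gmrfWeight L τ v ≤ gmrfWeight L σ v := by
  refine ENNReal.ofReal_le_ofReal (Real.exp_le_exp.2 ?_)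
  exact mul_le_mul_of_nonneg_right (by linarith) (hL v)

lemma le_lintegral_gmrfWeight (L : Matrix (Fin K) (Fin K) ℝ) {τ : ℝ} (hτ : 0 ≤ τ) (s : ℝ) :
    ENNReal.ofReal (Real.exp (-(s * τ))) * volume {v | centeredForm L v < 2 * s} ≤
      ∫⁻ v, gmrfWeight L τ v := by
  have hmeas : MeasurableSet {v | centeredForm L v < 2 * s} :=
    (isOpen_lt (by fun_prop) continuous_const).measurableSet
  rw [← setLIntegral_const]
  refine (setLIntegral_mono' hmeas fun v hv => ?_).trans (setLIntegral_le_lintegral _ _)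
  have hlt : centeredForm L v < 2 * s := hv
  refine ENNReal.ofReal_le_ofReal (Real.exp_le_exp.2 ?_)
  change -(s * τ) ≤ -(τ / 2) * centeredForm L v
  nlinarith

lemma exists_gmrf_le (hL : ∀ v, 0 ≤ centeredForm L v) {s : ℝ} (hs : 0 < s) :
    ∃ M : ℝ≥0, ∀ τ : ℝ, 0 ≤ τ → gmrf L τ ≤ (M * (Real.exp (s * τ)).toNNReal) • volume := by
  have hU : volume {v | centeredForm L v < 2 * s} ≠ 0 :=
    ((isOpen_lt (by fun_prop) continuous_const).measure_pos _
      ⟨0, by simp [centeredForm_zero, hs]⟩).ne'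
  refine ⟨(volume {v | centeredForm L v < 2 * s})⁻¹.toNNReal, fun τ hτ => ?_⟩
  have hdensity : volume.withDensity (gmrfWeight L τ) ≤ volume :=
    (withDensity_mono (Eventually.of_forall (gmrfWeight_le_one hL hτ))).trans_eq withDensity_one
  have hconst : (∫⁻ v, gmrfWeight L τ v)⁻¹ ≤ ↑((volume {v | centeredForm L v < 2 * s})⁻¹.toNNReal *
      (Real.exp (s * τ)).toNNReal) := by
    rw [ENNReal.coe_mul, ENNReal.coe_toNNReal (ENNReal.inv_ne_top.2 hU)]
    refine (ENNReal.inv_le_inv.2 (le_lintegral_gmrfWeight L hτ s)).trans_eq ?_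
    rw [ENNReal.mul_inv (Or.inl (by simp [Real.exp_pos])) (Or.inl ENNReal.ofReal_ne_top), mul_comm,
      ← ENNReal.ofReal_inv_of_pos (Real.exp_pos _), Real.exp_neg, inv_inv]
    rfl
  refine Measure.le_iff'.2 fun A => ?_
  exact mul_le_mul' hconst (hdensity A)

lemma lintegral_gmrfWeight_ne_top (hL : CenteredPosDef L) {τ : ℝ} (hτ : 0 < τ) :
    ∫⁻ v, gmrfWeight L τ v ≠ ⊤ := by
  obtain ⟨c, hc, hcL⟩ := hL.exists_coercive
  have hint := (GaussianFourier.integrable_cexp_neg_mul_sq_norm_add (V := centered K)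
    (b := ((τ / 2 * c : ℝ) : ℂ)) (by rw [Complex.ofReal_re]; positivity) 0 0).norm
  refine ne_top_of_le_ne_top hint.lintegral_lt_top.ne (lintegral_mono fun v => ?_)
  rw [gmrfWeight_eq, Complex.norm_exp]
  refine ENNReal.ofReal_le_ofReal (Real.exp_le_exp.2 ?_)
  have hre : (-((τ / 2 * c : ℝ) : ℂ) * (‖v‖ : ℂ) ^ 2 + 0 * ((inner ℝ 0 v : ℝ) : ℂ)).re =
      -(τ / 2) * (c * ‖v‖ ^ 2) := by
    norm_cast
    simp only [inner_zero_left, mul_zero, add_zero]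
    ring
  rw [hre]
  exact mul_le_mul_of_nonpos_left (hcL v) (by linarith)

lemma exists_le_gmrf (hL : CenteredPosDef L) {s : ℝ} (hs : 0 < s) (t B : ℝ) :
    ∃ κ : ℝ≥0, κ ≠ 0 ∧ ∀ τ ∈ Set.Icc s t,
      κ • volume.restrict (Metric.closedBall 0 B) ≤ gmrf L τ := by
  obtain ⟨R, hR⟩ := (isCompact_closedBall (0 : centered K) B).bddAbove_image
    (continuous_centeredForm L).continuousOn
  have hweight : ∀ τ ∈ Set.Icc s t, ∀ v ∈ Metric.closedBall (0 : centered K) B,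
      ENNReal.ofReal (Real.exp (-(t / 2) * R)) ≤ gmrfWeight L τ v := fun τ hτ v hv => by
    have hle : centeredForm L v ≤ R := hR ⟨v, hv, rfl⟩
    refine ENNReal.ofReal_le_ofReal (Real.exp_le_exp.2 ?_)
    change -(t / 2) * R ≤ -(τ / 2) * centeredForm L v
    nlinarith [hL.nonneg v, hτ.1, hτ.2]
  have hpos : 0 < (∫⁻ v, gmrfWeight L s v)⁻¹ * ENNReal.ofReal (Real.exp (-(t / 2) * R)) :=
    ENNReal.mul_pos (ENNReal.inv_ne_zero.2 (lintegral_gmrfWeight_ne_top hL hs))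
      (by simp [Real.exp_pos])
  obtain ⟨κ, hκ, hκle⟩ := ENNReal.lt_iff_exists_nnreal_btwn.1 hpos
  refine ⟨κ, by exact_mod_cast hκ.ne', fun τ hτ => Measure.le_iff.2 fun A hA => ?_⟩
  calc (κ : ℝ≥0∞) * volume.restrict (Metric.closedBall 0 B) A
      ≤ (∫⁻ v, gmrfWeight L s v)⁻¹ * (ENNReal.ofReal (Real.exp (-(t / 2) * R)) *
          volume.restrict (Metric.closedBall 0 B) A) := by
        rw [← mul_assoc]
        exact mul_le_mul_left hκle.le _
    _ ≤ (∫⁻ v, gmrfWeight L τ v)⁻¹ * ∫⁻ v in A, gmrfWeight L τ v := by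
        refine mul_le_mul'
          (ENNReal.inv_le_inv.2 (lintegral_mono fun v => gmrfWeight_anti hL.nonneg hτ.1 v)) ?_
        rw [Measure.restrict_apply hA, ← setLIntegral_const]
        exact (setLIntegral_mono' (hA.inter measurableSet_closedBall) fun v hv =>
          hweight τ hτ v hv.2).trans (lintegral_mono_set Set.inter_subset_left)
    _ = gmrf L τ A := by simp [gmrf, withDensity_apply _ hA]

end Gmrf

/-! ### Gamma hyperpriors -/

section Gamma

variable {a b : ℝ}

lemma ae_nonneg_gammaMeasure (a b : ℝ) : ∀ᵐ τ ∂gammaMeasure a b, 0 ≤ τ := by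
  have : {τ : ℝ | ¬ 0 ≤ τ} = Set.Iio 0 := by ext; simp
  rw [ae_iff, this, gammaMeasure, withDensity_apply _ measurableSet_Iio,
    lintegral_gammaPDF_of_nonpos le_rfl]

lemma gammaPDF_mul_exp (ha : 0 < a) (hb : 0 < b) {s : ℝ} (hs : s < b) (τ : ℝ) :
    gammaPDF a b τ * ENNReal.ofReal (Real.exp (s * τ)) =
      ENNReal.ofReal ((b / (b - s)) ^ a) * gammaPDF a (b - s) τ := by
  have hbs : 0 < b - s := sub_pos.2 hs
  rcases lt_or_ge τ 0 with hτ | hτ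
  · simp [gammaPDF_of_neg hτ]
  · rw [gammaPDF_of_nonneg hτ, gammaPDF_of_nonneg hτ, ← ENNReal.ofReal_mul (by positivity),
      ← ENNReal.ofReal_mul (by positivity)]
    have hexp : Real.exp (-(b * τ)) * Real.exp (s * τ) = Real.exp (-((b - s) * τ)) := by
      rw [← Real.exp_add]; ring_nf
    have hpow : (b / (b - s)) ^ a * (b - s) ^ a = b ^ a := by
      rw [← Real.mul_rpow (by positivity) hbs.le, div_mul_cancel₀ _ hbs.ne']
    rw [mul_assoc, hexp, ← hpow]
    ring_nf

lemma lintegral_exp_gammaMeasure (ha : 0 < a) (hb : 0 < b) {s : ℝ} (hs : s < b) :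
    ∫⁻ τ, ENNReal.ofReal (Real.exp (s * τ)) ∂gammaMeasure a b =
      ENNReal.ofReal ((b / (b - s)) ^ a) := by
  rw [gammaMeasure, lintegral_withDensity_eq_lintegral_mul _ (f := gammaPDF a b)
    (measurable_gammaPDFReal a b).ennreal_ofReal (by fun_prop)]
  simp only [Pi.mul_apply, gammaPDF_mul_exp ha hb hs]
  rw [lintegral_const_mul' _ _ ENNReal.ofReal_ne_top,
    lintegral_gammaPDF_eq_one ha (sub_pos.2 hs), mul_one]

lemma gammaMeasure_Icc_ne_zero (ha : 0 < a) (hb : 0 < b) {s t : ℝ} (hs : 0 < s) (hst : s < t) :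
    gammaMeasure a b (Set.Icc s t) ≠ 0 := by
  rw [gammaMeasure, withDensity_apply _ measurableSet_Icc]
  refine ((setLIntegral_pos_iff (measurable_gammaPDFReal a b).ennreal_ofReal).2 ?_).ne'
  refine lt_of_lt_of_le (by simp [hst]) (measure_mono (s := Set.Icc s t) fun τ hτ => ⟨?_, hτ⟩)
  simpa using gammaPDFReal_pos ha hb (hs.trans_le hτ.1)

end Gamma

/-! ### Mixtures and products of measures -/

section Bind

variable {α β γ : Type*} [MeasurableSpace α] [MeasurableSpace β] [MeasurableSpace γ]
  {μ : Measure α} {m : α → Measure β}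

lemma map_bind_eq_bind_map (hm : Measurable m) {g : β → γ} (hg : Measurable g) :
    (μ.bind m).map g = μ.bind fun a => (m a).map g := by
  ext s hs
  have hmap : Measurable fun a => (m a).map g := (Measure.measurable_map g hg).comp hm
  rw [Measure.map_apply hg hs, Measure.bind_apply (hg hs) hm.aemeasurable,
    Measure.bind_apply hs hmap.aemeasurable]
  simp only [Measure.map_apply hg hs]

lemma bind_le_lintegral_smul (hm : Measurable m) {f : α → ℝ≥0∞} (hf : Measurable f)
    {ν : Measure β} (hle : ∀ᵐ a ∂μ, m a ≤ f a • ν) : μ.bind m ≤ (∫⁻ a, f a ∂μ) • ν := by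
  refine Measure.le_iff.2 fun s hs => ?_
  rw [Measure.bind_apply hs hm.aemeasurable, Measure.smul_apply, smul_eq_mul,
    ← lintegral_mul_const _ hf]
  exact lintegral_mono_ae (hle.mono fun a ha => ha s)

lemma measure_smul_le_bind (hm : Measurable m) {S : Set α} (hS : MeasurableSet S) {ν : Measure β}
    (hle : ∀ a ∈ S, ν ≤ m a) : μ S • ν ≤ μ.bind m := by
  refine Measure.le_iff.2 fun s hs => ?_
  rw [Measure.bind_apply hs hm.aemeasurable, Measure.smul_apply, smul_eq_mul, mul_comm,
    ← setLIntegral_const]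
  exact (setLIntegral_mono' hS fun a ha => hle a ha s).trans (setLIntegral_le_lintegral _ _)

lemma bind_univ_le_one [IsProbabilityMeasure μ] (hm : Measurable m)
    (hle : ∀ a, m a Set.univ ≤ 1) : μ.bind m Set.univ ≤ 1 := by
  rw [Measure.bind_apply .univ hm.aemeasurable]
  exact (lintegral_mono hle).trans (by simp)

end Bind

section Pi

variable {ι : Type*} {X : ι → Type*} [∀ i, MeasurableSpace (X i)]
  {μ : ∀ i, Measure (X i)}

lemma pi_mono_of_le [Fintype ι] {ν : ∀ i, Measure (X i)} [∀ i, SigmaFinite (μ i)]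
    (hle : ∀ i, μ i ≤ ν i) : Measure.pi μ ≤ Measure.pi ν := by
  have houter : (Measure.pi μ).toOuterMeasure ≤ OuterMeasure.pi fun i => (ν i).toOuterMeasure := by
    refine OuterMeasure.le_pi.2 fun s _ => ?_
    change Measure.pi μ (Set.univ.pi s) ≤ _
    rw [Measure.pi_pi]
    exact Finset.prod_le_prod' fun i _ => hle i (s i)
  refine Measure.le_iff.2 fun s _ => (houter s).trans ?_
  rw [Measure.pi]
  exact le_toMeasure_apply _ _ s

lemma pi_smul_eq [Fintype ι] [∀ i, SigmaFinite (μ i)] (c : ℝ≥0) :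
    (Measure.pi fun i => c • μ i) = c ^ Fintype.card ι • Measure.pi μ := by
  refine Measure.pi_eq fun s _ => ?_
  simp only [Measure.smul_apply, Measure.pi_pi, ENNReal.smul_def, smul_eq_mul,
    Finset.prod_mul_distrib, Finset.prod_const, Finset.card_univ, ENNReal.coe_pow]

variable [∀ i, SigmaFinite (μ i)] {f : ∀ i, X i → ℝ≥0∞}

lemma lmarginal_prod [DecidableEq ι] (hf : ∀ i, Measurable (f i)) (s : Finset ι) (x : ∀ i, X i) :
    (∫⋯∫⁻_s, (fun y => ∏ j ∈ s, f j (y j)) ∂μ) x = ∏ j ∈ s, ∫⁻ z, f j z ∂μ j := by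
  induction s using Finset.induction_on generalizing x with
  | empty => simp
  | insert k s hk ih =>
    have hinner : ∀ y : ∀ i, X i, ∫⁻ z, ∏ j ∈ insert k s, f j (Function.update y k z j) ∂μ k =
        (∫⁻ z, f k z ∂μ k) * ∏ j ∈ s, f j (y j) := fun y => by
      rw [← lintegral_mul_const _ (hf k)]
      refine lintegral_congr fun z => ?_
      rw [Finset.prod_insert hk, Function.update_self]
      congr 1
      exact Finset.prod_congr rfl fun j hj => by
        rw [Function.update_of_ne (ne_of_mem_of_not_mem hj hk)]
    rw [lmarginal_insert' _ (by fun_prop) hk, Finset.prod_insert hk, ← ih x]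
    simp only [hinner]
    rw [lmarginal, lintegral_const_mul _ (by fun_prop), lmarginal]

lemma lintegral_pi_prod [Fintype ι] (hf : ∀ i, Measurable (f i)) :
    ∫⁻ y, ∏ j, f j (y j) ∂Measure.pi μ = ∏ j, ∫⁻ z, f j z ∂μ j := by
  classical
  rcases isEmpty_or_nonempty (∀ i, X i) with hempty | ⟨⟨x⟩⟩
  · obtain ⟨i, hi⟩ := isEmpty_pi.1 hempty
    rw [Finset.prod_eq_zero (Finset.mem_univ i) (by simp)]
    simp
  · rw [lintegral_eq_lmarginal_univ x, lmarginal_prod hf]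

lemma lintegral_pi_prod_mul_le [DecidableEq ι] [Fintype ι] (hf : ∀ i, Measurable (f i))
    {g : (∀ i, X i) → ℝ≥0∞} (hg : Measurable g) {P : ∀ i, X i → Prop} (hP : ∀ i, ∀ᵐ z ∂μ i, P i z)
    (i : ι) {D : ℝ≥0∞}
    (hD : ∀ y, (∀ j ≠ i, P j (y j)) → ∫⁻ z, f i z * g (Function.update y i z) ∂μ i ≤ D) :
    ∫⁻ y, (∏ j, f j (y j)) * g y ∂Measure.pi μ ≤
      D * ∏ j ∈ Finset.univ.erase i, ∫⁻ z, f j z ∂μ j := by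
  rcases isEmpty_or_nonempty (∀ i, X i) with hempty | ⟨⟨x⟩⟩
  · simp
  have hinner : ∀ y, (∀ j ≠ i, P j (y j)) →
      ∫⁻ z, (∏ j, f j (Function.update y i z j)) * g (Function.update y i z) ∂μ i ≤
        D * ∏ j ∈ Finset.univ.erase i, f j (y j) := fun y hy => by
    refine le_trans (le_of_eq ?_) (mul_le_mul_left (hD y hy) _)
    rw [← lintegral_mul_const _ (by fun_prop)]
    refine lintegral_congr fun z => ?_
    have hrest : ∏ j ∈ Finset.univ.erase i, f j (Function.update y i z j) =
        ∏ j ∈ Finset.univ.erase i, f j (y j) :=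
      Finset.prod_congr rfl fun j hj => by rw [Function.update_of_ne (Finset.ne_of_mem_erase hj)]
    rw [← Finset.mul_prod_erase _ _ (Finset.mem_univ i), Function.update_self, hrest]
    ring
  have hae : ∀ᵐ y ∂Measure.pi fun j : Finset.univ.erase i => μ j,
      ∀ j : Finset.univ.erase i, P j (y j) :=
    ae_all_iff.2 fun j => Measure.tendsto_eval_ae_ae.eventually (hP j)
  rw [lintegral_eq_lmarginal_univ x, lmarginal_erase' _ (by fun_prop) (Finset.mem_univ i),
    ← lmarginal_prod hf _ x, lmarginal, lmarginal, ← lintegral_const_mul _ (by fun_prop)]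
  refine lintegral_mono_ae (hae.mono fun y hy => hinner _ fun j hj => ?_)
  simpa [Function.updateFinset, hj] using hy ⟨j, by simp [hj]⟩

end Pi

/-! ### Bounds for the priors -/

/-- The law of the softmax of `gmrf L τ`: the conditional law, given `τ`, of `q` and of each
column of `C` under the prior. -/
def softmaxLaw (L : Matrix (Fin K) (Fin K) ℝ) (τ : ℝ) : Measure (Fin K → ℝ) :=
  (gmrf L τ).map csoftmax

/-- The columns of a matrix. -/
def columns (C : Matrix (Fin K) (Fin K) ℝ) (i j : Fin K) : ℝ := C j i

lemma measurable_matrix {X : Type*} [MeasurableSpace X] {f : X → Matrix (Fin K) (Fin K) ℝ}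
    (hf : ∀ j i, Measurable fun x => f x j i) : Measurable f :=
  measurable_pi_iff.2 fun j => measurable_pi_iff.2 fun i => hf j i

lemma measurable_matrix_apply (j i : Fin K) :
    Measurable fun C : Matrix (Fin K) (Fin K) ℝ => C j i :=
  (measurable_pi_apply i).comp (measurable_pi_apply (X := fun _ : Fin K => Fin K → ℝ) j)

@[fun_prop]
lemma measurable_columns : Measurable (columns (K := K)) :=
  measurable_pi_iff.2 fun i => measurable_pi_iff.2 fun j => measurable_matrix_apply j i

/-- The points of `Fin K → ℝ` with all coordinates at least `β`. -/
def coordsGe (K : ℕ) (β : ℝ) : Set (Fin K → ℝ) := {c | ∀ i, β ≤ c i}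

lemma measurableSet_coordsGe (β : ℝ) : MeasurableSet (coordsGe K β) := by
  have : coordsGe K β = ⋂ i, {c | β ≤ c i} := by ext; simp [coordsGe]
  rw [this]
  exact MeasurableSet.iInter fun i => measurableSet_le measurable_const (measurable_pi_apply i)

section Prior

variable [NeZero K] {L : Matrix (Fin K) (Fin K) ℝ} {a b : ℝ}

instance isFiniteMeasure_softmaxLaw (L : Matrix (Fin K) (Fin K) ℝ) (τ : ℝ) :
    IsFiniteMeasure (softmaxLaw L τ) :=
  inferInstanceAs (IsFiniteMeasure (Measure.map _ _))

lemma measurable_softmaxLaw (L : Matrix (Fin K) (Fin K) ℝ) : Measurable (softmaxLaw L) :=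
  (Measure.measurable_map csoftmax (by fun_prop)).comp (measurable_gmrf L)

lemma softmaxLaw_univ_le_one (L : Matrix (Fin K) (Fin K) ℝ) (τ : ℝ) :
    softmaxLaw L τ Set.univ ≤ 1 := by
  rw [softmaxLaw, Measure.map_apply (by fun_prop) .univ]
  exact gmrf_univ_le_one L τ

lemma map_csoftmax_pi_gmrf (L : Matrix (Fin K) (Fin K) ℝ) (τ : ℝ) :
    (Measure.pi fun _ : Fin K => gmrf L τ).map (fun φ i => csoftmax (φ i)) =
      Measure.pi fun _ => softmaxLaw L τ :=
  Measure.pi_map_pi (hμ := fun _ => inferInstance) fun _ => by fun_prop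

lemma measurable_pi_softmaxLaw (L : Matrix (Fin K) (Fin K) ℝ) :
    Measurable fun τ => Measure.pi fun _ : Fin K => softmaxLaw L τ := by
  simp only [← map_csoftmax_pi_gmrf]
  exact (Measure.measurable_map _ (by fun_prop)).comp (measurable_pi_gmrf L)

lemma priorTarget_eq_bind (L : Matrix (Fin K) (Fin K) ℝ) (a b : ℝ) :
    priorTarget L a b = (gammaMeasure a b).bind (softmaxLaw L) :=
  map_bind_eq_bind_map (measurable_gmrf L) continuous_csoftmax.measurable

lemma measurable_of_csoftmax : Measurable fun φ : Fin K → centered K =>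
    Matrix.of fun j i => csoftmax (φ i) j :=
  measurable_matrix fun j i => by
    change Measurable fun φ : Fin K → centered K => csoftmax (φ i) j
    fun_prop

lemma map_columns_priorConfusion (L : Matrix (Fin K) (Fin K) ℝ) (a b : ℝ) :
    (priorConfusion L a b).map columns =
      (gammaMeasure a b).bind fun τ => Measure.pi fun _ => softmaxLaw L τ := by
  simp only [← map_csoftmax_pi_gmrf]
  rw [← map_bind_eq_bind_map (measurable_pi_gmrf L) (by fun_prop)]
  exact Measure.map_map measurable_columns measurable_of_csoftmax

lemma priorTarget_univ_le_one (L : Matrix (Fin K) (Fin K) ℝ) (ha : 0 < a) (hb : 0 < b) :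
    priorTarget L a b Set.univ ≤ 1 := by
  have := isProbabilityMeasure_gammaMeasure ha hb
  rw [priorTarget_eq_bind]
  exact bind_univ_le_one (measurable_softmaxLaw L) (softmaxLaw_univ_le_one L)

lemma priorConfusion_univ_le_one (L : Matrix (Fin K) (Fin K) ℝ) (ha : 0 < a) (hb : 0 < b) :
    priorConfusion L a b Set.univ ≤ 1 := by
  have := isProbabilityMeasure_gammaMeasure ha hb
  rw [← Set.preimage_univ (f := columns), ← Measure.map_apply measurable_columns .univ,
    map_columns_priorConfusion]
  refine bind_univ_le_one (measurable_pi_softmaxLaw L) fun τ => ?_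
  rw [Measure.pi_univ]
  exact Finset.prod_le_one (fun _ _ => zero_le) fun _ _ => softmaxLaw_univ_le_one L τ

lemma isFiniteMeasure_priorTarget (L : Matrix (Fin K) (Fin K) ℝ) (ha : 0 < a) (hb : 0 < b) :
    IsFiniteMeasure (priorTarget L a b) :=
  ⟨(priorTarget_univ_le_one L ha hb).trans_lt ENNReal.one_lt_top⟩

lemma isFiniteMeasure_priorConfusion (L : Matrix (Fin K) (Fin K) ℝ) (ha : 0 < a) (hb : 0 < b) :
    IsFiniteMeasure (priorConfusion L a b) :=
  ⟨(priorConfusion_univ_le_one L ha hb).trans_lt ENNReal.one_lt_top⟩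

lemma ae_priorTarget_mem_openSimplex (L : Matrix (Fin K) (Fin K) ℝ) (a b : ℝ) :
    ∀ᵐ q ∂priorTarget L a b, q ∈ openSimplex K :=
  (ae_map_iff (p := (· ∈ openSimplex K)) continuous_csoftmax.measurable.aemeasurable
    measurableSet_openSimplex).2 (Eventually.of_forall csoftmax_mem_openSimplex)

lemma ae_priorConfusion_mem_openSimplex (L : Matrix (Fin K) (Fin K) ℝ) (a b : ℝ) :
    ∀ᵐ C ∂priorConfusion L a b, ∀ i, columns C i ∈ openSimplex K :=
  ae_all_iff.2 fun i => (ae_map_iff (p := fun C => columns C i ∈ openSimplex K)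
    measurable_of_csoftmax.aemeasurable
    (((measurable_pi_apply i).comp measurable_columns) measurableSet_openSimplex)).2
      (Eventually.of_forall fun φ : Fin K → centered K => csoftmax_mem_openSimplex (φ i))

lemma exists_softmaxLaw_le (hL : ∀ v, 0 ≤ centeredForm L v) {s : ℝ} (hs : 0 < s) :
    ∃ M : ℝ≥0, ∀ τ : ℝ, 0 ≤ τ →
      softmaxLaw L τ ≤ (M * (Real.exp (s * τ)).toNNReal) • jacobianMeasure K := by
  obtain ⟨M, hM⟩ := exists_gmrf_le hL hs
  refine ⟨M * ((2 * K : ℝ) ^ simplexDim K).toNNReal, fun τ hτ => ?_⟩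
  refine (Measure.map_mono (hM τ hτ) (by fun_prop)).trans ?_
  rw [Measure.map_smul, mul_right_comm, mul_smul _ ((2 * K : ℝ) ^ simplexDim K).toNNReal]
  gcongr
  exact map_csoftmax_le

lemma norm_le_of_le_csoftmax {φ : centered K} {β : ℝ} (hβ : 0 < β) (hle : ∀ j, β ≤ csoftmax φ j) :
    ‖φ‖ ≤ K * (-Real.log β) := by
  have hK : (0 : ℝ) < K := by exact_mod_cast NeZero.pos K
  have hlower : ∀ j, Real.log β ≤ Real.log (csoftmax φ j) := fun j => Real.log_le_log hβ (hle j)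
  have hupper : ∀ j, Real.log (csoftmax φ j) ≤ 0 := fun j =>
    Real.log_nonpos (hβ.trans_le (hle j)).le
      (le_one_of_mem_openSimplex (csoftmax_mem_openSimplex φ) j)
  have hmean_lower : Real.log β ≤ (K : ℝ)⁻¹ * ∑ j, Real.log (csoftmax φ j) := by
    rw [le_inv_mul_iff₀ hK]
    simpa using Finset.sum_le_sum fun j (_ : j ∈ Finset.univ) => hlower j
  have hmean_upper : (K : ℝ)⁻¹ * ∑ j, Real.log (csoftmax φ j) ≤ 0 :=
    mul_nonpos_of_nonneg_of_nonpos (by positivity) (Finset.sum_nonpos fun j _ => hupper j)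
  refine norm_le_mul_of_abs_le φ fun i => ?_
  have hφ : φ.1 i = Real.log (csoftmax φ i) - (K : ℝ)⁻¹ * ∑ j, Real.log (csoftmax φ j) := by
    conv_lhs => rw [← logChart_displacement_csoftmax φ, logChart, centering_apply]
    simp
  rw [hφ, abs_le]
  constructor <;> linarith [hlower i, hupper i]

lemma exists_le_softmaxLaw (hL : CenteredPosDef L) {s : ℝ} (hs : 0 < s) (t : ℝ) {β : ℝ}
    (hβ : 0 < β) :
    ∃ κ : ℝ≥0, κ ≠ 0 ∧ ∀ τ ∈ Set.Icc s t,
      κ • (simplexMeasure K).restrict (coordsGe K β) ≤ softmaxLaw L τ := by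
  obtain ⟨κ, hκ, hle⟩ := exists_le_gmrf hL hs t (K * (-Real.log β))
  refine ⟨κ, hκ, fun τ hτ => le_trans ?_ (Measure.map_mono (hle τ hτ) (by fun_prop))⟩
  rw [Measure.map_smul]
  gcongr
  have hball : csoftmax ⁻¹' coordsGe K β ⊆ Metric.closedBall 0 (K * (-Real.log β)) := fun φ hφ =>
    mem_closedBall_zero_iff.2 (norm_le_of_le_csoftmax hβ hφ)
  calc (simplexMeasure K).restrict (coordsGe K β)
      ≤ (Measure.map csoftmax volume).restrict (coordsGe K β) :=
        Measure.restrict_mono' .rfl simplexMeasure_le_map_csoftmax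
    _ = (volume.restrict (csoftmax ⁻¹' coordsGe K β)).map csoftmax :=
        Measure.restrict_map (by fun_prop) (measurableSet_coordsGe β)
    _ ≤ (volume.restrict (Metric.closedBall 0 (K * (-Real.log β)))).map csoftmax :=
        Measure.map_mono (Measure.restrict_mono hball le_rfl) (by fun_prop)

lemma exists_le_priorTarget (hL : CenteredPosDef L) (ha : 0 < a) (hb : 0 < b) {β : ℝ}
    (hβ : 0 < β) :
    ∃ κ : ℝ≥0∞, κ ≠ 0 ∧ κ • (simplexMeasure K).restrict (coordsGe K β) ≤ priorTarget L a b := by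
  obtain ⟨κ, hκ, hle⟩ := exists_le_softmaxLaw hL one_pos 2 hβ
  refine ⟨gammaMeasure a b (Set.Icc 1 2) * κ,
    mul_ne_zero (gammaMeasure_Icc_ne_zero ha hb one_pos one_lt_two) (by simpa), ?_⟩
  rw [priorTarget_eq_bind, mul_smul]
  exact measure_smul_le_bind (measurable_softmaxLaw L) measurableSet_Icc hle

lemma exists_le_map_columns_priorConfusion (hL : CenteredPosDef L) (ha : 0 < a) (hb : 0 < b)
    {β : ℝ} (hβ : 0 < β) :
    ∃ κ : ℝ≥0∞, κ ≠ 0 ∧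
      κ • Measure.pi (fun _ : Fin K => (simplexMeasure K).restrict (coordsGe K β)) ≤
        (priorConfusion L a b).map columns := by
  obtain ⟨κ, hκ, hle⟩ := exists_le_softmaxLaw hL one_pos 2 hβ
  refine ⟨gammaMeasure a b (Set.Icc 1 2) * ↑(κ ^ K),
    mul_ne_zero (gammaMeasure_Icc_ne_zero ha hb one_pos one_lt_two) (by simp [hκ]), ?_⟩
  rw [map_columns_priorConfusion, mul_smul]
  refine measure_smul_le_bind (measurable_pi_softmaxLaw L) measurableSet_Icc fun τ hτ => ?_
  have hpi := pi_smul_eq (μ := fun _ : Fin K => (simplexMeasure K).restrict (coordsGe K β)) κ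
  rw [Fintype.card_fin] at hpi
  exact hpi.symm.trans_le (pi_mono_of_le fun _ => hle τ hτ)

lemma exists_map_columns_priorConfusion_le (hL : ∀ v, 0 ≤ centeredForm L v) (ha : 0 < a)
    (hb : 0 < b) :
    ∃ M : ℝ≥0∞, M ≠ ⊤ ∧
      (priorConfusion L a b).map columns ≤ M • Measure.pi fun _ => jacobianMeasure K := by
  have hK : (0 : ℝ) < K := by exact_mod_cast NeZero.pos K
  obtain ⟨M, hM⟩ := exists_softmaxLaw_le hL (s := b / 2 / K) (by positivity)
  have hpow : ∀ τ : ℝ, (((Real.exp (b / 2 / K * τ)).toNNReal ^ K : ℝ≥0) : ℝ≥0∞) =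
      ENNReal.ofReal (Real.exp (b / 2 * τ)) := fun τ => by
    have hexp : (K : ℝ) * (b / 2 / K * τ) = b / 2 * τ := by field_simp
    rw [← Real.toNNReal_pow (Real.exp_pos _).le, ← Real.exp_nat_mul, hexp]
    rfl
  refine ⟨∫⁻ τ, ↑(M ^ K) * ENNReal.ofReal (Real.exp (b / 2 * τ)) ∂gammaMeasure a b, ?_, ?_⟩
  · rw [lintegral_const_mul _ (by fun_prop), lintegral_exp_gammaMeasure ha hb (half_lt_self hb)]
    exact ENNReal.mul_ne_top ENNReal.coe_ne_top ENNReal.ofReal_ne_top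
  · rw [map_columns_priorConfusion]
    refine bind_le_lintegral_smul (measurable_pi_softmaxLaw L) (by fun_prop) ?_
    filter_upwards [ae_nonneg_gammaMeasure a b] with τ hτ
    refine (pi_mono_of_le fun _ => hM τ hτ).trans_eq ?_
    rw [pi_smul_eq, Fintype.card_fin, mul_pow, ← hpow, ← ENNReal.coe_mul]
    rfl

end Prior

/-! ### Concentration of monomials on the simplex -/

/-- The monomial `∏ j, c j ^ k j`: the multinomial likelihood of the counts `k`, without its
multinomial coefficient. -/
def monomialWeight (k : Fin K → ℕ) (c : Fin K → ℝ) : ℝ≥0∞ := ENNReal.ofReal (∏ j, c j ^ k j)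

@[fun_prop]
lemma measurable_monomialWeight (k : Fin K → ℕ) : Measurable (monomialWeight k) := by
  unfold monomialWeight
  fun_prop

lemma monomialWeight_le_one (k : Fin K → ℕ) {c : Fin K → ℝ} (hc : c ∈ openSimplex K) :
    monomialWeight k c ≤ 1 := by
  rw [monomialWeight, ENNReal.ofReal_le_one]
  exact Finset.prod_le_one (fun j _ => pow_nonneg (hc.1 j).le _) fun j _ =>
    pow_le_one₀ (hc.1 j).le (le_one_of_mem_openSimplex hc j)

lemma monomialWeight_ne_zero (k : Fin K → ℕ) {c : Fin K → ℝ} (hc : c ∈ openSimplex K) :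
    monomialWeight k c ≠ 0 := by
  rw [monomialWeight, Ne, ENNReal.ofReal_eq_zero, not_le]
  exact Finset.prod_pos fun j _ => pow_pos (hc.1 j) _

lemma monomialWeight_eq_exp (k : Fin K → ℕ) {c : Fin K → ℝ} (hc : c ∈ openSimplex K) :
    monomialWeight k c = ENNReal.ofReal (Real.exp (∑ j, (k j : ℝ) * Real.log (c j))) := by
  rw [monomialWeight, Real.exp_sum]
  congr 1
  refine Finset.prod_congr rfl fun j _ => ?_
  rw [Real.exp_nat_mul, Real.exp_log (hc.1 j)]

lemma jacobianBound_mul_monomialWeight (k : Fin K → ℕ) {c : Fin K → ℝ} (hc : c ∈ openSimplex K) :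
    jacobianBound c * monomialWeight k c =
      ENNReal.ofReal (Real.exp (∑ j, ((k j : ℝ) - simplexDim K) * Real.log (c j))) := by
  have hprod : 0 < ∏ j, c j := prod_pos_of_mem_openSimplex hc
  rw [monomialWeight_eq_exp k hc, jacobianBound, ← ENNReal.ofReal_mul (by positivity)]
  congr 1
  simp only [sub_mul, Finset.sum_sub_distrib, Real.exp_sub]
  rw [← Finset.mul_sum, Real.exp_nat_mul, ← Real.log_prod fun j _ => (hc.1 j).ne',
    Real.exp_log hprod, inv_mul_eq_div]

/-- The mass of a monomial near a point of the simplex. -/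
def localMass (p : Fin K → ℝ) (r : ℝ) (k : Fin K → ℕ) : ℝ≥0∞ :=
  ∫⁻ c in Metric.ball p r, monomialWeight k c ∂simplexMeasure K

lemma simplexMeasure_ball_ne_zero [NeZero K] {p : Fin K → ℝ} (hp : p ∈ openSimplex K) {r : ℝ}
    (hr : 0 < r) : simplexMeasure K (Metric.ball p r) ≠ 0 := by
  rw [simplexMeasure, Measure.map_apply (by fun_prop) measurableSet_ball,
    Measure.restrict_apply (measurableSet_ball.preimage (by fun_prop))]
  have hopen : IsOpen (simplexPoint ⁻¹' Metric.ball p r ∩ simplexChart K) :=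
    (Metric.isOpen_ball.preimage continuous_simplexPoint).inter isOpen_simplexChart
  refine (hopen.measure_pos _ ⟨displacement p hp.2, ?_, fun j => ?_⟩).ne'
  · simpa [simplexPoint_displacement] using hr
  · simpa [simplexPoint_displacement] using hp.1 j

lemma localMass_ne_zero [NeZero K] {p : Fin K → ℝ} (hp : p ∈ openSimplex K) {r : ℝ} (hr : 0 < r)
    (k : Fin K → ℕ) : localMass p r k ≠ 0 := by
  have hzero := simplexMeasure_ball_ne_zero hp hr
  contrapose! hzero
  rw [localMass, lintegral_eq_zero_iff (by fun_prop)] at hzero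
  rw [← Measure.restrict_eq_zero, ← ae_eq_bot, ← Filter.empty_mem_iff_bot]
  filter_upwards [hzero, ae_restrict_of_ae ae_simplexMeasure_mem_openSimplex] with c hc hcK
  exact monomialWeight_ne_zero k hcK hc

lemma localMass_ne_top [NeZero K] (p : Fin K → ℝ) (r : ℝ) (k : Fin K → ℕ) :
    localMass p r k ≠ ⊤ := by
  refine ne_top_of_le_ne_top (measure_ne_top (simplexMeasure K) Set.univ) ?_
  calc localMass p r k ≤ ∫⁻ c, monomialWeight k c ∂simplexMeasure K :=
        setLIntegral_le_lintegral _ _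
    _ ≤ ∫⁻ _, 1 ∂simplexMeasure K :=
        lintegral_mono_ae (ae_simplexMeasure_mem_openSimplex.mono fun c hc =>
          monomialWeight_le_one k hc)
    _ = simplexMeasure K Set.univ := lintegral_one

lemma half_le_of_mem_ball {p c : Fin K → ℝ} {r : ℝ} (hrp : ∀ j, r ≤ p j / 2)
    (hc : c ∈ Metric.ball p r) (j : Fin K) : p j / 2 ≤ c j := by
  have hdist := (dist_le_pi_dist c p j).trans_lt hc
  rw [Real.dist_eq, abs_lt] at hdist
  linarith [hrp j]

lemma mul_log_le_of_le_one {p c : ℝ} (hp : 0 < p) (hp1 : p ≤ 1) (hc : 0 < c) (hc1 : c ≤ 1) :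
    p * Real.log c ≤ p * Real.log p + (c - p) - (c - p) ^ 2 / 4 := by
  obtain ⟨x, hx, rfl⟩ : ∃ x, 0 < x ∧ x ^ 2 = c := ⟨√c, Real.sqrt_pos.2 hc, Real.sq_sqrt hc.le⟩
  obtain ⟨y, hy, rfl⟩ : ∃ y, 0 < y ∧ y ^ 2 = p := ⟨√p, Real.sqrt_pos.2 hp, Real.sq_sqrt hp.le⟩
  have hx1 : x ≤ 1 := (sq_le_one_iff₀ hx.le).1 hc1
  have hy1 : y ≤ 1 := (sq_le_one_iff₀ hy.le).1 hp1
  have hlog : y ^ 2 * Real.log (x / y) ≤ y * x - y ^ 2 :=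
    calc y ^ 2 * Real.log (x / y) ≤ y ^ 2 * (x / y - 1) :=
          mul_le_mul_of_nonneg_left (Real.log_le_sub_one_of_pos (by positivity)) (sq_nonneg y)
      _ = y * x - y ^ 2 := by field_simp
  -- The Hellinger distance `(x - y)²` dominates a quarter of `(x² - y²)²`, as `x + y ≤ 2`.
  have hsq : (x ^ 2 - y ^ 2) ^ 2 ≤ 4 * (x - y) ^ 2 :=
    calc (x ^ 2 - y ^ 2) ^ 2 = (x + y) ^ 2 * (x - y) ^ 2 := by ring
      _ ≤ 4 * (x - y) ^ 2 := mul_le_mul_of_nonneg_right (by nlinarith) (sq_nonneg _)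
  rw [Real.log_div hx.ne' hy.ne'] at hlog
  simp only [Real.log_pow, Nat.cast_ofNat]
  nlinarith

lemma sum_mul_log_le {p c : Fin K → ℝ} (hp : p ∈ openSimplex K) (hc : c ∈ openSimplex K) :
    ∑ j, p j * Real.log (c j) ≤ ∑ j, p j * Real.log (p j) - ∑ j, (c j - p j) ^ 2 / 4 := by
  have hsum := Finset.sum_le_sum fun j (_ : j ∈ Finset.univ) =>
    mul_log_le_of_le_one (hp.1 j) (le_one_of_mem_openSimplex hp j) (hc.1 j)
      (le_one_of_mem_openSimplex hc j)
  rw [Finset.sum_sub_distrib, Finset.sum_add_distrib, Finset.sum_sub_distrib, hp.2, hc.2] at hsum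
  linarith

lemma sum_mul_log_le_of_notMem_ball {p c : Fin K → ℝ} (hp : p ∈ openSimplex K)
    (hc : c ∈ openSimplex K) {r : ℝ} (hr : 0 < r) (hcr : c ∉ Metric.ball p r) :
    ∑ j, p j * Real.log (c j) ≤ ∑ j, p j * Real.log (p j) - r ^ 2 / 4 := by
  rw [Metric.mem_ball, dist_pi_lt_iff hr] at hcr
  push Not at hcr
  obtain ⟨i, hi⟩ := hcr
  have hsq : r ^ 2 ≤ (c i - p i) ^ 2 := by
    simpa only [Real.dist_eq, sq_abs] using pow_le_pow_left₀ hr.le hi 2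
  have hsingle : (c i - p i) ^ 2 / 4 ≤ ∑ j, (c j - p j) ^ 2 / 4 :=
    Finset.single_le_sum (f := fun j => (c j - p j) ^ 2 / 4) (fun j _ => by positivity)
      (Finset.mem_univ i)
  linarith [sum_mul_log_le hp hc]

lemma sum_mul_log_antitone {c : Fin K → ℝ} (hc : c ∈ openSimplex K) {k k' : Fin K → ℝ}
    (hle : ∀ j, k j ≤ k' j) :
    ∑ j, k' j * Real.log (c j) ≤ ∑ j, k j * Real.log (c j) :=
  Finset.sum_le_sum fun j _ => mul_le_mul_of_nonpos_right (hle j)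
    (Real.log_nonpos (hc.1 j).le (le_one_of_mem_openSimplex hc j))

lemma exists_lt_sum_mul_log {p : Fin K → ℝ} (hp : p ∈ openSimplex K) {η : ℝ} (hη : 0 < η) :
    ∃ ρ > 0, ∀ b ∈ Metric.ball p ρ,
      ∑ j, p j * Real.log (p j) - η < ∑ j, p j * Real.log (b j) := by
  have hcont : ContinuousAt (fun b : Fin K → ℝ => ∑ j, p j * Real.log (b j)) p :=
    tendsto_finsetSum _ fun j _ => ((continuousAt_apply j p).log (hp.1 j).ne').const_mul _
  exact Metric.eventually_nhds_iff_ball.1 (hcont.eventually_mem (lt_mem_nhds (sub_lt_self _ hη)))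

lemma exists_sum_log_gap {p : Fin K → ℝ} (hp : p ∈ openSimplex K) {r : ℝ} (hr : 0 < r) :
    ∃ η > 0, ∃ s > 0, ∃ ρ > 0, ∀ t : ℝ, 0 ≤ t → ∀ c ∈ openSimplex K, c ∉ Metric.ball p r →
      ∀ b ∈ openSimplex K, b ∈ Metric.ball p ρ → ∀ k k' : Fin K → ℝ,
      (∀ j, (1 - s) * t * p j ≤ k j) → (∀ j, k' j ≤ (1 + s) * t * p j) →
      ∑ j, k j * Real.log (c j) + t * η ≤ ∑ j, k' j * Real.log (b j) := by
  set H := ∑ j, p j * Real.log (p j)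
  obtain ⟨ρ, hρ, hnear⟩ := exists_lt_sum_mul_log hp (η := r ^ 2 / 32) (by positivity)
  set s := min (1 / 2) (r ^ 2 / 64 / (|H| + 1))
  have hs : 0 < s := by positivity
  have hs_half : s ≤ 1 / 2 := min_le_left _ _
  have hsH : s * (|H| + 1) ≤ r ^ 2 / 64 := by
    rw [← le_div_iff₀ (by positivity)]
    exact min_le_right _ _
  refine ⟨r ^ 2 / 32, by positivity, s, hs, ρ, hρ, fun t ht c hc hcr b hb hbρ k k' hk hk' => ?_⟩
  have hpull : ∀ (a : ℝ) (x : Fin K → ℝ),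
      ∑ j, a * p j * Real.log (x j) = a * ∑ j, p j * Real.log (x j) := fun a x => by
    simp only [Finset.mul_sum, mul_assoc]
  have hgap : (1 - s) * (H - r ^ 2 / 4) + r ^ 2 / 32 ≤ (1 + s) * (H - r ^ 2 / 32) := by
    have hsH' : s * (-H) ≤ r ^ 2 / 64 :=
      (mul_le_mul_of_nonneg_left (by linarith [neg_abs_le H]) hs.le).trans hsH
    nlinarith [sq_nonneg r]
  calc ∑ j, k j * Real.log (c j) + t * (r ^ 2 / 32)
      ≤ (1 - s) * t * ∑ j, p j * Real.log (c j) + t * (r ^ 2 / 32) := by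
        gcongr
        exact (sum_mul_log_antitone hc hk).trans_eq (hpull _ c)
    _ ≤ (1 - s) * t * (H - r ^ 2 / 4) + t * (r ^ 2 / 32) := by
        gcongr
        · exact mul_nonneg (by linarith) ht
        · exact sum_mul_log_le_of_notMem_ball hp hc hr hcr
    _ = t * ((1 - s) * (H - r ^ 2 / 4) + r ^ 2 / 32) := by ring
    _ ≤ t * ((1 + s) * (H - r ^ 2 / 32)) := by gcongr
    _ = (1 + s) * t * (H - r ^ 2 / 32) := by ring
    _ ≤ (1 + s) * t * ∑ j, p j * Real.log (b j) := by
        gcongr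
        exact (hnear b hbρ).le
    _ ≤ ∑ j, k' j * Real.log (b j) := (hpull _ b).symm.trans_le (sum_mul_log_antitone hb hk')

/-- The count vectors with total `n` whose empirical frequencies are within `s` of `p`. -/
def typicalCounts (n : ℕ) (p : Fin K → ℝ) (s : ℝ) : Set (Fin K → ℕ) :=
  {k | ∑ j, k j = n ∧ ∀ j, |(k j : ℝ) - n * p j| ≤ s * n}

lemma typicalCounts_mono (n : ℕ) (p : Fin K → ℝ) {s s' : ℝ} (hs : s ≤ s') :
    typicalCounts n p s ⊆ typicalCounts n p s' := fun _ hk =>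
  ⟨hk.1, fun j => (hk.2 j).trans (mul_le_mul_of_nonneg_right hs n.cast_nonneg)⟩

lemma exists_monomialWeight_gap [NeZero K] {p : Fin K → ℝ} (hp : p ∈ openSimplex K) {r : ℝ}
    (hr : 0 < r) :
    ∃ η > 0, ∃ s > 0, ∃ ρ > 0, ∃ n₀ : ℕ, ∀ n ≥ n₀, ∀ k ∈ typicalCounts n p s,
      ∀ c ∈ openSimplex K, c ∉ Metric.ball p r → ∀ b ∈ openSimplex K, b ∈ Metric.ball p ρ →
      jacobianBound c * monomialWeight k c * ENNReal.ofReal (Real.exp (n * η)) ≤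
        monomialWeight k b := by
  obtain ⟨η, hη, s, hs, ρ, hρ, hgap⟩ := exists_sum_log_gap hp hr
  obtain ⟨i₀, hi₀⟩ := Finite.exists_min p
  set m := p i₀
  have hm : 0 < m := hp.1 i₀
  refine ⟨η, hη, s * m / 2, by positivity, ρ, hρ, ⌈2 * simplexDim K / (s * m)⌉₊,
    fun n hn k hk c hc hcr b hb hbρ => ?_⟩
  -- Dividing by the Jacobian lowers all exponents by `simplexDim K`, which is negligible.
  have hdim : (simplexDim K : ℝ) ≤ s * m / 2 * n := by
    have hceil : 2 * simplexDim K / (s * m) ≤ (n : ℝ) :=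
      (Nat.le_ceil _).trans (by exact_mod_cast hn)
    rw [div_le_iff₀ (by positivity)] at hceil
    linarith
  have hmp : ∀ j, s * m * n ≤ s * n * p j := fun j => by
    linarith [mul_le_mul_of_nonneg_left (hi₀ j) (mul_nonneg hs.le n.cast_nonneg)]
  rw [jacobianBound_mul_monomialWeight k hc, monomialWeight_eq_exp k hb,
    ← ENNReal.ofReal_mul (Real.exp_pos _).le, ← Real.exp_add]
  refine ENNReal.ofReal_le_ofReal (Real.exp_le_exp.2 ?_)
  refine hgap n n.cast_nonneg c hc hcr b hb hbρ _ _ (fun j => ?_) fun j => ?_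
  · linarith [(abs_le.1 (hk.2 j)).1, hmp j]
  · linarith [(abs_le.1 (hk.2 j)).2, hmp j]

/-- Concentration of the monomial with exponents `k` near `p`, relative to its local mass: it is
negligible away from `p`, up to the factor `γ`, and its total mass is comparable, up to the
factor `N`, with its local mass. Both hold against the blow-up of `jacobianBound`. -/
structure Concentrates (p : Fin K → ℝ) (r : ℝ) (N γ : ℝ≥0∞) (k : Fin K → ℕ) : Prop where
  far : ∀ c ∈ openSimplex K, c ∉ Metric.ball p r →
    jacobianBound c * monomialWeight k c ≤ γ * localMass p r k
  total : ∫⁻ c, monomialWeight k c ∂jacobianMeasure K ≤ N * localMass p r k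

lemma Concentrates.mono {p : Fin K → ℝ} {r : ℝ} {N N' γ γ' : ℝ≥0∞} {k : Fin K → ℕ}
    (h : Concentrates p r N γ k) (hN : N ≤ N') (hγ : γ ≤ γ') : Concentrates p r N' γ' k :=
  ⟨fun c hc hcr => (h.far c hc hcr).trans (mul_le_mul_left hγ _),
    h.total.trans (mul_le_mul_left hN _)⟩

lemma Concentrates.lintegral_simplexMeasure_le [NeZero K] {k : Fin K → ℕ} {p : Fin K → ℝ}
    {r : ℝ} {N γ : ℝ≥0∞} (h : Concentrates p r N γ k) :
    ∫⁻ c, monomialWeight k c ∂simplexMeasure K ≤ N * localMass p r k :=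
  (lintegral_mono' simplexMeasure_le_jacobianMeasure le_rfl).trans h.total

lemma tendsto_inv_mul_exp {V : ℝ≥0∞} (hV : V ≠ 0) {η : ℝ} (hη : 0 < η) :
    Tendsto (fun n : ℕ => (V * ENNReal.ofReal (Real.exp (n * η)))⁻¹) atTop (𝓝 0) := by
  have hexp : Tendsto (fun n : ℕ => ENNReal.ofReal (Real.exp (n * η))) atTop (𝓝 ⊤) :=
    ENNReal.tendsto_ofReal_nhds_top.2 (Real.tendsto_exp_atTop.comp
      (tendsto_natCast_atTop_atTop.atTop_mul_const hη))
  have hmul := ENNReal.Tendsto.const_mul (a := V) hexp (Or.inl ENNReal.top_ne_zero)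
  rw [ENNReal.mul_top hV] at hmul
  simpa using hmul.inv

lemma exists_far_le_localMass [NeZero K] {p : Fin K → ℝ} (hp : p ∈ openSimplex K) {r : ℝ}
    (hr : 0 < r) :
    ∃ γ : ℕ → ℝ≥0∞, Tendsto γ atTop (𝓝 0) ∧ ∃ s > 0, ∃ n₀ : ℕ, ∀ n ≥ n₀,
      ∀ k ∈ typicalCounts n p s, ∀ c ∈ openSimplex K, c ∉ Metric.ball p r →
      jacobianBound c * monomialWeight k c ≤ γ n * localMass p r k := by
  obtain ⟨η, hη, s, hs, ρ, hρ, n₀, hgap⟩ := exists_monomialWeight_gap hp hr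
  set V := simplexMeasure K (Metric.ball p (min ρ r))
  have hV0 : V ≠ 0 := simplexMeasure_ball_ne_zero hp (lt_min hρ hr)
  have hVtop : V ≠ ⊤ := measure_ne_top _ _
  refine ⟨_, tendsto_inv_mul_exp hV0 hη, s, hs, n₀, fun n hn k hk c hc hcr => ?_⟩
  set J := jacobianBound c * monomialWeight k c * ENNReal.ofReal (Real.exp (n * η))
  have hlocal : J * V ≤ localMass p r k :=
    calc J * V = ∫⁻ _ in Metric.ball p (min ρ r), J ∂simplexMeasure K :=
          (setLIntegral_const _ _).symm
      _ ≤ ∫⁻ b in Metric.ball p (min ρ r), monomialWeight k b ∂simplexMeasure K := by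
          refine lintegral_mono_ae ?_
          filter_upwards [ae_restrict_mem measurableSet_ball,
            ae_restrict_of_ae ae_simplexMeasure_mem_openSimplex] with b hb hbK
          exact hgap n hn k hk c hc hcr b hbK (Metric.ball_subset_ball (min_le_left _ _) hb)
      _ ≤ localMass p r k := lintegral_mono_set (Metric.ball_subset_ball (min_le_right _ _))
  rw [mul_comm _ (localMass p r k), ← div_eq_mul_inv, ENNReal.le_div_iff_mul_le
    (Or.inl (mul_ne_zero hV0 (by simp [Real.exp_pos])))
    (Or.inl (ENNReal.mul_ne_top hVtop ENNReal.ofReal_ne_top))]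
  exact (by ring : _ = J * V).trans_le hlocal

lemma exists_lintegral_ball_le_localMass {p : Fin K → ℝ} (hp : ∀ j, 0 < p j) {r : ℝ}
    (hrp : ∀ j, r ≤ p j / 2) :
    ∃ w : ℝ≥0∞, w ≠ ⊤ ∧ ∀ k : Fin K → ℕ,
      ∫⁻ c in Metric.ball p r, jacobianBound c * monomialWeight k c ∂simplexMeasure K ≤
        w * localMass p r k := by
  refine ⟨ENNReal.ofReal ((∏ j, p j / 2) ^ simplexDim K)⁻¹, ENNReal.ofReal_ne_top, fun k => ?_⟩
  rw [localMass, ← lintegral_const_mul' _ _ ENNReal.ofReal_ne_top]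
  refine setLIntegral_mono' measurableSet_ball fun c hc => ?_
  have hprod : 0 < ∏ j, p j / 2 := Finset.prod_pos fun j _ => half_pos (hp j)
  unfold jacobianBound
  gcongr with j
  · exact fun j _ => (half_pos (hp j)).le
  · exact half_le_of_mem_ball hrp hc j

lemma exists_concentrates [NeZero K] {p : Fin K → ℝ} (hp : p ∈ openSimplex K) {r : ℝ} (hr : 0 < r)
    (hrp : ∀ j, r ≤ p j / 2) :
    ∃ N : ℝ≥0∞, N ≠ ⊤ ∧ ∃ γ : ℕ → ℝ≥0∞, Tendsto γ atTop (𝓝 0) ∧ ∃ s > 0, ∃ n₀ : ℕ,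
      ∀ n ≥ n₀, ∀ k ∈ typicalCounts n p s, Concentrates p r N (γ n) k := by
  obtain ⟨γ, hγ, s, hs, n₁, hfar⟩ := exists_far_le_localMass hp hr
  obtain ⟨w, hw, hball⟩ := exists_lintegral_ball_le_localMass hp.1 hrp
  obtain ⟨n₂, hn₂⟩ := eventually_atTop.1 (hγ.eventually_le_const one_pos)
  set μ := simplexMeasure K
  refine ⟨w + μ Set.univ, ENNReal.add_ne_top.2 ⟨hw, measure_ne_top _ _⟩, γ, hγ, s, hs,
    max n₁ n₂, fun n hn k hk => ?_⟩
  have hfar' := hfar n (le_of_max_le_left hn) k hk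
  refine ⟨hfar', ?_⟩
  have hcompl : ∫⁻ c in (Metric.ball p r)ᶜ, jacobianBound c * monomialWeight k c ∂μ ≤
      μ Set.univ * localMass p r k :=
    calc _ ≤ ∫⁻ _ in (Metric.ball p r)ᶜ, localMass p r k ∂μ := by
          refine lintegral_mono_ae ?_
          filter_upwards [ae_restrict_mem measurableSet_ball.compl,
            ae_restrict_of_ae ae_simplexMeasure_mem_openSimplex] with c hcr hc
          exact (hfar' c hc hcr).trans (mul_le_of_le_one_left' (hn₂ n (le_of_max_le_right hn)))
      _ = μ (Metric.ball p r)ᶜ * localMass p r k := by rw [setLIntegral_const, mul_comm]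
      _ ≤ μ Set.univ * localMass p r k := by
          gcongr
          exact Set.subset_univ _
  rw [lintegral_jacobianMeasure (measurable_monomialWeight k),
    ← lintegral_add_compl _ (measurableSet_ball (x := p) (ε := r)), add_mul]
  exact add_le_add (hball k) hcompl

/-! ### Mixtures of columns -/

/-- The mixture with weights `q` of the vectors `c i`; for `c = columns C` it is `C *ᵥ q`. -/
def mixture (q : Fin K → ℝ) (c : Fin K → Fin K → ℝ) (l : Fin K) : ℝ := ∑ i, c i l * q i

lemma mulVec_eq_mixture (C : Matrix (Fin K) (Fin K) ℝ) (q : Fin K → ℝ) :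
    C *ᵥ q = mixture q (columns C) := rfl

@[fun_prop]
lemma continuous_mixture :
    Continuous fun x : (Fin K → ℝ) × (Fin K → Fin K → ℝ) => mixture x.1 x.2 := by
  unfold mixture
  fun_prop

lemma mixture_sub (v w : Fin K → ℝ) (c : Fin K → Fin K → ℝ) :
    mixture (v - w) c = mixture v c - mixture w c := by
  ext l
  simp [mixture, mul_sub, Finset.sum_sub_distrib]

lemma mixture_update (q : Fin K → ℝ) (c : Fin K → Fin K → ℝ) (i : Fin K) (x y : Fin K → ℝ) :
    mixture q (Function.update c i x) = mixture q (Function.update c i y) + q i • (x - y) := by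
  ext l
  have hterm : ∀ j, Function.update c i x j l * q j =
      Function.update c i y j l * q j + if j = i then q i * (x l - y l) else 0 := fun j => by
    rcases eq_or_ne j i with rfl | hj
    · simp only [Function.update_self, if_true]
      ring
    · simp [hj]
  simp only [mixture, hterm, Finset.sum_add_distrib, Finset.sum_ite_eq', Finset.mem_univ, if_true]
  rfl

lemma sum_mixture {q : Fin K → ℝ} {c : Fin K → Fin K → ℝ} (hc : ∀ i, ∑ l, c i l = 1) :
    ∑ l, mixture q c l = ∑ i, q i := by
  simp only [mixture]
  rw [Finset.sum_comm]
  simp [← Finset.sum_mul, hc]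

lemma mixture_mem_openSimplex [NeZero K] {q : Fin K → ℝ} {c : Fin K → Fin K → ℝ}
    (hq : q ∈ openSimplex K) (hc : ∀ i, c i ∈ openSimplex K) : mixture q c ∈ openSimplex K :=
  ⟨fun l => Finset.sum_pos (fun i _ => mul_pos ((hc i).1 l) (hq.1 i)) Finset.univ_nonempty,
    (sum_mixture fun i => (hc i).2).trans hq.2⟩

lemma lintegral_comp_linearMap_add {A : centered K →ₗ[ℝ] centered K} (hA : LinearMap.det A ≠ 0)
    (w : centered K) {F : centered K → ℝ≥0∞} (hF : Measurable F) :
    ∫⁻ h, F (A h + w) = ENNReal.ofReal |(LinearMap.det A)⁻¹| * ∫⁻ h, F h := by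
  have hAmeas : Measurable A := A.continuous_of_finiteDimensional.measurable
  rw [← lintegral_map (μ := volume) (f := fun y => F (y + w)) (by fun_prop) hAmeas,
    Measure.map_linearMap_addHaar_eq_smul_addHaar _ hA, lintegral_smul_measure,
    lintegral_add_right_eq_self F w, smul_eq_mul]

lemma forall_update_mem_openSimplex {c : Fin K → Fin K → ℝ} {i : Fin K}
    (hc : ∀ j ≠ i, c j ∈ openSimplex K) {z : Fin K → ℝ} (hz : z ∈ openSimplex K) (j : Fin K) :
    Function.update c i z j ∈ openSimplex K := by
  rcases eq_or_ne j i with rfl | hj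
  · simpa
  · simpa [hj] using hc j hj

lemma exists_mixture_update_simplexPoint [NeZero K] {q : Fin K → ℝ} {c : Fin K → Fin K → ℝ}
    (hq : ∑ j, q j = 1) {i : Fin K} (hc : ∀ j ≠ i, ∑ l, c j l = 1) :
    ∃ w : centered K, ∀ h : centered K,
      mixture q (Function.update c i (simplexPoint h)) = simplexPoint (q i • h + w) := by
  have hsum : ∑ l, mixture q (Function.update c i (simplexPoint 0)) l = 1 := by
    refine (sum_mixture fun j => ?_).trans hq
    rcases eq_or_ne j i with rfl | hj
    · simp [sum_simplexPoint]
    · simp [hj, hc j hj]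
  refine ⟨displacement _ hsum, fun h => ?_⟩
  have hbase := simplexPoint_displacement _ hsum
  rw [mixture_update q c i _ (simplexPoint 0)]
  ext l
  rw [Pi.add_apply, ← congrFun hbase l]
  simp only [simplexPoint, Pi.smul_apply, Pi.sub_apply, smul_eq_mul, Submodule.coe_add,
    Submodule.coe_smul, Submodule.coe_zero, PiLp.add_apply, PiLp.smul_apply, PiLp.zero_apply]
  ring

/-- If the `i`-th column is uniform on the simplex, a mixture giving it weight at least `η` has a
bounded density. -/
lemma lintegral_mixture_update_le [NeZero K] {q : Fin K → ℝ} {c : Fin K → Fin K → ℝ}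
    (hq : q ∈ openSimplex K) {i : Fin K} (hc : ∀ j ≠ i, c j ∈ openSimplex K) {η : ℝ} (hη : 0 < η)
    (hqi : η ≤ q i) {T : (Fin K → ℝ) → ℝ≥0∞} (hT : Measurable T) :
    ∫⁻ z, T (mixture q (Function.update c i z)) ∂simplexMeasure K ≤
      ENNReal.ofReal (η ^ simplexDim K)⁻¹ * ∫⁻ z, T z ∂simplexMeasure K := by
  obtain ⟨w, hw⟩ := exists_mixture_update_simplexPoint hq.2 fun j hj => (hc j hj).2
  have hdet : LinearMap.det (q i • (LinearMap.id : centered K →ₗ[ℝ] centered K)) =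
      q i ^ simplexDim K := by simp
  have hqi_pos : 0 < q i := hq.1 i
  have hchart := isOpen_simplexChart (K := K).measurableSet
  have hF : Measurable ((simplexChart K).indicator fun h => T (simplexPoint h)) :=
    (by fun_prop : Measurable fun h : centered K => T (simplexPoint h)).indicator hchart
  have hstay : ∀ h ∈ simplexChart K, q i • h + w ∈ simplexChart K := fun h hh l => by
    rw [← hw h]
    exact (mixture_mem_openSimplex hq
      (forall_update_mem_openSimplex hc (simplexPoint_mem_openSimplex hh))).1 l
  have hTmix : Measurable fun z => T (mixture q (Function.update c i z)) :=
    hT.comp (continuous_mixture.comp (continuous_const.prodMk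
      (continuous_const.update i continuous_id))).measurable
  rw [lintegral_simplexMeasure hTmix, lintegral_simplexMeasure hT]
  calc ∫⁻ h in simplexChart K, T (mixture q (Function.update c i (simplexPoint h)))
      ≤ ∫⁻ h, (simplexChart K).indicator (fun h => T (simplexPoint h)) (q i • h + w) := by
        rw [← lintegral_indicator hchart]
        refine lintegral_mono (Set.indicator_le fun h hh => ?_)
        rw [Set.indicator_of_mem (hstay h hh), hw]
    _ = ENNReal.ofReal |(q i ^ simplexDim K)⁻¹| * ∫⁻ h in simplexChart K, T (simplexPoint h) := by
        rw [← hdet, ← lintegral_indicator hchart]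
        exact lintegral_comp_linearMap_add (by rw [hdet]; positivity) w hF
    _ ≤ ENNReal.ofReal (η ^ simplexDim K)⁻¹ * ∫⁻ h in simplexChart K, T (simplexPoint h) := by
        rw [abs_of_pos (by positivity)]
        gcongr

/-! ### Stability of the inverse problem -/

lemma exists_norm_le_mulVec {C₀ : Matrix (Fin K) (Fin K) ℝ} (hdet : C₀.det ≠ 0) :
    ∃ B > 0, ∀ v : Fin K → ℝ, ‖v‖ ≤ B * ‖C₀ *ᵥ v‖ := by
  set T := (Matrix.toLin' C₀⁻¹).toContinuousLinearMap
  refine ⟨‖T‖ + 1, by positivity, fun v => ?_⟩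
  calc ‖v‖ = ‖T (C₀ *ᵥ v)‖ := by
        simp [T, Matrix.mulVec_mulVec, Matrix.nonsing_inv_mul _ (isUnit_iff_ne_zero.2 hdet)]
    _ ≤ ‖T‖ * ‖C₀ *ᵥ v‖ := T.le_opNorm _
    _ ≤ (‖T‖ + 1) * ‖C₀ *ᵥ v‖ := by gcongr; linarith

lemma abs_sub_lt_of_mem_ball {c c₀ : Fin K → ℝ} {r : ℝ} (h : c ∈ Metric.ball c₀ r) (l : Fin K) :
    |c l - c₀ l| < r := by
  rw [← Real.dist_eq]
  exact (dist_le_pi_dist c c₀ l).trans_lt h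

lemma norm_mixture_sub_le {c c₀ : Fin K → Fin K → ℝ} {r : ℝ} (hr : 0 < r)
    (hc : ∀ i, c i ∈ Metric.ball (c₀ i) r) (v : Fin K → ℝ) :
    ‖mixture v c - mixture v c₀‖ ≤ K * (r * ‖v‖) := by
  refine (pi_norm_le_iff_of_nonneg (by positivity)).2 fun l => ?_
  rw [Pi.sub_apply, mixture, mixture, ← Finset.sum_sub_distrib]
  calc ‖∑ i, (c i l * v i - c₀ i l * v i)‖ ≤ ∑ i, ‖c i l * v i - c₀ i l * v i‖ := norm_sum_le _ _
    _ ≤ ∑ _i : Fin K, r * ‖v‖ := by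
        refine Finset.sum_le_sum fun i _ => ?_
        rw [← sub_mul, norm_mul]
        exact mul_le_mul (abs_sub_lt_of_mem_ball (hc i) l).le (norm_le_pi_norm v i)
          (norm_nonneg _) hr.le
    _ = K * (r * ‖v‖) := by simp

lemma exists_norm_le_mixture [NeZero K] {C₀ : Matrix (Fin K) (Fin K) ℝ} (hdet : C₀.det ≠ 0) :
    ∃ B > 0, ∃ r > 0, ∀ c : Fin K → Fin K → ℝ, (∀ i, c i ∈ Metric.ball (columns C₀ i) r) →
      ∀ v, ‖v‖ ≤ B * ‖mixture v c‖ := by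
  have hK : (0 : ℝ) < K := by exact_mod_cast NeZero.pos K
  obtain ⟨B, hB, hbound⟩ := exists_norm_le_mulVec hdet
  refine ⟨2 * B, by positivity, 1 / (2 * B * K), by positivity, fun c hc v => ?_⟩
  have htriangle : ‖C₀ *ᵥ v‖ ≤ ‖mixture v c‖ + ‖mixture v c - C₀ *ᵥ v‖ := by
    simpa using norm_sub_le (mixture v c) (mixture v c - C₀ *ᵥ v)
  have hperturb : B * ‖mixture v c - C₀ *ᵥ v‖ ≤ ‖v‖ / 2 :=
    (mul_le_mul_of_nonneg_left (norm_mixture_sub_le (by positivity) hc v) hB.le).trans_eq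
      (by field_simp)
  linarith [hbound v, mul_le_mul_of_nonneg_left htriangle hB.le]

/-- The action of a column-stochastic matrix on centered vectors. -/
def mixtureMap (c : Fin K → Fin K → ℝ) (hc : ∀ i, ∑ l, c i l = 1) :
    centered K →ₗ[ℝ] centered K where
  toFun h := ⟨WithLp.toLp 2 (mixture (fun i => h.1 i) c), by
    rw [mem_centered]
    exact (sum_mixture hc).trans (sum_centered h)⟩
  map_add' h k := by
    ext l
    simp [mixture, mul_add, Finset.sum_add_distrib]
  map_smul' t h := by
    ext l
    simp [mixture, Finset.mul_sum, mul_left_comm]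

lemma mixtureMap_apply (c : Fin K → Fin K → ℝ) (hc : ∀ i, ∑ l, c i l = 1) (h : centered K)
    (l : Fin K) : (mixtureMap c hc h).1 l = mixture (fun i => h.1 i) c l := rfl

lemma exists_mixture_simplexPoint [NeZero K] {c : Fin K → Fin K → ℝ}
    (hc : ∀ i, ∑ l, c i l = 1) :
    ∃ w : centered K, ∀ h : centered K,
      mixture (simplexPoint h) c = simplexPoint (mixtureMap c hc h + w) := by
  have hsum : ∑ l, mixture (simplexPoint 0) c l = 1 := (sum_mixture hc).trans (sum_simplexPoint 0)
  refine ⟨displacement _ hsum, fun h => ?_⟩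
  have hsplit : mixture (simplexPoint h) c =
      mixture (simplexPoint 0) c + mixture (fun i => h.1 i) c := by
    ext l
    simp [mixture, simplexPoint, mul_add, Finset.sum_add_distrib]
  have hbase := simplexPoint_displacement _ hsum
  rw [hsplit]
  ext l
  rw [Pi.add_apply, ← congrFun hbase l, ← mixtureMap_apply c hc]
  simp only [simplexPoint, Submodule.coe_add, PiLp.add_apply]
  ring

lemma det_mixtureMap_ne_zero {c : Fin K → Fin K → ℝ} (hc : ∀ i, ∑ l, c i l = 1) {B : ℝ}
    (hB : ∀ v, ‖v‖ ≤ B * ‖mixture v c‖) : LinearMap.det (mixtureMap c hc) ≠ 0 := by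
  have hinj : Function.Injective (mixtureMap c hc) := by
    refine (injective_iff_map_eq_zero _).2 fun h hh => ?_
    have hmix : mixture (fun i => h.1 i) c = 0 := by
      ext l
      rw [← mixtureMap_apply c hc, hh]
      rfl
    have hnorm := hB fun i => h.1 i
    rw [hmix, norm_zero, mul_zero, norm_le_zero_iff] at hnorm
    ext i
    exact congrFun hnorm i
  exact ((LinearMap.isUnit_iff_isUnit_det _).1
    ((LinearMap.isUnit_iff_ker_eq_bot _).2 (LinearMap.ker_eq_bot.2 hinj))).ne_zero

lemma abs_det_mixtureMap_le [NeZero K] {c : Fin K → Fin K → ℝ} (hc : ∀ i, c i ∈ openSimplex K) :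
    |LinearMap.det (mixtureMap c fun i => (hc i).2)| ≤ (K * K : ℝ) ^ simplexDim K := by
  have hK : (0 : ℝ) < K := by exact_mod_cast NeZero.pos K
  refine abs_det_le_pow_of_norm_le _ (by positivity) fun h => ?_
  refine (norm_le_mul_of_abs_le _ (R := K * ‖h‖) fun l => ?_).trans_eq (by ring)
  calc |mixture (fun i => h.1 i) c l| ≤ ∑ i, |c i l * h.1 i| := Finset.abs_sum_le_sum_abs _ _
    _ ≤ ∑ _i : Fin K, ‖h‖ := by
        refine Finset.sum_le_sum fun i _ => ?_
        rw [abs_mul, abs_of_pos ((hc i).1 l)]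
        exact (mul_le_of_le_one_left (abs_nonneg _) (le_one_of_mem_openSimplex (hc i) l)).trans
          (abs_apply_le_norm h i)
    _ = K * ‖h‖ := by simp

lemma norm_le_one_of_mem_openSimplex {q : Fin K → ℝ} (hq : q ∈ openSimplex K) : ‖q‖ ≤ 1 :=
  (pi_norm_le_iff_of_nonneg zero_le_one).2 fun i => by
    rw [Real.norm_of_nonneg (hq.1 i).le]
    exact le_one_of_mem_openSimplex hq i

lemma norm_sub_le_of_mixture_mem_ball {q₀ : Fin K → ℝ} (hq₀ : q₀ ∈ openSimplex K)
    {c c₀ : Fin K → Fin K → ℝ} {B r : ℝ} (hB : 0 < B) (hr : 0 < r)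
    (hbound : ∀ v, ‖v‖ ≤ B * ‖mixture v c‖) (hc : ∀ i, c i ∈ Metric.ball (c₀ i) r)
    {q : Fin K → ℝ} (hq : mixture q c ∈ Metric.ball (mixture q₀ c₀) r) :
    ‖q - q₀‖ ≤ B * ((K + 1) * r) := by
  refine (hbound _).trans (mul_le_mul_of_nonneg_left ?_ hB.le)
  rw [mem_ball_iff_norm] at hq
  have hperturb : ‖mixture q₀ c - mixture q₀ c₀‖ ≤ K * r :=
    (norm_mixture_sub_le hr hc q₀).trans (mul_le_mul_of_nonneg_left
      (mul_le_of_le_one_right hr.le (norm_le_one_of_mem_openSimplex hq₀)) K.cast_nonneg)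
  calc ‖mixture (q - q₀) c‖
      = ‖(mixture q c - mixture q₀ c₀) - (mixture q₀ c - mixture q₀ c₀)‖ := by
        rw [sub_sub_sub_cancel_right, mixture_sub]
    _ ≤ ‖mixture q c - mixture q₀ c₀‖ + ‖mixture q₀ c - mixture q₀ c₀‖ := norm_sub_le _ _
    _ ≤ (K + 1) * r := by linarith

lemma exists_half_le_of_mixture_mem_ball [NeZero K] {q₀ : Fin K → ℝ} (hq₀ : q₀ ∈ openSimplex K)
    {C₀ : Matrix (Fin K) (Fin K) ℝ} (hdet : C₀.det ≠ 0) :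
    ∃ r > 0, ∀ c : Fin K → Fin K → ℝ, (∀ i, c i ∈ Metric.ball (columns C₀ i) r) →
      (∃ B, ∀ v, ‖v‖ ≤ B * ‖mixture v c‖) ∧
        ∀ q, mixture q c ∈ Metric.ball (C₀ *ᵥ q₀) r → ∀ i, q₀ i / 2 ≤ q i := by
  obtain ⟨B, hB, s, hs, hbound⟩ := exists_norm_le_mixture hdet
  obtain ⟨i₀, hi₀⟩ := Finite.exists_min q₀
  have hmin : 0 < q₀ i₀ := hq₀.1 i₀
  set r := min s (q₀ i₀ / (2 * (B * (K + 1))))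
  have hr : 0 < r := by positivity
  refine ⟨r, hr, fun c hc => ?_⟩
  have hboundc := hbound c fun i => Metric.ball_subset_ball (min_le_left _ _) (hc i)
  refine ⟨⟨B, hboundc⟩, fun q hq i => ?_⟩
  have hclose : ‖q - q₀‖ ≤ q₀ i₀ / 2 := by
    refine (norm_sub_le_of_mixture_mem_ball hq₀ hB hr hboundc hc hq).trans ?_
    calc B * ((K + 1) * r) ≤ B * ((K + 1) * (q₀ i₀ / (2 * (B * (K + 1))))) := by
          gcongr
          exact min_le_right _ _
      _ = q₀ i₀ / 2 := by field_simp
  have hcoord := (abs_le.1 ((norm_le_pi_norm (q - q₀) i).trans hclose)).1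
  rw [Pi.sub_apply] at hcoord
  linarith [hi₀ i]

/-- For fixed columns close to those of `C₀`, the law of the mixture has a density bounded below
near `C₀ *ᵥ q₀`. -/
lemma exists_le_lintegral_mixture [NeZero K] {q₀ : Fin K → ℝ} (hq₀ : q₀ ∈ openSimplex K)
    {C₀ : Matrix (Fin K) (Fin K) ℝ} (hdet : C₀.det ≠ 0) :
    ∃ r > 0, ∃ β > 0, ∃ κ : ℝ≥0∞, κ ≠ 0 ∧ ∀ c : Fin K → Fin K → ℝ,
      (∀ i, c i ∈ openSimplex K) → (∀ i, c i ∈ Metric.ball (columns C₀ i) r) →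
      ∀ T : (Fin K → ℝ) → ℝ≥0∞, Measurable T →
      κ * ∫⁻ p in Metric.ball (C₀ *ᵥ q₀) r, T p ∂simplexMeasure K ≤
        ∫⁻ q in coordsGe K β, T (mixture q c) ∂simplexMeasure K := by
  have hK : (0 : ℝ) < K := by exact_mod_cast NeZero.pos K
  obtain ⟨r, hr, hstable⟩ := exists_half_le_of_mixture_mem_ball hq₀ hdet
  obtain ⟨i₀, hi₀⟩ := Finite.exists_min q₀
  have hβ : 0 < q₀ i₀ / 2 := half_pos (hq₀.1 i₀)
  refine ⟨r, hr, q₀ i₀ / 2, hβ, ENNReal.ofReal ((K * K) ^ simplexDim K)⁻¹,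
    by simpa using by positivity, fun c hc hcr T hT => ?_⟩
  obtain ⟨⟨B, hbound⟩, hhalf⟩ := hstable c hcr
  obtain ⟨w, hw⟩ := exists_mixture_simplexPoint fun i => (hc i).2
  set A := mixtureMap c fun i => (hc i).2
  set F := (Metric.ball (C₀ *ᵥ q₀) r).indicator T
  have hF : Measurable F := hT.indicator Metric.isOpen_ball.measurableSet
  have hA : LinearMap.det A ≠ 0 := det_mixtureMap_ne_zero _ hbound
  have hTmix : Measurable fun q => T (mixture q c) :=
    hT.comp (continuous_mixture.comp (Continuous.prodMk_left c)).measurable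
  rw [← lintegral_indicator Metric.isOpen_ball.measurableSet, lintegral_simplexMeasure hF,
    ← lintegral_indicator (measurableSet_coordsGe _),
    lintegral_simplexMeasure (hTmix.indicator (measurableSet_coordsGe _))]
  calc ENNReal.ofReal ((K * K) ^ simplexDim K)⁻¹ * ∫⁻ h in simplexChart K, F (simplexPoint h)
      ≤ ENNReal.ofReal |(LinearMap.det A)⁻¹| * ∫⁻ h, F (simplexPoint h) := by
        rw [abs_inv]
        gcongr
        · exact abs_det_mixtureMap_le hc
        · exact Measure.restrict_le_self
    _ = ∫⁻ h, F (mixture (simplexPoint h) c) := by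
        simp_rw [hw]
        exact (lintegral_comp_linearMap_add hA w (by fun_prop)).symm
    _ ≤ ∫⁻ h in simplexChart K,
          (coordsGe K (q₀ i₀ / 2)).indicator (fun q => T (mixture q c)) (simplexPoint h) := by
        rw [← lintegral_indicator isOpen_simplexChart.measurableSet]
        refine lintegral_mono fun h => ?_
        by_cases hh : mixture (simplexPoint h) c ∈ Metric.ball (C₀ *ᵥ q₀) r
        · have hcoord : simplexPoint h ∈ coordsGe K (q₀ i₀ / 2) := fun i =>
            (by linarith [hi₀ i] : q₀ i₀ / 2 ≤ q₀ i / 2).trans (hhalf _ hh i)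
          have hchart : h ∈ simplexChart K := fun i => hβ.trans_le (hcoord i)
          simp [F, hh, hcoord, hchart]
        · simp [F, hh]

lemma mem_paramBall_of_abs_sub_le [NeZero K] {x : Param K} {q₀ : Fin K → ℝ}
    {C₀ : Matrix (Fin K) (Fin K) ℝ} {ρ ε : ℝ} (hρ : 0 < ρ) (hε : K * ρ < ε)
    (hq : ∀ i, |x.1 i - q₀ i| ≤ ρ) (hC : ∀ j i, |x.2 j i - C₀ j i| ≤ ρ) :
    x ∈ paramBall q₀ C₀ ε := by
  have hK : (1 : ℝ) ≤ K := by exact_mod_cast NeZero.pos K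
  have hε_pos : 0 < ε := hε.trans_le' (by positivity)
  have hsq : (K * ρ) ^ 2 < ε ^ 2 := pow_lt_pow_left₀ hε (by positivity) two_ne_zero
  constructor
  · refine (Real.sqrt_lt' hε_pos).2 (hsq.trans_le' ?_)
    calc ∑ i, (x.1 i - q₀ i) ^ 2 ≤ ∑ _i : Fin K, ρ ^ 2 :=
          Finset.sum_le_sum fun i _ => sq_le_sq' (neg_le_of_abs_le (hq i)) (le_of_abs_le (hq i))
      _ = K * ρ ^ 2 := by simp
      _ ≤ (K * ρ) ^ 2 := by nlinarith [sq_nonneg ρ]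
  · refine (Real.sqrt_lt' hε_pos).2 (hsq.trans_le' ?_)
    calc ∑ j, ∑ i, (x.2 j i - C₀ j i) ^ 2 ≤ ∑ _j : Fin K, ∑ _i : Fin K, ρ ^ 2 :=
          Finset.sum_le_sum fun j _ => Finset.sum_le_sum fun i _ =>
            sq_le_sq' (neg_le_of_abs_le (hC j i)) (le_of_abs_le (hC j i))
      _ = (K * ρ) ^ 2 := by
          simp only [Finset.sum_const, Finset.card_univ, Fintype.card_fin, nsmul_eq_mul]
          ring

lemma norm_mulVec_sub_le_of_mixture_mem_ball {q q₀ : Fin K → ℝ} {c : Fin K → Fin K → ℝ}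
    {C₀ : Matrix (Fin K) (Fin K) ℝ} {r : ℝ} (hr : 0 < r) (hq : q ∈ openSimplex K)
    (hc : ∀ i, c i ∈ openSimplex K) (hC₀ : ∀ i, columns C₀ i ∈ openSimplex K)
    (hmix : mixture q c ∈ Metric.ball (C₀ *ᵥ q₀) r)
    (hcr : ∀ i, c i ∈ Metric.ball (columns C₀ i) r ∨ q i < r) :
    ‖C₀ *ᵥ (q - q₀)‖ ≤ (K + 1) * r := by
  refine (pi_norm_le_iff_of_nonneg (by positivity)).2 fun l => ?_
  have hterm : ∀ i, |(c i l - columns C₀ i l) * q i| ≤ r := fun i => by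
    rw [abs_mul, abs_of_pos (hq.1 i)]
    rcases hcr i with hnear | hsmall
    · exact (mul_le_of_le_one_right (abs_nonneg _) (le_one_of_mem_openSimplex hq i)).trans
        (abs_sub_lt_of_mem_ball hnear l).le
    · refine (mul_le_of_le_one_left (hq.1 i).le (abs_le.2 ⟨?_, ?_⟩)).trans hsmall.le
      · linarith [(hc i).1 l, le_one_of_mem_openSimplex (hC₀ i) l]
      · linarith [(hC₀ i).1 l, le_one_of_mem_openSimplex (hc i) l]
  have hsum : |∑ i, (c i l - columns C₀ i l) * q i| ≤ K * r :=
    (Finset.abs_sum_le_sum_abs _ _).trans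
      ((Finset.sum_le_sum fun i _ => hterm i).trans_eq (by simp))
  have hsplit : (C₀ *ᵥ (q - q₀)) l = (mixture q c l - (C₀ *ᵥ q₀) l) -
      ∑ i, (c i l - columns C₀ i l) * q i := by
    simp only [sub_mul, Finset.sum_sub_distrib, Matrix.mulVec_sub, Pi.sub_apply,
      mulVec_eq_mixture, mixture]
    ring
  rw [hsplit, Real.norm_eq_abs]
  linarith [abs_sub (mixture q c l - (C₀ *ᵥ q₀) l) (∑ i, (c i l - columns C₀ i l) * q i),
    abs_sub_lt_of_mem_ball hmix l]

lemma exists_mem_paramBall [NeZero K] {q₀ : Fin K → ℝ} (hq₀ : q₀ ∈ openSimplex K)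
    {C₀ : Matrix (Fin K) (Fin K) ℝ} (hC₀ : ∀ i, columns C₀ i ∈ openSimplex K) (hdet : C₀.det ≠ 0)
    {ε : ℝ} (hε : 0 < ε) :
    ∃ r₁ > 0, ∀ r > 0, r ≤ r₁ → ∀ x : Param K, x.1 ∈ openSimplex K →
      (∀ i, columns x.2 i ∈ openSimplex K) →
      mixture x.1 (columns x.2) ∈ Metric.ball (C₀ *ᵥ q₀) r →
      (∀ i, columns x.2 i ∈ Metric.ball (columns C₀ i) r ∨ x.1 i < r) →
      x ∈ paramBall q₀ C₀ ε := by
  have hK : (0 : ℝ) < K := by exact_mod_cast NeZero.pos K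
  obtain ⟨B, hB, hbound⟩ := exists_norm_le_mulVec hdet
  obtain ⟨i₀, hi₀⟩ := Finite.exists_min q₀
  have hmin : 0 < q₀ i₀ := hq₀.1 i₀
  set R := B * (K + 1) + 1
  have : 0 < R := by positivity
  refine ⟨min (q₀ i₀ / (2 * R)) (ε / (2 * K * R)), by positivity,
    fun r hr hrr x hq hc hmix hcr => ?_⟩
  have hr_min : r * (2 * R) ≤ q₀ i₀ := (le_div_iff₀ (by positivity)).1 (hrr.trans (min_le_left _ _))
  have hr_ε : r * (2 * K * R) ≤ ε := (le_div_iff₀ (by positivity)).1 (hrr.trans (min_le_right _ _))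
  have hrR : r ≤ r * R := le_mul_of_one_le_right hr.le (le_add_of_nonneg_left (by positivity))
  have hq_close : ‖x.1 - q₀‖ ≤ r * R := by
    calc ‖x.1 - q₀‖ ≤ B * ‖C₀ *ᵥ (x.1 - q₀)‖ := hbound _
      _ ≤ B * ((K + 1) * r) := by
          gcongr
          exact norm_mulVec_sub_le_of_mixture_mem_ball hr hq hc hC₀ hmix hcr
      _ ≤ r * R := by simp only [R]; linarith
  have hq_coord : ∀ i, |x.1 i - q₀ i| ≤ r * R := fun i =>
    (norm_le_pi_norm (x.1 - q₀) i).trans hq_close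
  have hc_near : ∀ i, columns x.2 i ∈ Metric.ball (columns C₀ i) r := fun i =>
    (hcr i).resolve_right (not_lt.2 (by linarith [neg_le_of_abs_le (hq_coord i), hi₀ i]))
  have hKrR : 0 < K * (r * R) := by positivity
  exact mem_paramBall_of_abs_sub_le (by positivity) (by linarith) hq_coord fun j i =>
    (abs_sub_lt_of_mem_ball (hc_near i) j).le.trans hrR

/-! ### The likelihood in the coordinates `(C, C q)` -/

/-- The likelihood without its multinomial coefficients, as a function of the class prior `q` and
the columns `c` of the confusion matrix. -/
def likelihoodKernel (d : Data K) (q : Fin K → ℝ) (c : Fin K → Fin K → ℝ) : ℝ≥0∞ :=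
  (∏ i, monomialWeight (d.1 i) (c i)) * monomialWeight d.2 (mixture q c)

lemma measurable_likelihoodKernel (d : Data K) :
    Measurable fun y : (Fin K → ℝ) × (Fin K → Fin K → ℝ) => likelihoodKernel d y.1 y.2 := by
  unfold likelihoodKernel
  fun_prop

/-- The product of the local masses of the `K + 1` monomials in the likelihood, near the columns
`c₀ i` for the source counts and near `p` for the target counts. -/
def dataLocalMass (p : Fin K → ℝ) (c₀ : Fin K → Fin K → ℝ) (r : ℝ) (d : Data K) : ℝ≥0∞ :=
  localMass p r d.2 * ∏ i, localMass (c₀ i) r (d.1 i)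

/-- Simultaneous concentration of the `K + 1` monomials in the likelihood. -/
structure DataConcentrates (p : Fin K → ℝ) (c₀ : Fin K → Fin K → ℝ) (r : ℝ) (N γ : ℝ≥0∞)
    (d : Data K) : Prop where
  target : Concentrates p r N γ d.2
  column : ∀ i, Concentrates (c₀ i) r N γ (d.1 i)

section Kernel

variable [NeZero K] {p : Fin K → ℝ} {c₀ : Fin K → Fin K → ℝ} {r : ℝ} {N γ : ℝ≥0∞} {d : Data K}

lemma ae_pi_jacobianMeasure_mem_openSimplex :
    ∀ᵐ c ∂Measure.pi fun _ : Fin K => jacobianMeasure K, ∀ i, c i ∈ openSimplex K :=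
  ae_all_iff.2 fun _ =>
    Measure.tendsto_eval_ae_ae.eventually ae_jacobianMeasure_mem_openSimplex

lemma DataConcentrates.setLIntegral_mixture_notMem_ball_le (h : DataConcentrates p c₀ r N γ d)
    {q : Fin K → ℝ} (hq : q ∈ openSimplex K) :
    ∫⁻ c in {c | mixture q c ∉ Metric.ball p r}, likelihoodKernel d q c
        ∂Measure.pi (fun _ => jacobianMeasure K) ≤
      N ^ K * γ * dataLocalMass p c₀ r d := by
  have hmeas : MeasurableSet {c | mixture q c ∉ Metric.ball p r} :=
    (continuous_mixture.comp (Continuous.prodMk_right q)).measurable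
      Metric.isOpen_ball.measurableSet.compl
  calc ∫⁻ c in {c | mixture q c ∉ Metric.ball p r}, likelihoodKernel d q c
        ∂Measure.pi (fun _ => jacobianMeasure K)
      ≤ ∫⁻ c, (∏ i, monomialWeight (d.1 i) (c i)) * (γ * localMass p r d.2)
          ∂Measure.pi (fun _ => jacobianMeasure K) := by
        refine (setLIntegral_mono_ae' hmeas ?_).trans (setLIntegral_le_lintegral _ _)
        filter_upwards [ae_pi_jacobianMeasure_mem_openSimplex] with c hc hfar
        have hmix := mixture_mem_openSimplex hq hc
        exact mul_le_mul_right ((le_mul_of_one_le_left' (one_le_jacobianBound hmix)).trans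
          (h.target.far _ hmix hfar)) _
    _ = (∏ i, ∫⁻ z, monomialWeight (d.1 i) z ∂jacobianMeasure K) * (γ * localMass p r d.2) := by
        rw [lintegral_mul_const _ (by fun_prop),
          lintegral_pi_prod fun i => measurable_monomialWeight (d.1 i)]
    _ ≤ (∏ i, N * localMass (c₀ i) r (d.1 i)) * (γ * localMass p r d.2) := by
        gcongr with i
        exact (h.column i).total
    _ = N ^ K * γ * dataLocalMass p c₀ r d := by
        rw [Finset.prod_mul_distrib, Finset.prod_const, Finset.card_univ, Fintype.card_fin,
          dataLocalMass]
        ring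

lemma DataConcentrates.lintegral_far_update_le (h : DataConcentrates p c₀ r N γ d)
    {q : Fin K → ℝ} (hq : q ∈ openSimplex K) {i : Fin K} {η : ℝ} (hη : 0 < η) (hqi : η ≤ q i)
    {c : Fin K → Fin K → ℝ} (hc : ∀ j ≠ i, c j ∈ openSimplex K) :
    ∫⁻ z, monomialWeight (d.1 i) z * ((Metric.ball (c₀ i) r)ᶜ.indicator 1 z *
        monomialWeight d.2 (mixture q (Function.update c i z))) ∂jacobianMeasure K ≤
      γ * localMass (c₀ i) r (d.1 i) *
        (ENNReal.ofReal (η ^ simplexDim K)⁻¹ * (N * localMass p r d.2)) := by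
  have hball : MeasurableSet (Metric.ball (c₀ i) r)ᶜ := Metric.isOpen_ball.measurableSet.compl
  have : Measurable ((Metric.ball (c₀ i) r)ᶜ.indicator (1 : (Fin K → ℝ) → ℝ≥0∞)) :=
    measurable_one.indicator hball
  have hmix : Measurable fun z => monomialWeight d.2 (mixture q (Function.update c i z)) :=
    (measurable_monomialWeight _).comp (continuous_mixture.comp (continuous_const.prodMk
      (continuous_const.update i continuous_id))).measurable
  rw [lintegral_jacobianMeasure (by fun_prop)]
  calc ∫⁻ z, jacobianBound z * (monomialWeight (d.1 i) z *
        ((Metric.ball (c₀ i) r)ᶜ.indicator 1 z *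
          monomialWeight d.2 (mixture q (Function.update c i z)))) ∂simplexMeasure K
      ≤ ∫⁻ z, γ * localMass (c₀ i) r (d.1 i) *
          monomialWeight d.2 (mixture q (Function.update c i z)) ∂simplexMeasure K := by
        refine lintegral_mono_ae ?_
        filter_upwards [ae_simplexMeasure_mem_openSimplex] with z hz
        by_cases hzr : z ∈ Metric.ball (c₀ i) r
        · simp [hzr]
        · rw [Set.indicator_of_mem (Set.mem_compl hzr), Pi.one_apply, one_mul, ← mul_assoc]
          exact mul_le_mul_left ((h.column i).far z hz hzr) _
    _ = γ * localMass (c₀ i) r (d.1 i) *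
          ∫⁻ z, monomialWeight d.2 (mixture q (Function.update c i z)) ∂simplexMeasure K :=
        lintegral_const_mul _ hmix
    _ ≤ γ * localMass (c₀ i) r (d.1 i) * (ENNReal.ofReal (η ^ simplexDim K)⁻¹ *
          ∫⁻ z, monomialWeight d.2 z ∂simplexMeasure K) := by
        gcongr
        exact lintegral_mixture_update_le hq hc hη hqi (measurable_monomialWeight _)
    _ ≤ γ * localMass (c₀ i) r (d.1 i) *
          (ENNReal.ofReal (η ^ simplexDim K)⁻¹ * (N * localMass p r d.2)) := by
        gcongr
        exact h.target.lintegral_simplexMeasure_le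

lemma DataConcentrates.setLIntegral_column_notMem_ball_le (h : DataConcentrates p c₀ r N γ d)
    {q : Fin K → ℝ} (hq : q ∈ openSimplex K) {i : Fin K} {η : ℝ} (hη : 0 < η) (hqi : η ≤ q i) :
    ∫⁻ c in {c | c i ∉ Metric.ball (c₀ i) r}, likelihoodKernel d q c
        ∂Measure.pi (fun _ => jacobianMeasure K) ≤
      ENNReal.ofReal (η ^ simplexDim K)⁻¹ * (N ^ K * γ * dataLocalMass p c₀ r d) := by
  set far : (Fin K → ℝ) → ℝ≥0∞ := (Metric.ball (c₀ i) r)ᶜ.indicator 1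
  have hfar : Measurable far :=
    measurable_one.indicator Metric.isOpen_ball.measurableSet.compl
  have hmeas : MeasurableSet {c : Fin K → Fin K → ℝ | c i ∉ Metric.ball (c₀ i) r} :=
    measurable_pi_apply i Metric.isOpen_ball.measurableSet.compl
  calc ∫⁻ c in {c | c i ∉ Metric.ball (c₀ i) r}, likelihoodKernel d q c
        ∂Measure.pi (fun _ => jacobianMeasure K)
      ≤ ∫⁻ c, (∏ j, monomialWeight (d.1 j) (c j)) *
          (far (c i) * monomialWeight d.2 (mixture q c))
          ∂Measure.pi (fun _ => jacobianMeasure K) := by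
        rw [← lintegral_indicator hmeas]
        refine lintegral_mono (Set.indicator_le fun c hc => ?_)
        simp only [far, Set.indicator_of_mem (Set.mem_compl hc), Pi.one_apply, one_mul]
        exact le_rfl
    _ ≤ γ * localMass (c₀ i) r (d.1 i) *
          (ENNReal.ofReal (η ^ simplexDim K)⁻¹ * (N * localMass p r d.2)) *
          ∏ j ∈ Finset.univ.erase i, ∫⁻ z, monomialWeight (d.1 j) z ∂jacobianMeasure K := by
        refine lintegral_pi_prod_mul_le (fun j => measurable_monomialWeight (d.1 j))
          (by fun_prop) (fun _ => ae_jacobianMeasure_mem_openSimplex) i fun c hc => ?_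
        simpa only [Function.update_self] using h.lintegral_far_update_le hq hη hqi hc
    _ ≤ γ * localMass (c₀ i) r (d.1 i) *
          (ENNReal.ofReal (η ^ simplexDim K)⁻¹ * (N * localMass p r d.2)) *
          ∏ j ∈ Finset.univ.erase i, N * localMass (c₀ j) r (d.1 j) := by
        gcongr with j
        exact (h.column j).total
    _ = γ * (ENNReal.ofReal (η ^ simplexDim K)⁻¹ * localMass p r d.2) *
          ∏ j, N * localMass (c₀ j) r (d.1 j) := by
        rw [← Finset.mul_prod_erase _ _ (Finset.mem_univ i)]
        ring
    _ = ENNReal.ofReal (η ^ simplexDim K)⁻¹ * (N ^ K * γ * dataLocalMass p c₀ r d) := by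
        rw [Finset.prod_mul_distrib, Finset.prod_const, Finset.card_univ, Fintype.card_fin,
          dataLocalMass]
        ring

end Kernel

/-! ### Bounds for the joint prior -/

section JointPrior

variable [NeZero K] {L : Matrix (Fin K) (Fin K) ℝ} {aq bq aC bC : ℝ}

lemma jointPrior_univ_le_one (L : Matrix (Fin K) (Fin K) ℝ) (haq : 0 < aq) (hbq : 0 < bq)
    (haC : 0 < aC) (hbC : 0 < bC) : jointPrior L aq bq aC bC Set.univ ≤ 1 := by
  have := isFiniteMeasure_priorTarget L haq hbq
  have := isFiniteMeasure_priorConfusion L haC hbC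
  rw [jointPrior, ← Set.univ_prod_univ, Measure.prod_prod]
  exact mul_le_one' (priorTarget_univ_le_one L haq hbq) (priorConfusion_univ_le_one L haC hbC)

lemma ae_jointPrior_mem_openSimplex (L : Matrix (Fin K) (Fin K) ℝ) (haC : 0 < aC)
    (hbC : 0 < bC) :
    ∀ᵐ x ∂jointPrior L aq bq aC bC,
      x.1 ∈ openSimplex K ∧ ∀ i, columns x.2 i ∈ openSimplex K := by
  have := isFiniteMeasure_priorConfusion L haC hbC
  exact (Measure.quasiMeasurePreserving_fst.ae (ae_priorTarget_mem_openSimplex L aq bq)).and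
    (Measure.quasiMeasurePreserving_snd.ae (ae_priorConfusion_mem_openSimplex L aC bC))

lemma lintegral_jointPrior (L : Matrix (Fin K) (Fin K) ℝ) (haC : 0 < aC) (hbC : 0 < bC)
    {F : (Fin K → ℝ) × (Fin K → Fin K → ℝ) → ℝ≥0∞} (hF : Measurable F) :
    ∫⁻ x, F (x.1, columns x.2) ∂jointPrior L aq bq aC bC =
      ∫⁻ q, ∫⁻ c, F (q, c) ∂(priorConfusion L aC bC).map columns ∂priorTarget L aq bq := by
  have := isFiniteMeasure_priorConfusion L haC hbC
  rw [jointPrior, lintegral_prod _ (by fun_prop)]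
  exact lintegral_congr fun q =>
    (lintegral_map (hF.comp measurable_prodMk_left) measurable_columns).symm

lemma exists_setLIntegral_jointPrior_le (hL : ∀ v, 0 ≤ centeredForm L v) (haq : 0 < aq)
    (hbq : 0 < bq) (haC : 0 < aC) (hbC : 0 < bC) :
    ∃ M : ℝ≥0∞, M ≠ ⊤ ∧ ∀ (F : (Fin K → ℝ) × (Fin K → Fin K → ℝ) → ℝ≥0∞)
      (S : Set ((Fin K → ℝ) × (Fin K → Fin K → ℝ))) (D : ℝ≥0∞), Measurable F → MeasurableSet S →
      (∀ q ∈ openSimplex K, ∫⁻ c in Prod.mk q ⁻¹' S, F (q, c)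
        ∂Measure.pi (fun _ => jacobianMeasure K) ≤ D) →
      ∫⁻ x in {x | (x.1, columns x.2) ∈ S}, F (x.1, columns x.2) ∂jointPrior L aq bq aC bC ≤
        M * D := by
  obtain ⟨M, hM, hle⟩ := exists_map_columns_priorConfusion_le hL haC hbC
  refine ⟨M, hM, fun F S D hF hS hD => ?_⟩
  have hpre : MeasurableSet {x : Param K | (x.1, columns x.2) ∈ S} :=
    (by fun_prop : Measurable fun x : Param K => (x.1, columns x.2)) hS
  rw [← lintegral_indicator hpre]
  refine (lintegral_jointPrior L haC hbC (hF.indicator hS)).trans_le ?_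
  have hinner : ∀ q ∈ openSimplex K,
      ∫⁻ c, S.indicator F (q, c) ∂(priorConfusion L aC bC).map columns ≤ M * D := fun q hq => by
    refine (lintegral_mono' hle le_rfl).trans ?_
    rw [lintegral_smul_measure, smul_eq_mul]
    refine mul_le_mul_right ((lintegral_indicator (measurable_prodMk_left hS) _).trans_le
      (hD q hq)) _
  calc ∫⁻ q, ∫⁻ c, S.indicator F (q, c) ∂(priorConfusion L aC bC).map columns ∂priorTarget L aq bq
      ≤ ∫⁻ _q, M * D ∂priorTarget L aq bq :=
        lintegral_mono_ae ((ae_priorTarget_mem_openSimplex L aq bq).mono hinner)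
    _ ≤ M * D := by
        rw [lintegral_const]
        exact mul_le_of_le_one_right' (priorTarget_univ_le_one L haq hbq)

lemma exists_le_lintegral_priorTarget (hL : CenteredPosDef L) (haq : 0 < aq) (hbq : 0 < bq)
    {q₀ : Fin K → ℝ} (hq₀ : q₀ ∈ openSimplex K) {C₀ : Matrix (Fin K) (Fin K) ℝ}
    (hdet : C₀.det ≠ 0) :
    ∃ r₁ > 0, ∃ κ : ℝ≥0∞, κ ≠ 0 ∧ ∀ r ≤ r₁, ∀ d : Data K, ∀ c : Fin K → Fin K → ℝ,
      (∀ i, c i ∈ openSimplex K) →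
      κ * localMass (C₀ *ᵥ q₀) r d.2 *
          ∏ i, (Metric.ball (columns C₀ i) r).indicator (monomialWeight (d.1 i)) (c i) ≤
        ∫⁻ q, likelihoodKernel d q c ∂priorTarget L aq bq := by
  obtain ⟨r₁, hr₁, β, hβ, κ₁, hκ₁, hmix⟩ := exists_le_lintegral_mixture hq₀ hdet
  obtain ⟨κ₂, hκ₂, hprior⟩ := exists_le_priorTarget hL haq hbq hβ
  refine ⟨r₁, hr₁, κ₂ * κ₁, mul_ne_zero hκ₂ hκ₁, fun r hr d c hc => ?_⟩
  by_cases hnear : ∀ i, c i ∈ Metric.ball (columns C₀ i) r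
  swap
  · obtain ⟨i, hi⟩ := not_forall.1 hnear
    rw [Finset.prod_eq_zero (Finset.mem_univ i) (Set.indicator_of_notMem hi _), mul_zero]
    exact zero_le
  have hball : ∀ p : Fin K → ℝ, Metric.ball p r ⊆ Metric.ball p r₁ := fun _ =>
    Metric.ball_subset_ball hr
  have htarget : κ₂ * κ₁ * localMass (C₀ *ᵥ q₀) r d.2 ≤
      ∫⁻ q, monomialWeight d.2 (mixture q c) ∂priorTarget L aq bq :=
    calc κ₂ * κ₁ * localMass (C₀ *ᵥ q₀) r d.2
        ≤ κ₂ * (κ₁ * ∫⁻ p in Metric.ball (C₀ *ᵥ q₀) r₁, monomialWeight d.2 p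
            ∂simplexMeasure K) := by
          rw [mul_assoc]
          gcongr
          exact lintegral_mono_set (hball _)
      _ ≤ κ₂ * ∫⁻ q in coordsGe K β, monomialWeight d.2 (mixture q c) ∂simplexMeasure K := by
          gcongr
          exact hmix c hc (fun i => hball _ (hnear i)) _ (measurable_monomialWeight _)
      _ = ∫⁻ q, monomialWeight d.2 (mixture q c)
            ∂(κ₂ • (simplexMeasure K).restrict (coordsGe K β)) := by
          rw [lintegral_smul_measure, smul_eq_mul]
      _ ≤ ∫⁻ q, monomialWeight d.2 (mixture q c) ∂priorTarget L aq bq :=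
          lintegral_mono' hprior le_rfl
  have hindicator : ∀ i, (Metric.ball (columns C₀ i) r).indicator (monomialWeight (d.1 i)) (c i) =
      monomialWeight (d.1 i) (c i) := fun i => Set.indicator_of_mem (hnear i) _
  simp only [likelihoodKernel, hindicator]
  rw [lintegral_const_mul _ (by fun_prop), mul_comm (∏ i, _)]
  exact mul_le_mul_left htarget _

lemma exists_le_lintegral_map_columns (hL : CenteredPosDef L) (haC : 0 < aC) (hbC : 0 < bC)
    {c₀ : Fin K → Fin K → ℝ} (hc₀ : ∀ i, c₀ i ∈ openSimplex K) :
    ∃ r₁ > 0, ∃ κ : ℝ≥0∞, κ ≠ 0 ∧ ∀ r ≤ r₁, ∀ k : Fin K → Fin K → ℕ,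
      κ * ∏ i, localMass (c₀ i) r (k i) ≤
        ∫⁻ c, ∏ i, (Metric.ball (c₀ i) r).indicator (monomialWeight (k i)) (c i)
          ∂(priorConfusion L aC bC).map columns := by
  obtain ⟨⟨i₀, j₀⟩, hmin⟩ := Finite.exists_min fun ij : Fin K × Fin K => c₀ ij.1 ij.2
  have hβ : 0 < c₀ i₀ j₀ / 2 := half_pos ((hc₀ i₀).1 j₀)
  obtain ⟨κ, hκ, hprior⟩ := exists_le_map_columns_priorConfusion hL haC hbC hβ
  refine ⟨c₀ i₀ j₀ / 2, hβ, κ, hκ, fun r hr k => ?_⟩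
  have hhalf : ∀ i j, c₀ i₀ j₀ / 2 ≤ c₀ i j / 2 := fun i j => by linarith [hmin (i, j)]
  have hsub : ∀ i, Metric.ball (c₀ i) r ⊆ coordsGe K (c₀ i₀ j₀ / 2) := fun i c hc j =>
    (hhalf i j).trans (half_le_of_mem_ball (fun j => hr.trans (hhalf i j)) hc j)
  have hball : ∀ i, MeasurableSet (Metric.ball (c₀ i) r) := fun i =>
    Metric.isOpen_ball.measurableSet
  have hlocal : ∀ i, localMass (c₀ i) r (k i) =
      ∫⁻ z, (Metric.ball (c₀ i) r).indicator (monomialWeight (k i)) z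
        ∂(simplexMeasure K).restrict (coordsGe K (c₀ i₀ j₀ / 2)) := fun i => by
    rw [lintegral_indicator (hball i), Measure.restrict_restrict (hball i),
      Set.inter_eq_left.2 (hsub i), localMass]
  calc κ * ∏ i, localMass (c₀ i) r (k i)
      = ∫⁻ c, ∏ i, (Metric.ball (c₀ i) r).indicator (monomialWeight (k i)) (c i)
          ∂(κ • Measure.pi fun _ => (simplexMeasure K).restrict (coordsGe K (c₀ i₀ j₀ / 2))) := by
        rw [lintegral_smul_measure, smul_eq_mul,
          lintegral_pi_prod fun i => (measurable_monomialWeight (k i)).indicator (hball i)]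
        simp only [hlocal]
    _ ≤ _ := lintegral_mono' hprior le_rfl

lemma exists_le_lintegral_likelihoodKernel (hL : CenteredPosDef L) (haq : 0 < aq) (hbq : 0 < bq)
    (haC : 0 < aC) (hbC : 0 < bC) {q₀ : Fin K → ℝ} (hq₀ : q₀ ∈ openSimplex K)
    {C₀ : Matrix (Fin K) (Fin K) ℝ} (hC₀ : ∀ i, columns C₀ i ∈ openSimplex K)
    (hdet : C₀.det ≠ 0) :
    ∃ r₁ > 0, ∃ κ : ℝ≥0∞, κ ≠ 0 ∧ ∀ r ≤ r₁, ∀ d : Data K,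
      κ * dataLocalMass (C₀ *ᵥ q₀) (columns C₀) r d ≤
        ∫⁻ x, likelihoodKernel d x.1 (columns x.2) ∂jointPrior L aq bq aC bC := by
  have := isFiniteMeasure_priorTarget L haq hbq
  have := isFiniteMeasure_priorConfusion L haC hbC
  obtain ⟨r₁, hr₁, κ₁, hκ₁, htarget⟩ := exists_le_lintegral_priorTarget hL haq hbq hq₀ hdet
  obtain ⟨r₂, hr₂, κ₂, hκ₂, hcolumns⟩ := exists_le_lintegral_map_columns hL haC hbC hC₀
  refine ⟨min r₁ r₂, lt_min hr₁ hr₂, κ₁ * κ₂, mul_ne_zero hκ₁ hκ₂, fun r hr d => ?_⟩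
  have hmeas : MeasurableSet {c : Fin K → Fin K → ℝ | ∀ i, c i ∈ openSimplex K} := by
    rw [Set.ofPred_forall]
    exact MeasurableSet.iInter fun i => measurable_pi_apply i measurableSet_openSimplex
  have hmem : ∀ᵐ c ∂(priorConfusion L aC bC).map columns, ∀ i, c i ∈ openSimplex K :=
    (ae_map_iff measurable_columns.aemeasurable hmeas).2 (ae_priorConfusion_mem_openSimplex L aC bC)
  rw [lintegral_jointPrior L haC hbC (measurable_likelihoodKernel d),
    lintegral_lintegral_swap (measurable_likelihoodKernel d).aemeasurable]
  calc κ₁ * κ₂ * dataLocalMass (C₀ *ᵥ q₀) (columns C₀) r d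
      = κ₁ * localMass (C₀ *ᵥ q₀) r d.2 * (κ₂ * ∏ i, localMass (columns C₀ i) r (d.1 i)) := by
        rw [dataLocalMass]
        ring
    _ ≤ κ₁ * localMass (C₀ *ᵥ q₀) r d.2 *
          ∫⁻ c, ∏ i, (Metric.ball (columns C₀ i) r).indicator (monomialWeight (d.1 i)) (c i)
            ∂(priorConfusion L aC bC).map columns := by
        gcongr
        exact hcolumns r (hr.trans (min_le_right _ _)) d.1
    _ ≤ _ := (lintegral_const_mul_le _ _).trans
        (lintegral_mono_ae (hmem.mono (htarget r (hr.trans (min_le_left _ _)) d)))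

end JointPrior

/-! ### Chernoff bounds for the multinomial distribution -/

lemma multinomialMass_nonneg (n : ℕ) {p : Fin K → ℝ} (hp : ∀ j, 0 ≤ p j) (k : Fin K → ℕ) :
    0 ≤ multinomialMass n p k := by
  unfold multinomialMass
  split_ifs
  · exact mul_nonneg (Nat.cast_nonneg _) (Finset.prod_nonneg fun j _ => pow_nonneg (hp j) _)
  · exact le_rfl

lemma lintegral_multinomialLaw (n : ℕ) (p : Fin K → ℝ) (F : (Fin K → ℕ) → ℝ≥0∞) :
    ∫⁻ k, F k ∂multinomialLaw n p =
      ∑ k ∈ Finset.piAntidiag Finset.univ n, ENNReal.ofReal (multinomialMass n p k) * F k := by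
  simp [multinomialLaw, lintegral_finsetSum_measure, lintegral_smul_measure]

lemma ae_sum_eq_multinomialLaw (n : ℕ) (p : Fin K → ℝ) :
    ∀ᵐ k ∂multinomialLaw n p, ∑ j, k j = n := by
  rw [ae_iff, multinomialLaw]
  simp only [Measure.coe_finsetSum, Finset.sum_apply, Measure.coe_smul, Pi.smul_apply, smul_eq_mul]
  refine Finset.sum_eq_zero fun k hk => ?_
  rw [Measure.dirac_apply' _ MeasurableSet.of_discrete, Set.indicator_of_notMem, mul_zero]
  exact not_not_intro (Finset.mem_piAntidiag.1 hk).1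

lemma lintegral_prod_pow_multinomialLaw (n : ℕ) {p x : Fin K → ℝ} (hp : ∀ j, 0 ≤ p j)
    (hx : ∀ j, 0 ≤ x j) :
    ∫⁻ k, ENNReal.ofReal (∏ j, x j ^ k j) ∂multinomialLaw n p =
      ENNReal.ofReal ((∑ j, p j * x j) ^ n) := by
  rw [lintegral_multinomialLaw, Finset.sum_pow_eq_sum_piAntidiag]
  simp only [← ENNReal.ofReal_mul (multinomialMass_nonneg n hp _)]
  rw [← ENNReal.ofReal_sum_of_nonneg fun k _ => mul_nonneg (multinomialMass_nonneg n hp k)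
    (Finset.prod_nonneg fun j _ => pow_nonneg (hx j) _)]
  congr 1
  refine Finset.sum_congr rfl fun k hk => ?_
  rw [multinomialMass, if_pos (Finset.mem_piAntidiag.1 hk).1, mul_assoc,
    ← Finset.prod_mul_distrib]
  simp only [mul_pow]

lemma lintegral_exp_multinomialLaw (n : ℕ) {p : Fin K → ℝ} (hp : p ∈ stdSimplex ℝ (Fin K))
    (j : Fin K) (t : ℝ) :
    ∫⁻ k, ENNReal.ofReal (Real.exp (t * k j)) ∂multinomialLaw n p =
      ENNReal.ofReal ((1 + p j * (Real.exp t - 1)) ^ n) := by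
  set x : Fin K → ℝ := fun i => if i = j then Real.exp t else 1 with hx
  have hx₀ : ∀ i, 0 ≤ x i := fun i => by
    simp only [hx]
    split_ifs
    exacts [(Real.exp_pos t).le, zero_le_one]
  have hprod : ∀ k : Fin K → ℕ, Real.exp (t * k j) = ∏ i, x i ^ k i := fun k => by
    rw [Finset.prod_eq_single j (fun i _ hi => by simp [hx, hi]) (by simp), mul_comm,
      Real.exp_nat_mul]
    simp [hx]
  have hsum : ∑ i, p i * x i = 1 + p j * (Real.exp t - 1) := by
    have hsplit : ∀ i, p i * x i = p i + if i = j then p j * (Real.exp t - 1) else 0 := fun i => by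
      simp only [hx]
      split_ifs with hij
      · rw [hij]
        ring
      · ring
    simp only [hsplit, Finset.sum_add_distrib, hp.2, Finset.sum_ite_eq', Finset.mem_univ, if_true]
  simp only [hprod]
  rw [lintegral_prod_pow_multinomialLaw n hp.1 hx₀, hsum]

lemma one_add_mul_exp_sub_one_pow_le {x t : ℝ} (hx₀ : 0 ≤ x) (hx₁ : x ≤ 1) (ht : |t| ≤ 1)
    (n : ℕ) : (1 + x * (Real.exp t - 1)) ^ n ≤ Real.exp ((x * t + t ^ 2) * n) := by
  rw [mul_comm _ (n : ℝ), Real.exp_nat_mul]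
  refine pow_le_pow_left₀ (by nlinarith [Real.exp_pos t]) ?_ n
  have hexp : Real.exp t - 1 - t ≤ t ^ 2 := (abs_le.1 (Real.abs_exp_sub_one_sub_id_le ht)).2
  calc 1 + x * (Real.exp t - 1) ≤ x * t + t ^ 2 + 1 := by nlinarith [sq_nonneg t]
    _ ≤ Real.exp (x * t + t ^ 2) := Real.add_one_le_exp _

lemma multinomialLaw_tail_le (n : ℕ) {p : Fin K → ℝ} (hp : p ∈ stdSimplex ℝ (Fin K))
    (j : Fin K) {t : ℝ} (ht : |t| ≤ 1) (s : ℝ) :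
    multinomialLaw n p {k | s * n ≤ t * (k j - n * p j)} ≤
      ENNReal.ofReal (Real.exp ((t ^ 2 - s) * n)) := by
  have hpj : p j ≤ 1 := (mem_Icc_of_mem_stdSimplex hp j).2
  set a : ℝ := t * (n * p j) + s * n
  have hmarkov := mul_meas_ge_le_lintegral (μ := multinomialLaw n p)
    (f := fun k => ENNReal.ofReal (Real.exp (t * k j))) (measurable_of_countable _)
    (ENNReal.ofReal (Real.exp a))
  calc multinomialLaw n p {k | s * n ≤ t * (k j - n * p j)}
      ≤ multinomialLaw n p {k | ENNReal.ofReal (Real.exp a) ≤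
          ENNReal.ofReal (Real.exp (t * k j))} := by
        refine measure_mono fun k (hk : s * n ≤ _) => ENNReal.ofReal_le_ofReal ?_
        exact Real.exp_le_exp.2 (by linarith)
    _ = ENNReal.ofReal (Real.exp (-a)) * (ENNReal.ofReal (Real.exp a) * multinomialLaw n p
          {k | ENNReal.ofReal (Real.exp a) ≤ ENNReal.ofReal (Real.exp (t * k j))}) := by
        rw [← mul_assoc, ← ENNReal.ofReal_mul (Real.exp_pos _).le, ← Real.exp_add, neg_add_cancel,
          Real.exp_zero, ENNReal.ofReal_one, one_mul]
    _ ≤ ENNReal.ofReal (Real.exp (-a)) *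
          ENNReal.ofReal (Real.exp ((p j * t + t ^ 2) * n)) := by
        gcongr
        refine hmarkov.trans ?_
        rw [lintegral_exp_multinomialLaw n hp]
        exact ENNReal.ofReal_le_ofReal (one_add_mul_exp_sub_one_pow_le (hp.1 j) hpj ht n)
    _ = ENNReal.ofReal (Real.exp ((t ^ 2 - s) * n)) := by
        rw [← ENNReal.ofReal_mul (Real.exp_pos _).le, ← Real.exp_add]
        congr 2
        ring

lemma multinomialLaw_compl_typicalCounts_le (n : ℕ) {p : Fin K → ℝ}
    (hp : p ∈ stdSimplex ℝ (Fin K)) {s : ℝ} (hs : 0 < s) (hs2 : s ≤ 2) :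
    multinomialLaw n p (typicalCounts n p s)ᶜ ≤
      K * (2 * ENNReal.ofReal (Real.exp (-(s ^ 2 / 4) * n))) := by
  have hcover : (typicalCounts n p s)ᶜ ⊆ {k | ¬ ∑ j, k j = n} ∪ ⋃ j : Fin K,
      ({k | s ^ 2 / 2 * n ≤ s / 2 * (k j - n * p j)} ∪
        {k | s ^ 2 / 2 * n ≤ -(s / 2) * (k j - n * p j)}) := by
    intro k hk
    by_contra hout
    simp only [Set.mem_union, Set.mem_iUnion, Set.mem_ofPred_eq, not_or, not_exists, not_le,
      not_not] at hout
    refine hk ⟨hout.1, fun j => abs_le.2 ?_⟩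
    obtain ⟨hupper, hlower⟩ := hout.2 j
    constructor <;> nlinarith
  -- the choice `t = ± s / 2` minimizes `t ^ 2 - s |t|`
  have htail : ∀ j, ∀ t ∈ ({s / 2, -(s / 2)} : Set ℝ),
      multinomialLaw n p {k | s ^ 2 / 2 * n ≤ t * (k j - n * p j)} ≤
        ENNReal.ofReal (Real.exp (-(s ^ 2 / 4) * n)) := by
    rintro j t (rfl | rfl)
    · refine (multinomialLaw_tail_le n hp j (by rw [abs_of_pos] <;> linarith) _).trans_eq ?_
      ring_nf
    · refine (multinomialLaw_tail_le n hp j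
        (by rw [abs_neg, abs_of_pos] <;> linarith) _).trans_eq ?_
      ring_nf
  refine (measure_mono hcover).trans ((measure_union_le _ _).trans ?_)
  rw [ae_iff.1 (ae_sum_eq_multinomialLaw n p), zero_add]
  refine (measure_iUnion_fintype_le _ _).trans ?_
  refine (Finset.sum_le_card_nsmul _ _ (2 * ENNReal.ofReal (Real.exp (-(s ^ 2 / 4) * n)))
    fun j _ => ?_).trans_eq (by simp)
  rw [two_mul]
  exact (measure_union_le _ _).trans (add_le_add (htail j _ (by simp)) (htail j _ (by simp)))

lemma tendsto_multinomialLaw_compl_typicalCounts {p : Fin K → ℝ} (hp : p ∈ stdSimplex ℝ (Fin K))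
    {s : ℝ} (hs : 0 < s) :
    Tendsto (fun n => multinomialLaw n p (typicalCounts n p s)ᶜ) atTop (𝓝 0) := by
  set s' := min s 2
  have hs' : 0 < s' := by positivity
  have hexp : Tendsto (fun n : ℕ => ENNReal.ofReal (Real.exp (-(s' ^ 2 / 4) * n))) atTop
      (𝓝 0) := by
    rw [← ENNReal.ofReal_zero]
    exact ENNReal.tendsto_ofReal (Real.tendsto_exp_atBot.comp
      (tendsto_natCast_atTop_atTop.const_mul_atTop_of_neg (neg_neg_of_pos (by positivity))))
  have hbound : Tendsto (fun n : ℕ =>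
      (K : ℝ≥0∞) * (2 * ENNReal.ofReal (Real.exp (-(s' ^ 2 / 4) * n)))) atTop (𝓝 0) := by
    simpa using ENNReal.Tendsto.const_mul (a := (K : ℝ≥0∞))
      (ENNReal.Tendsto.const_mul (a := (2 : ℝ≥0∞)) hexp (Or.inr (by simp))) (Or.inr (by simp))
  refine tendsto_of_tendsto_of_tendsto_of_le_of_le tendsto_const_nhds hbound (fun _ => zero_le)
    fun n => (measure_mono ?_).trans
      (multinomialLaw_compl_typicalCounts_le n hp hs' (min_le_right _ _))
  exact Set.compl_subset_compl.2 (typicalCounts_mono n p (min_le_left _ _))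

/-! ### Typical data -/

/-- The data in which all `K + 1` count vectors are typical: the source counts `d.1 i` for the
probability vector `c₀ i`, the target counts `d.2` for `p`. -/
def typicalData (nS : Fin K → ℕ) (nT : ℕ) (p : Fin K → ℝ) (c₀ : Fin K → Fin K → ℝ) (s : ℝ) :
    Set (Data K) :=
  {d | (∀ i, d.1 i ∈ typicalCounts (nS i) (c₀ i) s) ∧ d.2 ∈ typicalCounts nT p s}

section Data

variable {nS : Fin K → ℕ} {nT : ℕ} {x : Param K}

lemma ae_sum_eq_dataLaw (hS : ∀ i, columns x.2 i ∈ stdSimplex ℝ (Fin K))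
    (hT : x.2 *ᵥ x.1 ∈ stdSimplex ℝ (Fin K)) :
    ∀ᵐ d ∂dataLaw nS nT x, (∀ i, ∑ j, d.1 i j = nS i) ∧ ∑ j, d.2 j = nT := by
  have := fun i => isProbabilityMeasure_multinomialLaw (nS i) (hS i)
  have := isProbabilityMeasure_multinomialLaw nT hT
  have hcol : ∀ᵐ k ∂Measure.pi fun i => multinomialLaw (nS i) (columns x.2 i),
      ∀ i, ∑ j, k i j = nS i := eventually_all.2 fun i =>
    (Measure.tendsto_eval_ae_ae (μ := fun i => multinomialLaw (nS i) (columns x.2 i))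
      (i := i)).eventually (ae_sum_eq_multinomialLaw (nS i) (columns x.2 i))
  exact (Measure.quasiMeasurePreserving_fst.ae hcol).and
    (Measure.quasiMeasurePreserving_snd.ae (ae_sum_eq_multinomialLaw nT _))

lemma dataLaw_compl_typicalData_le (hS : ∀ i, columns x.2 i ∈ stdSimplex ℝ (Fin K))
    (hT : x.2 *ᵥ x.1 ∈ stdSimplex ℝ (Fin K)) (s : ℝ) :
    dataLaw nS nT x (typicalData nS nT (x.2 *ᵥ x.1) (columns x.2) s)ᶜ ≤
      ∑ i, multinomialLaw (nS i) (columns x.2 i) (typicalCounts (nS i) (columns x.2 i) s)ᶜ +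
        multinomialLaw nT (x.2 *ᵥ x.1) (typicalCounts nT (x.2 *ᵥ x.1) s)ᶜ := by
  have := fun i => isProbabilityMeasure_multinomialLaw (nS i) (hS i)
  have := isProbabilityMeasure_multinomialLaw nT hT
  set μ := Measure.pi fun i => multinomialLaw (nS i) (columns x.2 i)
  set A := fun i => typicalCounts (nS i) (columns x.2 i) s
  set B := typicalCounts nT (x.2 *ᵥ x.1) s
  have hcover : (typicalData nS nT (x.2 *ᵥ x.1) (columns x.2) s)ᶜ ⊆
      (⋃ i, Prod.fst ⁻¹' (Function.eval i ⁻¹' (A i)ᶜ)) ∪ Prod.snd ⁻¹' Bᶜ := by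
    intro d hd
    by_contra hout
    simp only [Set.mem_union, Set.mem_iUnion, Set.mem_preimage, Set.mem_compl_iff, not_or,
      not_exists, not_not, Function.eval] at hout
    exact hd hout
  change μ.prod (multinomialLaw nT (x.2 *ᵥ x.1)) _ ≤ _
  refine (measure_mono hcover).trans ((measure_union_le _ _).trans (add_le_add ?_ ?_))
  · refine (measure_iUnion_fintype_le _ _).trans (Finset.sum_le_sum fun i _ => ?_)
    rw [measurePreserving_fst.measure_preimage
      (MeasurableSet.of_discrete.preimage (measurable_pi_apply i)).nullMeasurableSet,
      (measurePreserving_eval _ i).measure_preimage MeasurableSet.of_discrete.nullMeasurableSet]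
  · rw [measurePreserving_snd.measure_preimage MeasurableSet.of_discrete.nullMeasurableSet]

lemma tendsto_dataLaw_compl_typicalData {ι : Type*} {l : Filter ι} {nS : ι → Fin K → ℕ}
    {nT : ι → ℕ} (hnS : ∀ i, Tendsto (fun m => nS m i) l atTop) (hnT : Tendsto nT l atTop)
    (hS : ∀ i, columns x.2 i ∈ stdSimplex ℝ (Fin K)) (hT : x.2 *ᵥ x.1 ∈ stdSimplex ℝ (Fin K))
    {s : ℝ} (hs : 0 < s) :
    Tendsto (fun m => dataLaw (nS m) (nT m) x
      (typicalData (nS m) (nT m) (x.2 *ᵥ x.1) (columns x.2) s)ᶜ) l (𝓝 0) := by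
  have hbound := (tendsto_finsetSum Finset.univ fun i _ =>
    (tendsto_multinomialLaw_compl_typicalCounts (hS i) hs).comp (hnS i)).add
    ((tendsto_multinomialLaw_compl_typicalCounts hT hs).comp hnT)
  simp only [Finset.sum_const_zero, add_zero] at hbound
  exact tendsto_of_tendsto_of_tendsto_of_le_of_le tendsto_const_nhds hbound (fun _ => zero_le)
    fun _ => dataLaw_compl_typicalData_le hS hT s

end Data

lemma eventually_forall_le_half {ι : Type*} [Finite ι] {p : ι → ℝ} (hp : ∀ i, 0 < p i) :
    ∀ᶠ r in 𝓝[>] 0, ∀ i, r ≤ p i / 2 :=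
  eventually_all.2 fun i => (eventually_le_nhds (half_pos (hp i))).filter_mono nhdsWithin_le_nhds

lemma exists_dataConcentrates [NeZero K] {p : Fin K → ℝ} {c₀ : Fin K → Fin K → ℝ}
    (hp : p ∈ openSimplex K) (hc₀ : ∀ i, c₀ i ∈ openSimplex K) {r : ℝ} (hr : 0 < r)
    (hrp : ∀ j, r ≤ p j / 2) (hrc : ∀ i j, r ≤ c₀ i j / 2) {ι : Type*} {l : Filter ι}
    {nS : ι → Fin K → ℕ} {nT : ι → ℕ} (hnS : ∀ i, Tendsto (fun m => nS m i) l atTop)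
    (hnT : Tendsto nT l atTop) :
    ∃ N : ℝ≥0∞, N ≠ ⊤ ∧ ∃ γ : ι → ℝ≥0∞, Tendsto γ l (𝓝 0) ∧ ∃ s > 0, ∀ᶠ m in l,
      ∀ d ∈ typicalData (nS m) (nT m) p c₀ s, DataConcentrates p c₀ r N (γ m) d := by
  obtain ⟨N₀, hN₀, γ₀, hγ₀, s₀, hs₀, n₀, htarget⟩ := exists_concentrates hp hr hrp
  choose N₁ hN₁ γ₁ hγ₁ s₁ hs₁ n₁ hcolumn using fun i => exists_concentrates (hc₀ i) hr (hrc i)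
  obtain ⟨i₀, hmin⟩ := Finite.exists_min s₁
  refine ⟨N₀ + ∑ i, N₁ i, ENNReal.add_ne_top.2 ⟨hN₀, ENNReal.sum_ne_top.2 fun i _ => hN₁ i⟩,
    fun m => γ₀ (nT m) + ∑ i, γ₁ i (nS m i), ?_, min s₀ (s₁ i₀), lt_min hs₀ (hs₁ i₀), ?_⟩
  · simpa using (hγ₀.comp hnT).add
      (tendsto_finsetSum Finset.univ fun i _ => (hγ₁ i).comp (hnS i))
  filter_upwards [hnT.eventually_ge_atTop n₀,
    eventually_all.2 fun i => (hnS i).eventually_ge_atTop (n₁ i)] with m hT hS d hd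
  have hle : ∀ (f : Fin K → ℝ≥0∞) (y : ℝ≥0∞) (i : Fin K), f i ≤ y + ∑ j, f j := fun f _ i =>
    (Finset.single_le_sum (fun _ _ => zero_le) (Finset.mem_univ i)).trans le_add_self
  exact ⟨(htarget _ hT _ (typicalCounts_mono _ _ (min_le_left _ _) hd.2)).mono
      le_self_add le_self_add,
    fun i => (hcolumn i _ (hS i) _ (typicalCounts_mono _ _
      ((min_le_right _ _).trans (hmin i)) (hd.1 i))).mono (hle N₁ _ i)
      (hle (fun j => γ₁ j (nS m j)) _ i)⟩

/-! ### Posterior consistency -/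

lemma measurableSet_paramBall (q₀ : Fin K → ℝ) (C₀ : Matrix (Fin K) (Fin K) ℝ) (ε : ℝ) :
    MeasurableSet (paramBall q₀ C₀ ε) := by
  have hq : Measurable fun x : Param K => √(∑ i, (x.1 i - q₀ i) ^ 2) := by fun_prop
  have hC : Measurable fun x : Param K => √(∑ j, ∑ i, (x.2 j i - C₀ j i) ^ 2) :=
    (Finset.measurable_sum _ fun j _ => Finset.measurable_sum _ fun i _ =>
      ((((measurable_matrix_apply j i).comp measurable_snd).sub_const _).pow_const 2)).sqrt
  exact (measurableSet_lt hq measurable_const).inter (measurableSet_lt hC measurable_const)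

/-- The product of the multinomial coefficients in the likelihood. -/
def likelihoodConst (d : Data K) : ℝ≥0∞ :=
  ENNReal.ofReal ((∏ i, (Nat.multinomial Finset.univ (d.1 i) : ℝ)) *
    Nat.multinomial Finset.univ d.2)

lemma likelihoodConst_ne_zero (d : Data K) : likelihoodConst d ≠ 0 := by
  rw [likelihoodConst, Ne, ENNReal.ofReal_eq_zero, not_le]
  have hpos : ∀ k : Fin K → ℕ, (0 : ℝ) < Nat.multinomial Finset.univ k := fun k => by
    exact_mod_cast Nat.multinomial_pos _ _
  exact mul_pos (Finset.prod_pos fun i _ => hpos _) (hpos _)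

lemma ofReal_likelihood {nS : Fin K → ℕ} {nT : ℕ} {d : Data K}
    (hS : ∀ i, ∑ j, d.1 i j = nS i) (hT : ∑ j, d.2 j = nT) {x : Param K}
    (hx : ∀ i, columns x.2 i ∈ openSimplex K) :
    ENNReal.ofReal (likelihood nS nT d x) =
      likelihoodConst d * likelihoodKernel d x.1 (columns x.2) := by
  have hnonneg : ∀ i, 0 ≤ ∏ j, columns x.2 i j ^ d.1 i j := fun i =>
    Finset.prod_nonneg fun j _ => pow_nonneg ((hx i).1 j).le _
  simp only [likelihoodConst, likelihoodKernel, monomialWeight]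
  rw [← ENNReal.ofReal_prod_of_nonneg fun i _ => hnonneg i,
    ← ENNReal.ofReal_mul (Finset.prod_nonneg fun i _ => hnonneg i),
    ← ENNReal.ofReal_mul (by positivity)]
  congr 1
  simp only [likelihood, multinomialMass, hS, hT, if_true, Finset.prod_mul_distrib]
  rw [mulVec_eq_mixture]
  simp only [columns]
  ring

lemma likelihoodKernel_le_one [NeZero K] (d : Data K) {q : Fin K → ℝ} {c : Fin K → Fin K → ℝ}
    (hq : q ∈ openSimplex K) (hc : ∀ i, c i ∈ openSimplex K) : likelihoodKernel d q c ≤ 1 :=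
  mul_le_one' (Finset.prod_le_one (fun _ _ => zero_le) fun i _ => monomialWeight_le_one _ (hc i))
    (monomialWeight_le_one _ (mixture_mem_openSimplex hq hc))

section LocalMass

variable [NeZero K] {p : Fin K → ℝ} {c₀ : Fin K → Fin K → ℝ} {r : ℝ}

lemma dataLocalMass_ne_zero (hp : p ∈ openSimplex K) (hc₀ : ∀ i, c₀ i ∈ openSimplex K)
    (hr : 0 < r) (d : Data K) : dataLocalMass p c₀ r d ≠ 0 :=
  mul_ne_zero (localMass_ne_zero hp hr _)
    (Finset.prod_ne_zero_iff.2 fun i _ => localMass_ne_zero (hc₀ i) hr _)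

lemma dataLocalMass_ne_top (p : Fin K → ℝ) (c₀ : Fin K → Fin K → ℝ) (r : ℝ) (d : Data K) :
    dataLocalMass p c₀ r d ≠ ⊤ :=
  ENNReal.mul_ne_top (localMass_ne_top p r _)
    (ENNReal.prod_ne_top fun i _ => localMass_ne_top (c₀ i) r _)

end LocalMass

section Posterior

variable [NeZero K] {L : Matrix (Fin K) (Fin K) ℝ} {aq bq aC bC : ℝ}

lemma posterior_apply (L : Matrix (Fin K) (Fin K) ℝ) (haC : 0 < aC) (hbC : 0 < bC)
    {nS : Fin K → ℕ} {nT : ℕ} {d : Data K} (hS : ∀ i, ∑ j, d.1 i j = nS i)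
    (hT : ∑ j, d.2 j = nT) {A : Set (Param K)} (hA : MeasurableSet A) :
    posterior (jointPrior L aq bq aC bC) nS nT d A =
      (∫⁻ x, likelihoodKernel d x.1 (columns x.2) ∂jointPrior L aq bq aC bC)⁻¹ *
        ∫⁻ x in A, likelihoodKernel d x.1 (columns x.2) ∂jointPrior L aq bq aC bC := by
  have hae : ∀ᵐ x ∂jointPrior L aq bq aC bC, ENNReal.ofReal (likelihood nS nT d x) =
      likelihoodConst d * likelihoodKernel d x.1 (columns x.2) :=
    (ae_jointPrior_mem_openSimplex L haC hbC).mono fun x hx => ofReal_likelihood hS hT hx.2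
  have htop : likelihoodConst d ≠ ⊤ := ENNReal.ofReal_ne_top
  have hzero := likelihoodConst_ne_zero d
  rw [posterior, Measure.smul_apply, withDensity_apply _ hA, smul_eq_mul, lintegral_congr_ae hae,
    lintegral_congr_ae (ae_restrict_of_ae hae), lintegral_const_mul' _ _ htop,
    lintegral_const_mul' _ _ htop, ENNReal.mul_inv (Or.inl hzero) (Or.inl htop),
    mul_mul_mul_comm, ENNReal.inv_mul_cancel hzero htop, one_mul]

lemma lintegral_likelihoodKernel_le_one (L : Matrix (Fin K) (Fin K) ℝ) (haq : 0 < aq)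
    (hbq : 0 < bq) (haC : 0 < aC) (hbC : 0 < bC) (d : Data K) :
    ∫⁻ x, likelihoodKernel d x.1 (columns x.2) ∂jointPrior L aq bq aC bC ≤ 1 :=
  calc ∫⁻ x, likelihoodKernel d x.1 (columns x.2) ∂jointPrior L aq bq aC bC
      ≤ ∫⁻ _, 1 ∂jointPrior L aq bq aC bC :=
        lintegral_mono_ae ((ae_jointPrior_mem_openSimplex L haC hbC).mono fun _ hx =>
          likelihoodKernel_le_one d hx.1 hx.2)
    _ ≤ 1 := lintegral_one.trans_le (jointPrior_univ_le_one L haq hbq haC hbC)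

variable {q₀ : Fin K → ℝ} {C₀ : Matrix (Fin K) (Fin K) ℝ}

lemma lintegral_likelihoodKernel_ne_zero (hL : CenteredPosDef L) (haq : 0 < aq) (hbq : 0 < bq)
    (haC : 0 < aC) (hbC : 0 < bC) (hq₀ : q₀ ∈ openSimplex K)
    (hC₀ : ∀ i, columns C₀ i ∈ openSimplex K) (hdet : C₀.det ≠ 0) (d : Data K) :
    ∫⁻ x, likelihoodKernel d x.1 (columns x.2) ∂jointPrior L aq bq aC bC ≠ 0 := by
  obtain ⟨r, hr, κ, hκ, hle⟩ :=
    exists_le_lintegral_likelihoodKernel hL haq hbq haC hbC hq₀ hC₀ hdet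
  have hpos : κ * dataLocalMass (C₀ *ᵥ q₀) (columns C₀) r d ≠ 0 :=
    mul_ne_zero hκ (dataLocalMass_ne_zero (mixture_mem_openSimplex hq₀ hC₀) hC₀ hr d)
  exact ((pos_iff_ne_zero.2 hpos).trans_le (hle r le_rfl d)).ne'

lemma ae_isProbabilityMeasure_posterior (hL : CenteredPosDef L) (haq : 0 < aq) (hbq : 0 < bq)
    (haC : 0 < aC) (hbC : 0 < bC) (hq₀ : q₀ ∈ openSimplex K)
    (hC₀ : ∀ i, columns C₀ i ∈ openSimplex K) (hdet : C₀.det ≠ 0) (nS : Fin K → ℕ) (nT : ℕ) :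
    ∀ᵐ d ∂dataLaw nS nT (q₀, C₀),
      IsProbabilityMeasure (posterior (jointPrior L aq bq aC bC) nS nT d) := by
  have htotals := ae_sum_eq_dataLaw (nS := nS) (nT := nT) (x := (q₀, C₀))
    (fun i => openSimplex_subset_stdSimplex (hC₀ i))
    (openSimplex_subset_stdSimplex (mixture_mem_openSimplex hq₀ hC₀))
  filter_upwards [htotals] with d hd
  refine ⟨?_⟩
  rw [posterior_apply L haC hbC hd.1 hd.2 MeasurableSet.univ, Measure.restrict_univ]
  exact ENNReal.inv_mul_cancel
    (lintegral_likelihoodKernel_ne_zero hL haq hbq haC hbC hq₀ hC₀ hdet d)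
    (ne_top_of_le_ne_top ENNReal.one_ne_top
      (lintegral_likelihoodKernel_le_one L haq hbq haC hbC d))

lemma eventually_compl_paramBall_subset (hq₀ : q₀ ∈ openSimplex K)
    (hC₀ : ∀ i, columns C₀ i ∈ openSimplex K) (hdet : C₀.det ≠ 0) {ε : ℝ} (hε : 0 < ε) :
    ∀ᶠ r in 𝓝[>] 0, ∀ x : Param K, x.1 ∈ openSimplex K → (∀ i, columns x.2 i ∈ openSimplex K) →
      x ∉ paramBall q₀ C₀ ε → mixture x.1 (columns x.2) ∉ Metric.ball (C₀ *ᵥ q₀) r ∨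
        ∃ i, r ≤ x.1 i ∧ columns x.2 i ∉ Metric.ball (columns C₀ i) r := by
  obtain ⟨r₁, hr₁, hmem⟩ := exists_mem_paramBall hq₀ hC₀ hdet hε
  filter_upwards [Ioc_mem_nhdsGT hr₁] with r hr x hq hc hx
  by_contra! hout
  exact hx (hmem r hr.1 hr.2 x hq hc hout.1 fun i =>
    or_iff_not_imp_right.2 fun hi => hout.2 i (not_lt.1 hi))

lemma exists_setLIntegral_far_le (hL : ∀ v, 0 ≤ centeredForm L v) (haq : 0 < aq) (hbq : 0 < bq)
    (haC : 0 < aC) (hbC : 0 < bC) (p : Fin K → ℝ) (c₀ : Fin K → Fin K → ℝ) {r : ℝ} (hr : 0 < r) :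
    ∃ M : ℝ≥0∞, M ≠ ⊤ ∧ ∀ N γ d, DataConcentrates p c₀ r N γ d →
      ∫⁻ x in {x | mixture x.1 (columns x.2) ∉ Metric.ball p r},
        likelihoodKernel d x.1 (columns x.2) ∂jointPrior L aq bq aC bC ≤
          M * (N ^ K * γ * dataLocalMass p c₀ r d) ∧
      ∀ i, ∫⁻ x in {x | r ≤ x.1 i ∧ columns x.2 i ∉ Metric.ball (c₀ i) r},
        likelihoodKernel d x.1 (columns x.2) ∂jointPrior L aq bq aC bC ≤
          M * (N ^ K * γ * dataLocalMass p c₀ r d) := by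
  obtain ⟨M, hM, hle⟩ := exists_setLIntegral_jointPrior_le hL haq hbq haC hbC
  set R := ENNReal.ofReal (r ^ simplexDim K)⁻¹
  refine ⟨M * (1 + R), by finiteness, fun N γ d h => ?_⟩
  set E := dataLocalMass p c₀ r d
  set S₀ : Set ((Fin K → ℝ) × (Fin K → Fin K → ℝ)) := {y | mixture y.1 y.2 ∉ Metric.ball p r}
  set S : Fin K → Set ((Fin K → ℝ) × (Fin K → Fin K → ℝ)) := fun i =>
    {y | r ≤ y.1 i ∧ y.2 i ∉ Metric.ball (c₀ i) r}
  have hball : ∀ c : Fin K → ℝ, MeasurableSet (Metric.ball c r)ᶜ := fun _ =>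
    Metric.isOpen_ball.measurableSet.compl
  have hS₀ : MeasurableSet S₀ := continuous_mixture.measurable (hball p)
  have hS : ∀ i, MeasurableSet (S i) := fun i =>
    have hweight : Measurable fun y : (Fin K → ℝ) × (Fin K → Fin K → ℝ) => y.1 i := by fun_prop
    have hcolumn : Measurable fun y : (Fin K → ℝ) × (Fin K → Fin K → ℝ) => y.2 i := by fun_prop
    (hweight measurableSet_Ici).inter (hcolumn (hball (c₀ i)))
  refine ⟨(hle _ S₀ _ (measurable_likelihoodKernel d) hS₀ fun q hq =>
    h.setLIntegral_mixture_notMem_ball_le hq).trans ?_, fun i =>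
    (hle _ (S i) (R * (N ^ K * γ * E)) (measurable_likelihoodKernel d) (hS i)
      fun q hq => ?_).trans ?_⟩
  · gcongr
    exact le_mul_of_one_le_right' le_self_add
  · by_cases hqi : r ≤ q i
    · exact (lintegral_mono_set fun c hc => hc.2).trans
        (h.setLIntegral_column_notMem_ball_le hq hr hqi)
    · rw [show Prod.mk q ⁻¹' S i = ∅ from Set.eq_empty_of_forall_notMem fun c hc => hqi hc.1,
        Measure.restrict_empty, lintegral_zero_measure]
      exact zero_le
  · rw [← mul_assoc]
    gcongr
    exact le_add_self

lemma eventually_setLIntegral_compl_paramBall_le (hL : ∀ v, 0 ≤ centeredForm L v) (haq : 0 < aq)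
    (hbq : 0 < bq) (haC : 0 < aC) (hbC : 0 < bC) (hq₀ : q₀ ∈ openSimplex K)
    (hC₀ : ∀ i, columns C₀ i ∈ openSimplex K) (hdet : C₀.det ≠ 0) {ε : ℝ} (hε : 0 < ε) :
    ∀ᶠ r in 𝓝[>] 0, ∀ N : ℝ≥0∞, N ≠ ⊤ → ∃ M : ℝ≥0∞, M ≠ ⊤ ∧ ∀ γ d,
      DataConcentrates (C₀ *ᵥ q₀) (columns C₀) r N γ d →
      ∫⁻ x in (paramBall q₀ C₀ ε)ᶜ, likelihoodKernel d x.1 (columns x.2)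
        ∂jointPrior L aq bq aC bC ≤ M * γ * dataLocalMass (C₀ *ᵥ q₀) (columns C₀) r d := by
  filter_upwards [eventually_compl_paramBall_subset hq₀ hC₀ hdet hε, self_mem_nhdsWithin]
    with r hcover hr N hN
  obtain ⟨M, hM, hle⟩ :=
    exists_setLIntegral_far_le hL haq hbq haC hbC (C₀ *ᵥ q₀) (columns C₀) hr
  refine ⟨(1 + K) * (M * N ^ K), by finiteness, fun γ d h => ?_⟩
  obtain ⟨htarget, hcolumn⟩ := hle N γ d h
  set E := dataLocalMass (C₀ *ᵥ q₀) (columns C₀) r d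
  set F := fun x : Param K => likelihoodKernel d x.1 (columns x.2)
  set ρ := jointPrior L aq bq aC bC
  set A₀ : Set (Param K) := {x | mixture x.1 (columns x.2) ∉ Metric.ball (C₀ *ᵥ q₀) r}
  set A : Fin K → Set (Param K) := fun i =>
    {x | r ≤ x.1 i ∧ columns x.2 i ∉ Metric.ball (columns C₀ i) r}
  have hsub : ∀ᵐ x ∂ρ, x ∈ (paramBall q₀ C₀ ε)ᶜ → x ∈ A₀ ∪ ⋃ i, A i := by
    filter_upwards [ae_jointPrior_mem_openSimplex L haC hbC] with x hx hout
    exact (hcover x hx.1 hx.2 hout).imp id fun hi => Set.mem_iUnion.2 hi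
  calc ∫⁻ x in (paramBall q₀ C₀ ε)ᶜ, F x ∂ρ
      ≤ ∫⁻ x in A₀, F x ∂ρ + ∑ i, ∫⁻ x in A i, F x ∂ρ := by
        refine (lintegral_mono_set' hsub).trans ((lintegral_union_le _ _ _).trans ?_)
        gcongr
        exact (lintegral_iUnion_le _ _).trans_eq (tsum_fintype _)
    _ ≤ M * (N ^ K * γ * E) + ∑ _i : Fin K, M * (N ^ K * γ * E) :=
        add_le_add htarget (Finset.sum_le_sum fun i _ => hcolumn i)
    _ = (1 + K) * (M * N ^ K) * γ * E := by
        rw [Finset.sum_const, Finset.card_univ, Fintype.card_fin, nsmul_eq_mul]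
        ring

lemma eventually_posterior_compl_paramBall_le (hL : CenteredPosDef L) (haq : 0 < aq)
    (hbq : 0 < bq) (haC : 0 < aC) (hbC : 0 < bC) (hq₀ : q₀ ∈ openSimplex K)
    (hC₀ : ∀ i, columns C₀ i ∈ openSimplex K) (hdet : C₀.det ≠ 0) {ε : ℝ} (hε : 0 < ε) :
    ∀ᶠ r in 𝓝[>] 0, ∀ N : ℝ≥0∞, N ≠ ⊤ → ∃ M : ℝ≥0∞, M ≠ ⊤ ∧ ∀ γ nS nT d,
      (∀ i, ∑ j, d.1 i j = nS i) → ∑ j, d.2 j = nT →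
      DataConcentrates (C₀ *ᵥ q₀) (columns C₀) r N γ d →
      posterior (jointPrior L aq bq aC bC) nS nT d (paramBall q₀ C₀ ε)ᶜ ≤ M * γ := by
  obtain ⟨r₁, hr₁, κ, hκ, hevidence⟩ :=
    exists_le_lintegral_likelihoodKernel hL haq hbq haC hbC hq₀ hC₀ hdet
  filter_upwards [Ioc_mem_nhdsGT hr₁, eventually_setLIntegral_compl_paramBall_le hL.nonneg haq hbq
    haC hbC hq₀ hC₀ hdet hε] with r hr hfar N hN
  obtain ⟨M, hM, hfar⟩ := hfar N hN
  refine ⟨κ⁻¹ * M, ENNReal.mul_ne_top (ENNReal.inv_ne_top.2 hκ) hM, fun γ nS nT d hS hT h => ?_⟩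
  set E := dataLocalMass (C₀ *ᵥ q₀) (columns C₀) r d
  have hE₀ : E ≠ 0 := dataLocalMass_ne_zero (mixture_mem_openSimplex hq₀ hC₀) hC₀ hr.1 d
  have hE : E ≠ ⊤ := dataLocalMass_ne_top _ _ r d
  rw [posterior_apply L haC hbC hS hT (measurableSet_paramBall q₀ C₀ ε).compl]
  calc _ ≤ (κ * E)⁻¹ * (M * γ * E) :=
        mul_le_mul' (ENNReal.inv_le_inv.2 (hevidence r hr.2 d)) (hfar γ d h)
    _ = κ⁻¹ * M * γ * (E⁻¹ * E) := by
        rw [ENNReal.mul_inv (Or.inr hE) (Or.inr hE₀)]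
        ring
    _ = κ⁻¹ * M * γ := by rw [ENNReal.inv_mul_cancel hE₀ hE, mul_one]

lemma exists_posterior_compl_paramBall_le (hL : CenteredPosDef L) (haq : 0 < aq) (hbq : 0 < bq)
    (haC : 0 < aC) (hbC : 0 < bC) (hq₀ : q₀ ∈ openSimplex K)
    (hC₀ : ∀ i, columns C₀ i ∈ openSimplex K) (hdet : C₀.det ≠ 0) {ε : ℝ} (hε : 0 < ε)
    {ι : Type*} {l : Filter ι} {nS : ι → Fin K → ℕ} {nT : ι → ℕ}
    (hnS : ∀ i, Tendsto (fun m => nS m i) l atTop) (hnT : Tendsto nT l atTop) :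
    ∃ γ : ι → ℝ≥0∞, Tendsto γ l (𝓝 0) ∧ ∃ s > 0, ∀ᶠ m in l,
      ∀ d ∈ typicalData (nS m) (nT m) (C₀ *ᵥ q₀) (columns C₀) s,
        posterior (jointPrior L aq bq aC bC) (nS m) (nT m) d (paramBall q₀ C₀ ε)ᶜ ≤ γ m := by
  have hp₀ : C₀ *ᵥ q₀ ∈ openSimplex K := mixture_mem_openSimplex hq₀ hC₀
  obtain ⟨r, hr, hrp, hrc, hposterior⟩ := (eventually_mem_nhdsWithin.and <|
    (eventually_forall_le_half hp₀.1).and <|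
    (eventually_all.2 fun i => eventually_forall_le_half (hC₀ i).1).and <|
    eventually_posterior_compl_paramBall_le hL haq hbq haC hbC hq₀ hC₀ hdet hε).exists
  obtain ⟨N, hN, γ, hγ, s, hs, htypical⟩ :=
    exists_dataConcentrates hp₀ hC₀ hr hrp hrc hnS hnT
  obtain ⟨M, hM, hle⟩ := hposterior N hN
  refine ⟨fun m => M * γ m, ?_, s, hs, ?_⟩
  · simpa using ENNReal.Tendsto.const_mul hγ (Or.inr hM)
  · filter_upwards [htypical] with m hm d hd
    exact hle _ _ _ d (fun i => (hd.1 i).1) hd.2.1 (hm d hd)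

end Posterior

end LabelShift

end

theorem mainTheorem3_general {K : ℕ} {L : Matrix (Fin K) (Fin K) ℝ}
    (hL : LabelShift.CenteredPosDef L)
    {aq bq aC bC : ℝ} (haq : 0 < aq) (hbq : 0 < bq) (haC : 0 < aC) (hbC : 0 < bC)
    {q₀ : Fin K → ℝ} (hq₀ : q₀ ∈ LabelShift.openSimplex K)
    {C₀ : Matrix (Fin K) (Fin K) ℝ}
    (hC₀ : ∀ i, LabelShift.columns C₀ i ∈ LabelShift.openSimplex K) (hdet : C₀.det ≠ 0)
    {ι : Type*} {l : Filter ι} {nS : ι → Fin K → ℕ} {nT : ι → ℕ}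
    (hnS : ∀ i, Tendsto (fun m => nS m i) l atTop) (hnT : Tendsto nT l atTop) :
    (∀ m, ∀ᵐ d ∂(LabelShift.dataLaw (nS m) (nT m) (q₀, C₀)),
      IsProbabilityMeasure
        (LabelShift.posterior (LabelShift.jointPrior L aq bq aC bC) (nS m) (nT m) d)) ∧
    ∀ ε : ℝ, 0 < ε → ∀ δ : ℝ≥0∞, 0 < δ →
      Tendsto
        (fun m => LabelShift.dataLaw (nS m) (nT m) (q₀, C₀)
          {d | δ < LabelShift.posterior (LabelShift.jointPrior L aq bq aC bC)
            (nS m) (nT m) d (LabelShift.paramBall q₀ C₀ ε)ᶜ})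
        l (𝓝 0) := by
  have : NeZero K := LabelShift.neZero_of_mem_openSimplex hq₀
  refine ⟨fun m => LabelShift.ae_isProbabilityMeasure_posterior hL haq hbq haC hbC hq₀ hC₀ hdet
    (nS m) (nT m), fun ε hε δ hδ => ?_⟩
  obtain ⟨γ, hγ, s, hs, hposterior⟩ :=
    LabelShift.exists_posterior_compl_paramBall_le hL haq hbq haC hbC hq₀ hC₀ hdet hε hnS hnT
  have htypical := LabelShift.tendsto_dataLaw_compl_typicalData hnS hnT (x := (q₀, C₀))
    (fun i => LabelShift.openSimplex_subset_stdSimplex (hC₀ i))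
    (LabelShift.openSimplex_subset_stdSimplex (LabelShift.mixture_mem_openSimplex hq₀ hC₀)) hs
  refine tendsto_of_tendsto_of_tendsto_of_le_of_le' tendsto_const_nhds htypical
    (Eventually.of_forall fun _ => zero_le) ?_
  filter_upwards [hposterior, hγ.eventually_lt_const hδ] with m hle hlt
  refine measure_mono fun d hd hgood => ?_
  exact ((hle d hgood).trans_lt hlt).not_gt hd

theorem mainTheorem3 (K : ℕ) (hK : 2 ≤ K)
    (W : Matrix (Fin K) (Fin K) ℝ) (hWsymm : W.IsSymm)
    (hW01 : ∀ i j, W i j ∈ Set.Icc (0 : ℝ) 1)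
    (hWconn : (LabelShift.similarityGraph W).Connected)
    (aq bq aC bC : ℝ) (haq : 0 < aq) (hbq : 0 < bq) (haC : 0 < aC) (hbC : 0 < bC)
    (q₀ : Fin K → ℝ) (hq₀ : q₀ ∈ LabelShift.openSimplex K)
    (C₀ : Matrix (Fin K) (Fin K) ℝ) (hC₀ : ∀ j i, C₀ j i ∈ Set.Ioo (0 : ℝ) 1)
    (hC₀sum : ∀ i, ∑ j, C₀ j i = 1) (hC₀det : C₀.det ≠ 0)
    (nS : ℕ → Fin K → ℕ) (nT : ℕ → ℕ)
    (hnS : ∀ i, Tendsto (fun m => nS m i) atTop atTop) (hnT : Tendsto nT atTop atTop) :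
    (∀ m, ∀ᵐ d ∂(LabelShift.dataLaw (nS m) (nT m) (q₀, C₀)),
      IsProbabilityMeasure
        (LabelShift.posterior (LabelShift.jointPrior (LabelShift.laplacian W) aq bq aC bC)
          (nS m) (nT m) d)) ∧
    ∀ ε : ℝ, 0 < ε → ∀ δ : ℝ≥0∞, 0 < δ →
      Tendsto
        (fun m => LabelShift.dataLaw (nS m) (nT m) (q₀, C₀)
          {d | δ < LabelShift.posterior
            (LabelShift.jointPrior (LabelShift.laplacian W) aq bq aC bC)
            (nS m) (nT m) d (LabelShift.paramBall q₀ C₀ ε)ᶜ})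
        atTop (𝓝 0) := by
  exact mainTheorem3_general
    (LabelShift.centeredPosDef_laplacian hWsymm (fun i j => (hW01 i j).1) hWconn)
    haq hbq haC hbC hq₀ (fun i => ⟨fun j => (hC₀ j i).1, hC₀sum i⟩) hC₀det hnS hnT
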